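/- Let $1\le p<\infty$. A Banach lattice $E$ is regarded as a metric structure whose universe is its closed unit ball $M$ with the metric $d(x,y)=\|x-y\|$, in the language $L$ with symbols $0$, $-x$, $\frac{x+y}{2}$, $|x|$ and $\|x\|$. The models of $ALpL$ are the nonzero atomless $L_p$ Banach lattices, i.e. those Banach lattices which are isometrically lattice isomorphic to $L_p(\Omega,\mu)\neq 0$ with $\mu$ atomless. Let $L_P=L\cup\{P\}$ with $P$ a $1$-Lipschitz unary predicate symbol. A beautiful pair of models of $ALpL$ is an $L_P$-structure $(M,P)$ with $M\models ALpL$, in which $P(M)=\{x\in M: P(x)=0\}$ is an elementary substructure of $M$, $P(x)=d(x,P(M))$ for all $x\in M$, $P(M)$ is $\aleph_1$-saturated, and $M$ is $\aleph_0$-saturated over $P(M)$. Let $ALpL_P$ be the continuous first order $L_P$-theory of all beautiful pairs of models of $ALpL$; its models are the Banach lattices with a $1$-Lipschitz predicate $P$ on their unit ball which satisfy this theory. Proposition. The theory $ALpL_P$ is $\aleph_0$-categorical up to arbitrarily small perturbations of $P$: if $(M,P)$ and $(N,Q)$ are separable models of $ALpL_P$, then for every $\varepsilon>0$ there is an isomorphism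 $\rho\colon M\to N$ of Banach lattices (a surjective linear isometry preserving the lattice operations, restricted to the unit balls) such that $|P(f)-Q(\rho(f))|<\varepsilon$ for all $f\in M$. More precisely, for every $0<r<1$ there is such a $\rho$ with $$|P(f)-Q(\rho(f))|\le\zeta(r):=1-(1-r)^{1/p}+r^{1/p}\qquad (f\in M).$$ Moreover, let $M_1$ and $M_2$ be the closed unit balls of $L_p([0,1]\times[0,1])$ and $L_p([0,2]\times[0,1])$ (Lebesgue measure), and let $N_1\subseteq M_1$, $N_2\subseteq M_2$ be the copies of the unit ball of $L_p([0,1])$ consisting of the functions which on $[0,1]\times[0,1]$ depend only on the first coordinate and which vanish elsewhere. Then for every $0<r<1$ the formula $$(\rho f)(x,y)=\begin{cases}(1-r)^{-1/p}\,f\bigl(x,\tfrac{y-r}{1-r}\bigr), & y\ge r,\\ r^{-1/p}\,f\bigl(x+1,\tfrac{y}{r}\bigr), & y<r,\end{cases}$$ defines an isomorphism of Banach lattices $\rho\colon L_p([0,2]\times[0,1])\to L_p([0,1]\times[0,1])$ with $|d(f,N_2)-d(\rho(f),N_1)|\le\zeta(r)$ for all $f\in M_2$. -/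

import Mathlib

open MeasureTheory Set
open scoped ENNReal

noncomputable section

/-- A (real) Banach lattice: a complete normed vector lattice whose norm is a lattice norm. -/
class IsBanachLattice (E : Type*) [NormedAddCommGroup E] [NormedSpace ℝ E] [Lattice E] : Prop
    extends IsOrderedAddMonoid E, IsOrderedModule ℝ E, HasSolidNorm E, CompleteSpace E

/-- An isomorphism of Banach lattices: a surjective linear isometry preserving both lattice
operations. -/
structure BanachLatticeIso (E F : Type*) [NormedAddCommGroup E] [NormedSpace ℝ E] [Lattice E]
    [NormedAddCommGroup F] [NormedSpace ℝ F] [Lattice F] extends E ≃ₗᵢ[ℝ] F where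
  map_sup' : ∀ x y : E, toFun (x ⊔ y) = toFun x ⊔ toFun y
  map_inf' : ∀ x y : E, toFun (x ⊓ y) = toFun x ⊓ toFun y

/-- The closed unit ball of `E`, the universe of the metric structure attached to `E`. -/
abbrev UnitBall (E : Type*) [NormedAddCommGroup E] : Type _ := Metric.closedBall (0 : E) 1

/-- The restriction of an isomorphism of Banach lattices to the unit balls. -/
def BanachLatticeIso.ballMap {E F : Type*} [NormedAddCommGroup E] [NormedSpace ℝ E] [Lattice E]
    [NormedAddCommGroup F] [NormedSpace ℝ F] [Lattice F] (ρ : BanachLatticeIso E F)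
    (x : UnitBall E) : UnitBall F :=
  ⟨ρ.toLinearIsometryEquiv x.1, by
    have hx := x.2
    rw [mem_closedBall_zero_iff] at hx ⊢
    rwa [LinearIsometryEquiv.norm_map]⟩

/-! ### Continuous logic for unit balls of Banach lattices

The language of Banach lattices has the function symbols `0`, `-x`, `(x + y) / 2` and `|x|`, the
norm as a predicate symbol, and the distance. Further unary predicate symbols are indexed by a
type `K`: `Empty` gives the language `L` of Banach lattices itself, and `Unit` gives the language
`L_P` with one new unary predicate symbol `P`. -/

namespace BLat

section Operations

variable {E : Type*} [NormedAddCommGroup E] [NormedSpace ℝ E] [Lattice E]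

/-- The interpretation of the symbol `0`. -/
def zero : UnitBall E := ⟨0, by simp⟩

/-- The interpretation of the symbol `-x`. -/
def neg (x : UnitBall E) : UnitBall E :=
  ⟨-x.1, by
    have hx := x.2
    rw [mem_closedBall_zero_iff] at hx ⊢
    rwa [norm_neg]⟩

/-- The interpretation of the symbol `(x + y) / 2`. -/
def mid (x y : UnitBall E) : UnitBall E :=
  ⟨(1 / 2 : ℝ) • (x.1 + y.1), by
    have hx := x.2
    have hy := y.2
    rw [mem_closedBall_zero_iff] at hx hy ⊢
    rw [norm_smul, Real.norm_of_nonneg (by norm_num)]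
    have h := norm_add_le x.1 y.1
    linarith⟩

/-- The interpretation of the symbol `|x|`. -/
def abs [IsBanachLattice E] (x : UnitBall E) : UnitBall E :=
  ⟨|x.1|, by
    have hx := x.2
    rw [mem_closedBall_zero_iff] at hx ⊢
    rwa [norm_abs_eq_norm]⟩

end Operations

/-- Terms in the variables `0, …, n - 1`. -/
inductive Term (n : ℕ) : Type
  | var : Fin n → Term n
  | zero : Term n
  | neg : Term n → Term n
  | mid : Term n → Term n → Term n
  | abs : Term n → Term n

/-- Formulas of continuous logic with free variables `0, …, n - 1`. Connectives are arbitrary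
continuous functions; a quantifier binds variable `0` and shifts the others. -/
inductive Formula (K : Type) : ℕ → Type
  | norm {n : ℕ} : Term n → Formula K n
  | dist {n : ℕ} : Term n → Term n → Formula K n
  | pred {n : ℕ} : K → Term n → Formula K n
  | conn {n m : ℕ} : C(Fin m → ℝ, ℝ) → (Fin m → Formula K n) → Formula K n
  | sup {n : ℕ} : Formula K (n + 1) → Formula K n
  | inf {n : ℕ} : Formula K (n + 1) → Formula K n

section Semantics

variable {E : Type*} [NormedAddCommGroup E] [NormedSpace ℝ E] [Lattice E] [IsBanachLattice E]

/-- The value of a term. -/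
def Term.eval {n : ℕ} (v : Fin n → UnitBall E) : Term n → UnitBall E
  | .var i => v i
  | .zero => BLat.zero
  | .neg t => BLat.neg (t.eval v)
  | .mid s t => BLat.mid (s.eval v) (t.eval v)
  | .abs t => BLat.abs (t.eval v)

/-- The value of a formula in the structure with universe `S`, a subset of the unit ball of `E`
(the whole structure is `S = univ`); the extra predicate symbols are interpreted by `I`. -/
def Formula.eval {K : Type} (S : Set (UnitBall E)) (I : K → UnitBall E → ℝ) :
    {n : ℕ} → Formula K n → (Fin n → UnitBall E) → ℝ
  | _, .norm t, v => ‖(t.eval v).1‖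
  | _, .dist s t, v => Dist.dist (s.eval v) (t.eval v)
  | _, .pred k t, v => I k (t.eval v)
  | _, .conn u φ, v => u (fun i => (φ i).eval S I v)
  | _, .sup φ, v => ⨆ x : S, φ.eval S I (Fin.cons x.1 v)
  | _, .inf φ, v => ⨅ x : S, φ.eval S I (Fin.cons x.1 v)

/-- The value of a formula of the language of Banach lattices in the structure with
universe `S`. -/
def Formula.evalL {n : ℕ} (φ : Formula Empty n) (S : Set (UnitBall E))
    (v : Fin n → UnitBall E) : ℝ :=
  φ.eval S (fun k _ => k.elim) v

/-- `S` is (the universe of) a substructure of the unit ball of `E`. -/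
structure IsSubstructure (S : Set (UnitBall E)) : Prop where
  closed : IsClosed S
  zero_mem : BLat.zero ∈ S
  neg_mem : ∀ x ∈ S, BLat.neg x ∈ S
  mid_mem : ∀ x ∈ S, ∀ y ∈ S, BLat.mid x y ∈ S
  abs_mem : ∀ x ∈ S, BLat.abs x ∈ S

/-- `S` is an elementary substructure of the unit ball of `E`. -/
def IsElementarySubstructure (S : Set (UnitBall E)) : Prop :=
  IsSubstructure S ∧ ∀ (n : ℕ) (φ : Formula Empty n) (v : Fin n → UnitBall E),
    (∀ i, v i ∈ S) → φ.evalL S v = φ.evalL univ v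

/-- The structure with universe `S` realises every type over `A ⊆ S` in finitely many variables.
A member `⟨k, φ, a⟩` of `Γ` stands for the condition `φ(x, a) = 0` with parameters `a`; a set of
such conditions is consistent if it is finitely approximately satisfiable in `S`. -/
def RealisesTypesOver (S A : Set (UnitBall E)) : Prop :=
  ∀ (n : ℕ) (Γ : Set (Σ k : ℕ, Formula Empty (n + k) × (Fin k → UnitBall E))),
    (∀ c ∈ Γ, ∀ i, c.2.2 i ∈ A) →
    (∀ Γ₀ ⊆ Γ, Γ₀.Finite → ∀ ε : ℝ, 0 < ε → ∃ x : Fin n → UnitBall E, (∀ i, x i ∈ S) ∧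
      ∀ c ∈ Γ₀, |c.2.1.evalL S (Fin.append x c.2.2)| ≤ ε) →
    ∃ x : Fin n → UnitBall E, (∀ i, x i ∈ S) ∧
      ∀ c ∈ Γ, c.2.1.evalL S (Fin.append x c.2.2) = 0

/-- The zero set `P(M)` of a predicate. -/
def zeroSet (P : UnitBall E → ℝ) : Set (UnitBall E) := {x | P x = 0}

/-- `(M, P)` is an elementary pair: `P(M)` is an elementary substructure of `M`, the unit ball
of `E`, and `P` is the distance to `P(M)`. -/
def IsElementaryPair (P : UnitBall E → ℝ) : Prop :=
  IsElementarySubstructure (zeroSet P) ∧ ∀ x, P x = Metric.infDist x (zeroSet P)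

/-- `(M, P)` is a beautiful pair: an elementary pair such that `P(M)` is `ℵ₁`-saturated (the
language is countable) and `M` is `ℵ₀`-saturated over `P(M)`. -/
def IsBeautifulPair (P : UnitBall E → ℝ) : Prop :=
  IsElementaryPair P ∧
  (∀ A ⊆ zeroSet P, A.Countable → RealisesTypesOver (zeroSet P) A) ∧
  (∀ A : Set (UnitBall E), A.Finite → RealisesTypesOver univ (zeroSet P ∪ A))

end Semantics

end BLat

/-- A measure is atomless if every set of positive measure has a subset of strictly smaller
positive measure. -/
def IsAtomlessMeasure {Ω : Type*} [MeasurableSpace Ω] (μ : Measure Ω) : Prop :=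
  ∀ s, MeasurableSet s → 0 < μ s → ∃ t ⊆ s, MeasurableSet t ∧ 0 < μ t ∧ μ t < μ s

/-- The models of `ALpL`: nonzero Banach lattices isomorphic to `L_p(Ω, μ)` with `μ` atomless. -/
def IsAtomlessLpLattice (p : ℝ≥0∞) [Fact (1 ≤ p)] (E : Type) [NormedAddCommGroup E]
    [NormedSpace ℝ E] [Lattice E] : Prop :=
  Nontrivial E ∧ ∃ (Ω : Type) (_ : MeasurableSpace Ω) (μ : Measure Ω),
    IsAtomlessMeasure μ ∧ Nonempty (BanachLatticeIso E (Lp ℝ p μ))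

/-- The theory `ALpL_P`: the `L_P`-sentences `σ` such that the condition `σ = 0` holds in all
beautiful pairs of models of `ALpL`. -/
def theoryALpLP (p : ℝ≥0∞) [Fact (1 ≤ p)] : Set (BLat.Formula Unit 0) :=
  {σ | ∀ (E : Type) [NormedAddCommGroup E] [NormedSpace ℝ E] [Lattice E] [IsBanachLattice E]
    (P : UnitBall E → ℝ), IsAtomlessLpLattice p E → BLat.IsBeautifulPair P →
    σ.eval univ (fun _ => P) Fin.elim0 = 0}

/-- `(M, P)`, with `M` the unit ball of `E`, is a model of `ALpL_P`. The symbol `P` is a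
`1`-Lipschitz predicate symbol. -/
def IsModelALpLP (p : ℝ≥0∞) [Fact (1 ≤ p)] {E : Type*} [NormedAddCommGroup E] [NormedSpace ℝ E]
    [Lattice E] [IsBanachLattice E] (P : UnitBall E → ℝ) : Prop :=
  LipschitzWith 1 P ∧ ∀ σ ∈ theoryALpLP p, σ.eval univ (fun _ => P) Fin.elim0 = 0

/-- The distortion bound `ζ(r) = 1 - (1 - r)^{1/p} + r^{1/p}`. -/
def zetaBound (p : ℝ≥0∞) (r : ℝ) : ℝ :=
  1 - (1 - r) ^ (1 / p.toReal) + r ^ (1 / p.toReal)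

/-- Lebesgue measure on the rectangle `[0, a] × [0, 1]`. -/
def rectMeasure (a : ℝ) : Measure (ℝ × ℝ) :=
  (volume : Measure (ℝ × ℝ)).restrict (Icc 0 a ×ˢ Icc 0 1)

/-- The copy of the unit ball of `L_p([0, 1])` in the unit ball of `L_p([0, a] × [0, 1])`,
for `a ≥ 1`: functions of the first coordinate on `[0, 1] × [0, 1]`, extended by `0`. -/
def baseBall (p : ℝ≥0∞) [Fact (1 ≤ p)] (a : ℝ) : Set (UnitBall (Lp ℝ p (rectMeasure a))) :=
  {f | ∃ g : ℝ → ℝ, Measurable g ∧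
    ∀ᵐ z ∂(rectMeasure a), f.1 z = if z.1 ≤ 1 then g z.1 else 0}

end

/-!
Every separable model of `ALpL_P` is shown to be isomorphic to one of the two standard pairs
`L_p([0, 1]) ⊆ L_p([0, a] × [0, 1])` for `a = 1, 2`, and these two differ by an arbitrarily small
perturbation of `P`.

*Axioms.* The conditions in `PairAxioms` are expressed by sentences, and hold in beautiful pairs
(`BLat.IsBeautifulPair.pairAxioms`), hence in all models (`IsModelALpLP.pairAxioms`). Together with
`p`-additivity of the norm (`IsModelALpLP.isPAdditive`) they say that `P` is the distance to the
unit ball of a nonzero closed sublattice `F`, that positive elements of `F` split into two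
almost disjoint parts in `F` of almost equal norm (`Halves`), and that positive elements of the
whole lattice split in the same way with the two parts looking alike when truncated by any
element of `F` (`HalvesOver`). The last property is where saturation over `P(M)` enters: in an
atomless `L_p` lattice such a splitting exists for finitely many truncations at a time
(`IsAtomlessMeasure.hasHalvings`), so a compactness argument yields it for all of `F`.

*Representation.* A separable `p`-additive lattice has a weak unit, and by Freudenthal's spectral
theorem it is spanned by a sequence of components of the unit. The norms of the components of the
generated Boolean algebra define a measure on the Cantor space, and the lattice is `L_p` of that
measure (`IsPAdditive.exists_iso_Lp_cantor`). Choosing the components of even index in `F` makes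
`F` the lattice of the functions which factor through the even coordinates and vanish off a set
(`IsPAdditive.exists_pair_representation`).

*Classification.* `Halves` and `HalvesOver` exclude atoms: points, fibres of the projection `π` onto
the even coordinates and graphs over it are null sets (`HalvesOver.measure_singleton`,
`Halves.measure_fiber`, `HalvesOver.measure_graph`). Therefore the quantile functions of the
conditional measures along `π` identify the support of `F` with the unit square, `π` becoming the
first coordinate (`exists_isMeasureIso_square`). The complement of the support is either null or
isomorphic to a second square, which gives `a = 1` or `a = 2` (`exists_iso_rectMeasure`).

*Perturbation.* The rescaling isomorphism squeezes the second square into a strip of width `r`. It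
moves the functions of the first coordinate by at most `ζ(r)` (`norm_rescaleIso_sub_le`), so the
distances to the two copies of `L_p([0, 1])` differ by at most `ζ(r)`.
-/

noncomputable section

open Filter Topology ProbabilityTheory

set_option linter.unusedSectionVars false

/-! ### Vector lattice algebra -/

section VectorLattice

variable {E : Type*} [NormedAddCommGroup E] [NormedSpace ℝ E] [Lattice E] [IsBanachLattice E]

theorem inf_eq_half_smul (x y : E) : x ⊓ y = (1 / 2 : ℝ) • (x + y - |x - y|) := by
  rw [inf_eq_half_smul_add_sub_abs_sub ℝ, abs_sub_comm]; norm_num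

theorem sup_eq_half_smul (x y : E) : x ⊔ y = (1 / 2 : ℝ) • (x + y + |x - y|) := by
  rw [sup_eq_half_smul_add_add_abs_sub ℝ, abs_sub_comm]; norm_num

theorem smul_inf_of_nonneg {c : ℝ} (hc : 0 ≤ c) (x y : E) : c • (x ⊓ y) = (c • x) ⊓ (c • y) := by
  rcases hc.eq_or_lt with rfl | hc
  · simp
  · apply le_antisymm
    · exact le_inf (smul_le_smul_of_nonneg_left inf_le_left hc.le)
        (smul_le_smul_of_nonneg_left inf_le_right hc.le)
    · rw [← inv_smul_le_iff_of_pos hc]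
      refine le_inf ?_ ?_ <;> rw [inv_smul_le_iff_of_pos hc]
      exacts [inf_le_left, inf_le_right]

theorem abs_smul_eq (c : ℝ) (x : E) : |c • x| = |c| • |x| := by
  have key : ∀ d : ℝ, 0 ≤ d → |d • x| = d • |x| := fun d hd => by
    have h := smul_inf_of_nonneg hd x (-x)
    rw [← neg_inj, ← smul_neg, abs, abs, neg_sup, neg_sup, neg_neg, neg_neg, inf_comm (-x), h,
      smul_neg, inf_comm]
  rcases le_total 0 c with hc | hc
  · rw [key c hc, abs_of_nonneg hc]
  · rw [abs_of_nonpos hc, ← key (-c) (neg_nonneg.2 hc), neg_smul, abs_neg]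

theorem add_eq_sup_of_inf_eq_zero {x y : E} (h : x ⊓ y = 0) : x + y = x ⊔ y := by
  rw [← inf_add_sup, h, zero_add]

theorem inf_sup_left' (x y z : E) : x ⊓ (y ⊔ z) = x ⊓ y ⊔ x ⊓ z :=
  @inf_sup_left E (AddCommGroup.toDistribLattice E) x y z

theorem inf_add_of_disjoint {x y z : E} (hx : 0 ≤ x) (hy : 0 ≤ y) (hz : 0 ≤ z)
    (h : y ⊓ z = 0) : x ⊓ (y + z) = x ⊓ y + x ⊓ z := by
  have h2 : (x ⊓ y) ⊓ (x ⊓ z) = 0 := by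
    apply le_antisymm
    · rw [← h]; exact inf_le_inf inf_le_right inf_le_right
    · exact le_inf (le_inf hx hy) (le_inf hx hz)
  rw [add_eq_sup_of_inf_eq_zero h, add_eq_sup_of_inf_eq_zero h2, inf_sup_left']

/-- For positive elements the infimum is subadditive in each argument. -/
theorem inf_add_le {x y z : E} (hx : 0 ≤ x) (hy : 0 ≤ y) (hz : 0 ≤ z) :
    x ⊓ (y + z) ≤ x ⊓ y + x ⊓ z := by
  rw [add_inf, inf_add, inf_add]
  refine le_inf (le_inf ?_ ?_) (le_inf ?_ ?_)
  · exact inf_le_left.trans (le_add_of_nonneg_left hx)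
  · exact inf_le_left.trans (le_add_of_nonneg_left hy)
  · exact inf_le_left.trans (le_add_of_nonneg_right hz)
  · exact inf_le_right

theorem inf_eq_zero_of_le {x y x' y' : E} (h : x ⊓ y = 0) (hx : 0 ≤ x') (hy : 0 ≤ y')
    (hx' : x' ≤ x) (hy' : y' ≤ y) : x' ⊓ y' = 0 :=
  le_antisymm (h ▸ inf_le_inf hx' hy') (le_inf hx hy)

theorem disjoint_add {x y z : E} (hx : 0 ≤ x) (hy : 0 ≤ y) (hz : 0 ≤ z) (h1 : x ⊓ y = 0)
    (h2 : x ⊓ z = 0) : x ⊓ (y + z) = 0 := by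
  apply le_antisymm
  · have := inf_add_le hx hy hz
    rwa [h1, h2, add_zero] at this
  · exact le_inf hx (add_nonneg hy hz)

theorem disjoint_nsmul {x y : E} (hx : 0 ≤ x) (hy : 0 ≤ y) (h1 : x ⊓ y = 0) (n : ℕ) :
    x ⊓ (n • y) = 0 := by
  induction n with
  | zero => simpa using hx
  | succ k ih => rw [succ_nsmul]; exact disjoint_add hx (nsmul_nonneg hy k) hy ih h1

theorem disjoint_smul {x y : E} (hx : 0 ≤ x) (hy : 0 ≤ y) (h1 : x ⊓ y = 0) {c : ℝ} (hc : 0 ≤ c) :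
    x ⊓ (c • y) = 0 := by
  obtain ⟨n, hn⟩ := exists_nat_ge c
  refine inf_eq_zero_of_le (disjoint_nsmul hx hy h1 n) hx (smul_nonneg hc hy) le_rfl ?_
  rw [← Nat.cast_smul_eq_nsmul ℝ]
  exact smul_le_smul_of_nonneg_right hn hy

theorem sub_inf_eq_posPart (x y : E) : x - x ⊓ y = (x - y)⁺ := by
  rw [posPart_def, sub_inf, sub_self, sup_comm]

theorem norm_le_norm_of_nonneg_of_le {x y : E} (hx : 0 ≤ x) (h : x ≤ y) : ‖x‖ ≤ ‖y‖ :=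
  norm_le_norm_of_abs_le_abs (by rwa [abs_of_nonneg hx, abs_of_nonneg (hx.trans h)])

end VectorLattice

/-- The norm of a Banach lattice is `q`-additive: superadditivity of `‖·‖ ^ q` on the positive
cone, and additivity on pairs of disjoint positive elements. -/
structure IsPAdditive (q : ℝ) (E : Type*) [NormedAddCommGroup E] [Lattice E] : Prop where
  one_le : 1 ≤ q
  superadd : ∀ x y : E, 0 ≤ x → 0 ≤ y → ‖x‖ ^ q + ‖y‖ ^ q ≤ ‖x + y‖ ^ q
  add_of_disjoint : ∀ x y : E, 0 ≤ x → 0 ≤ y → x ⊓ y = 0 → ‖x + y‖ ^ q = ‖x‖ ^ q + ‖y‖ ^ q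

/-- A closed vector sublattice. -/
structure IsClosedSublattice {E : Type*} [NormedAddCommGroup E] [NormedSpace ℝ E] [Lattice E]
    (V : Submodule ℝ E) : Prop where
  isClosed : IsClosed (V : Set E)
  abs_mem : ∀ x ∈ V, |x| ∈ V

/-- `b` is a component of `e`: it is positive and disjoint from its complement `e - b`. -/
structure IsComponent {E : Type*} [NormedAddCommGroup E] [Lattice E] (e b : E) : Prop where
  nonneg : 0 ≤ b
  inf_sub : b ⊓ (e - b) = 0

/-! ### Components, Freudenthal's theorem and weak units -/

section Components

variable {E : Type*} [NormedAddCommGroup E] [NormedSpace ℝ E] [Lattice E] [IsBanachLattice E]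
variable {q : ℝ} {V : Submodule ℝ E}

namespace IsClosedSublattice

theorem top : IsClosedSublattice (⊤ : Submodule ℝ E) := ⟨by simp, fun _ _ => trivial⟩

theorem inf_mem (hV : IsClosedSublattice V) {x y : E} (hx : x ∈ V) (hy : y ∈ V) : x ⊓ y ∈ V := by
  rw [inf_eq_half_smul]
  exact V.smul_mem _ (V.sub_mem (V.add_mem hx hy) (hV.abs_mem _ (V.sub_mem hx hy)))

theorem sup_mem (hV : IsClosedSublattice V) {x y : E} (hx : x ∈ V) (hy : y ∈ V) : x ⊔ y ∈ V := by
  rw [sup_eq_half_smul]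
  exact V.smul_mem _ (V.add_mem (V.add_mem hx hy) (hV.abs_mem _ (V.sub_mem hx hy)))

theorem posPart_mem (hV : IsClosedSublattice V) {x : E} (hx : x ∈ V) : x⁺ ∈ V := by
  rw [posPart_def]; exact hV.sup_mem hx V.zero_mem

theorem negPart_mem (hV : IsClosedSublattice V) {x : E} (hx : x ∈ V) : x⁻ ∈ V := by
  rw [negPart_def]; exact hV.sup_mem (V.neg_mem hx) V.zero_mem

end IsClosedSublattice

namespace IsPAdditive

theorem pos (h : IsPAdditive q E) : 0 < q := lt_of_lt_of_le one_pos h.one_le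

theorem norm_sub_rpow_le (h : IsPAdditive q E) {x y : E} (hx : 0 ≤ x) (hxy : x ≤ y) :
    ‖y - x‖ ^ q ≤ ‖y‖ ^ q - ‖x‖ ^ q := by
  have := h.superadd x (y - x) hx (sub_nonneg.2 hxy)
  rw [add_sub_cancel] at this
  linarith

/-- Order bounded increasing sequences of positive elements converge in norm: the numbers
`‖x n‖ ^ q` increase to a limit, and superadditivity controls the increments by their
differences. -/
theorem exists_tendsto (h : IsPAdditive q E) {x : ℕ → E} (hm : Monotone x) (h0 : 0 ≤ x 0) {e : E}
    (he : ∀ n, x n ≤ e) : ∃ y, Tendsto x atTop (𝓝 y) := by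
  have hx : ∀ n, 0 ≤ x n := fun n => h0.trans (hm (Nat.zero_le n))
  have hmono : Monotone fun n => ‖x n‖ ^ q := fun m n hmn =>
    Real.rpow_le_rpow (norm_nonneg _) (norm_le_norm_of_nonneg_of_le (hx m) (hm hmn)) h.pos.le
  have hbdd : BddAbove (range fun n => ‖x n‖ ^ q) := by
    refine ⟨‖e‖ ^ q, ?_⟩
    rintro _ ⟨n, rfl⟩
    exact Real.rpow_le_rpow (norm_nonneg _) (norm_le_norm_of_nonneg_of_le (hx n) (he n)) h.pos.le
  have hlim := tendsto_atTop_ciSup hmono hbdd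
  have hcau := hlim.cauchySeq
  apply cauchySeq_tendsto_of_complete
  rw [Metric.cauchySeq_iff']
  intro ε hε
  obtain ⟨N, hN⟩ := Metric.cauchySeq_iff'.1 hcau (ε ^ q) (Real.rpow_pos_of_pos hε q)
  refine ⟨N, fun n hn => ?_⟩
  have h1 := h.norm_sub_rpow_le (hx N) (hm hn)
  have h2 := hN n hn
  rw [Real.dist_eq] at h2
  rw [dist_eq_norm]
  have h3 : ‖x n - x N‖ ^ q < ε ^ q := h1.trans_lt ((le_abs_self _).trans_lt h2)
  exact (Real.rpow_lt_rpow_iff (norm_nonneg _) hε.le h.pos).1 h3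

end IsPAdditive

namespace IsComponent

variable {e b c : E}

theorem le (h : IsComponent e b) : b ≤ e := by
  rw [← sub_nonneg, ← h.inf_sub]; exact inf_le_right

theorem self (he : 0 ≤ e) : IsComponent e e := ⟨he, by simpa using he⟩

theorem compl (h : IsComponent e b) : IsComponent e (e - b) :=
  ⟨sub_nonneg.2 h.le, by rw [sub_sub_cancel, inf_comm, h.inf_sub]⟩

theorem inf (hb : IsComponent e b) (hc : IsComponent e c) : IsComponent e (b ⊓ c) := by
  refine ⟨le_inf hb.nonneg hc.nonneg, ?_⟩
  have h1 := hb.compl.nonneg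
  have h2 := hc.compl.nonneg
  rw [sub_inf, inf_sup_left']
  rw [inf_eq_zero_of_le hb.inf_sub (le_inf hb.nonneg hc.nonneg) h1 inf_le_left le_rfl,
    inf_eq_zero_of_le hc.inf_sub (le_inf hb.nonneg hc.nonneg) h2 inf_le_right le_rfl, sup_idem]

theorem inf_add_inf_compl (hb : IsComponent e b) {x : E} (hx : 0 ≤ x) (hxe : x ≤ e) :
    x ⊓ b + x ⊓ (e - b) = x := by
  rw [← inf_add_of_disjoint hx hb.nonneg hb.compl.nonneg hb.inf_sub, add_sub_cancel,
    inf_eq_left.2 hxe]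

end IsComponent

/-- The spectral component `lim (n w) ⊓ e` of `e` in the band generated by `w`. -/
theorem IsPAdditive.exists_component (h : IsPAdditive q E) (hV : IsClosedSublattice V) {e w : E}
    (he : 0 ≤ e) (hw : 0 ≤ w) (heV : e ∈ V) (hwV : w ∈ V) :
    ∃ b ∈ V, IsComponent e b ∧ (∀ n : ℕ, (n • w) ⊓ e ≤ b) ∧
      ∀ c : E, (∀ n : ℕ, (n • w) ⊓ e ≤ c) → b ≤ c := by
  have hmono : Monotone fun n : ℕ => (n • w) ⊓ e := fun m n hmn =>
    inf_le_inf_right _ (nsmul_le_nsmul_left hw hmn)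
  obtain ⟨b, hb⟩ := h.exists_tendsto hmono (by simpa using he) (e := e) (fun n => inf_le_right)
  have hle : ∀ n : ℕ, (n • w) ⊓ e ≤ b := fun n => hmono.ge_of_tendsto hb n
  have hb0 : 0 ≤ b := le_trans (by simpa using he) (hle 0)
  have hbe : b ≤ e := le_of_tendsto' hb fun n => inf_le_right
  refine ⟨b, ?_, ⟨hb0, ?_⟩, hle, fun c hc => le_of_tendsto' hb hc⟩
  · exact hV.isClosed.mem_of_tendsto hb (Eventually.of_forall fun n =>
      hV.inf_mem (V.smul_of_tower_mem n hwV) heV)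
  · -- doubling the sequence does not change its limit, so `(2 b) ⊓ e = b`
    have h2 : Tendsto (fun n : ℕ => (2 • ((n • w) ⊓ e)) ⊓ e) atTop (𝓝 ((2 • b) ⊓ e)) :=
      (hb.const_smul 2).inf_nhds tendsto_const_nhds
    have h3 : (fun n : ℕ => (2 • ((n • w) ⊓ e)) ⊓ e) = fun n : ℕ => ((2 * n) • w) ⊓ e := by
      funext n
      have hs : (2 : ℕ) • ((n • w) ⊓ e) = ((2 * n) • w) ⊓ ((2 : ℕ) • e) := by
        have := smul_inf_of_nonneg (c := (2 : ℝ)) (by norm_num) (n • w) e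
        rw [two_smul, two_smul, two_smul] at this
        rw [two_nsmul, two_nsmul, this, two_mul, add_nsmul]
      have he2 : ((2 : ℕ) • e) ⊓ e = e :=
        inf_eq_right.2 (by rw [two_nsmul]; exact le_add_of_nonneg_left he)
      rw [hs, inf_assoc, he2]
    rw [h3] at h2
    have h4 := hb.comp (tendsto_id.const_mul_atTop' (show 0 < 2 by norm_num) :
      Tendsto (fun n : ℕ => 2 * n) atTop atTop)
    have h5 : (2 • b) ⊓ e = b := tendsto_nhds_unique h2 h4
    have h6 : b ⊓ (e - b) = (2 • b) ⊓ e - b := by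
      rw [inf_sub]; congr 1; rw [two_nsmul, add_sub_cancel_right]
    rw [h6, h5, sub_self]

theorem inf_add_sub_inf (x y d : E) (hd : 0 ≤ d) : x ⊓ (y + d) - x ⊓ y = (x - y)⁺ ⊓ d := by
  rw [← sub_inf_eq_posPart, sub_eq_iff_eq_add, inf_add, sub_add_cancel, add_comm d, inf_add,
    ← inf_assoc, inf_eq_left.2 (le_add_of_nonneg_right hd)]

/-- Where `w` exceeds `z` the left-hand side is at most `0`, elsewhere it is at most `w ≤ z`. -/
theorem nsmul_posPart_inf_le (z w : E) (n : ℕ) : (n • (z - w)⁺) ⊓ w ≤ z⁺ := by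
  have h1 : w ≤ z⁺ + (w - z)⁺ := by
    calc w = z + (w - z) := by abel
      _ ≤ _ := add_le_add (le_posPart z) (le_posPart _)
  have h0 : (w - z)⁺ = (z - w)⁻ := by rw [← neg_sub z w, posPart_neg]
  have hr : 0 ≤ n • (z - w)⁺ := nsmul_nonneg (posPart_nonneg _) n
  have h2 : (n • (z - w)⁺) ⊓ (w - z)⁺ = 0 := by
    rw [h0, inf_comm]
    refine disjoint_nsmul (negPart_nonneg _) (posPart_nonneg _) ?_ n
    rw [inf_comm]; exact posPart_inf_negPart_eq_zero _
  calc (n • (z - w)⁺) ⊓ w ≤ (n • (z - w)⁺) ⊓ (z⁺ + (w - z)⁺) := inf_le_inf_left _ h1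
    _ ≤ (n • (z - w)⁺) ⊓ z⁺ + (n • (z - w)⁺) ⊓ (w - z)⁺ :=
      inf_add_le hr (posPart_nonneg _) (posPart_nonneg _)
    _ ≤ z⁺ := by rw [h2, add_zero]; exact inf_le_right

/-- Freudenthal's spectral theorem: an element of the order interval `[0, e]` is within `‖e‖ / k`
of the average of its spectral components at the levels `1 / k, …, k / k`. -/
theorem IsPAdditive.mem_closure_span_components_of_le (h : IsPAdditive q E)
    (hV : IsClosedSublattice V) {e x : E} (he : 0 ≤ e) (heV : e ∈ V) (hx : 0 ≤ x) (hxe : x ≤ e)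
    (hxV : x ∈ V) :
    x ∈ closure (Submodule.span ℝ {b | b ∈ V ∧ IsComponent e b} : Set E) := by
  have hcomp : ∀ t : ℝ, ∃ b ∈ V, IsComponent e b ∧ (∀ n : ℕ, (n • (x - t • e)⁺) ⊓ e ≤ b) ∧
      ∀ c : E, (∀ n : ℕ, (n • (x - t • e)⁺) ⊓ e ≤ c) → b ≤ c := fun t =>
    h.exists_component hV he (posPart_nonneg _) heV
      (hV.posPart_mem (V.sub_mem hxV (V.smul_mem _ heV)))
  choose b hbV hbc hble hbleast using hcomp
  -- the part of `x` between the levels `t` and `t + δ` lies between the multiples by `δ` of the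
  -- spectral components at the upper and at the lower level
  have hup : ∀ t δ : ℝ, 0 < δ → x ⊓ ((t + δ) • e) - x ⊓ (t • e) ≤ δ • b t := by
    intro t δ hδ
    rw [add_smul, inf_add_sub_inf _ _ _ (smul_nonneg hδ.le he)]
    obtain ⟨n, hn⟩ := exists_nat_ge δ⁻¹
    refine le_trans ?_ (smul_le_smul_of_nonneg_left (hble t n) hδ.le)
    rw [smul_inf_of_nonneg hδ.le]
    refine inf_le_inf_right _ ?_
    rw [← Nat.cast_smul_eq_nsmul ℝ, smul_smul]
    have h1 : 1 ≤ δ * n := by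
      calc 1 = δ * δ⁻¹ := (mul_inv_cancel₀ hδ.ne').symm
        _ ≤ δ * n := by gcongr
    calc (x - t • e)⁺ = (1 : ℝ) • (x - t • e)⁺ := (one_smul _ _).symm
      _ ≤ _ := smul_le_smul_of_nonneg_right h1 (posPart_nonneg _)
  have hlow : ∀ t δ : ℝ, 0 < δ → δ • b (t + δ) ≤ x ⊓ ((t + δ) • e) - x ⊓ (t • e) := by
    intro t δ hδ
    rw [← le_inv_smul_iff_of_pos hδ]
    refine hbleast _ _ fun n => ?_
    rw [le_inv_smul_iff_of_pos hδ, add_smul, inf_add_sub_inf _ _ _ (smul_nonneg hδ.le he),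
      ← sub_sub, smul_inf_of_nonneg hδ.le]
    refine le_inf ?_ inf_le_right
    obtain ⟨m, hm⟩ := exists_nat_ge (δ * n)
    refine le_trans (inf_le_inf_right _ ?_) (nsmul_posPart_inf_le _ _ m)
    rw [← Nat.cast_smul_eq_nsmul ℝ, smul_smul, ← Nat.cast_smul_eq_nsmul ℝ m]
    exact smul_le_smul_of_nonneg_right hm (posPart_nonneg _)
  rw [Metric.mem_closure_iff]
  intro ε hε
  obtain ⟨k, hk⟩ := exists_nat_gt (‖e‖ / ε)
  have hk0 : (0 : ℝ) < k := lt_of_le_of_lt (div_nonneg (norm_nonneg _) hε.le) hk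
  set δ : ℝ := (k : ℝ)⁻¹ with hδdef
  have hδ : 0 < δ := inv_pos.2 hk0
  -- cutting `x` at the levels `j δ` gives a telescoping sum, and so does the difference of the
  -- upper and the lower estimate
  have htel : ∑ j ∈ Finset.range k, (x ⊓ ((j * δ + δ) • e) - x ⊓ ((j * δ) • e)) = x := by
    have := Finset.sum_range_sub (fun j : ℕ => x ⊓ ((j * δ) • e)) k
    have h2 : (k : ℝ) * δ = 1 := mul_inv_cancel₀ hk0.ne'
    simp only [h2, one_smul, Nat.cast_zero, zero_mul, zero_smul, inf_eq_left.2 hxe,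
      inf_eq_right.2 hx, sub_zero] at this
    refine Eq.trans (Finset.sum_congr rfl fun j _ => ?_) this
    push_cast; rw [add_mul, one_mul]
  refine ⟨∑ j ∈ Finset.range k, δ • b (j * δ + δ), ?_, ?_⟩
  · exact Submodule.sum_mem _ fun j _ => Submodule.smul_mem _ _
      (Submodule.subset_span ⟨hbV _, hbc _⟩)
  · have h1 : 0 ≤ x - ∑ j ∈ Finset.range k, δ • b (j * δ + δ) := by
      rw [sub_nonneg]
      exact (Finset.sum_le_sum fun j _ => hlow _ _ hδ).trans htel.le
    have h2 : x - ∑ j ∈ Finset.range k, δ • b (j * δ + δ) ≤ δ • e := by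
      calc x - ∑ j ∈ Finset.range k, δ • b (j * δ + δ)
          ≤ ∑ j ∈ Finset.range k, δ • b (j * δ) - ∑ j ∈ Finset.range k, δ • b (j * δ + δ) := by
            refine sub_le_sub_right ?_ _
            exact htel.ge.trans (Finset.sum_le_sum fun j _ => hup _ _ hδ)
        _ = δ • (b ((0 : ℕ) * δ) - b (k * δ)) := by
            rw [← Finset.sum_sub_distrib, smul_sub]
            have := Finset.sum_range_sub' (fun j : ℕ => δ • b (j * δ)) k
            rw [← this]
            refine Finset.sum_congr rfl fun j _ => ?_
            push_cast; rw [add_mul, one_mul]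
        _ ≤ δ • e := by
            refine smul_le_smul_of_nonneg_left ?_ hδ.le
            exact (sub_le_self _ (hbc _).nonneg).trans (hbc _).le
    rw [dist_eq_norm]
    calc _ ≤ ‖δ • e‖ := norm_le_norm_of_nonneg_of_le h1 h2
      _ = δ * ‖e‖ := by rw [norm_smul, Real.norm_of_nonneg hδ.le]
      _ < ε := by
        rw [hδdef, inv_mul_lt_iff₀ hk0]
        rwa [div_lt_iff₀ hε] at hk

/-- `u` is a weak order unit of the sublattice `V`. -/
structure IsWeakUnit (V : Submodule ℝ E) (u : E) : Prop where
  mem : u ∈ V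
  nonneg : 0 ≤ u
  eq_zero : ∀ x ∈ V, |x| ⊓ u = 0 → x = 0

/-- The component of a positive `x` in the band generated by `u` is `lim x ⊓ (n u)`. -/
theorem IsPAdditive.exists_band_component (h : IsPAdditive q E) (hV : IsClosedSublattice V)
    {u x : E} (hu : 0 ≤ u) (hx : 0 ≤ x) (huV : u ∈ V) (hxV : x ∈ V) :
    ∃ y ∈ V, 0 ≤ y ∧ y ≤ x ∧ (x - y) ⊓ u = 0 ∧
      Tendsto (fun n : ℕ => x ⊓ (n • u)) atTop (𝓝 y) := by
  have hmono : Monotone fun n : ℕ => x ⊓ (n • u) := fun m n hmn =>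
    inf_le_inf_left _ (nsmul_le_nsmul_left hu hmn)
  obtain ⟨y, hy⟩ := h.exists_tendsto hmono (by simpa using hx) (e := x) (fun n => inf_le_left)
  have hle : ∀ n : ℕ, x ⊓ (n • u) ≤ y := fun n => hmono.ge_of_tendsto hy n
  have hyx : y ≤ x := le_of_tendsto' hy fun n => inf_le_left
  refine ⟨y, hV.isClosed.mem_of_tendsto hy (Eventually.of_forall fun n =>
    hV.inf_mem hxV (V.smul_of_tower_mem n huV)), le_trans (by simpa using hx) (hle 0), hyx, ?_, hy⟩
  apply le_antisymm _ (le_inf (sub_nonneg.2 hyx) hu)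
  have h1 : ∀ n : ℕ, (x - x ⊓ (n • u)) ⊓ u ≤ x ⊓ ((n + 1) • u) - x ⊓ (n • u) := fun n => by
    rw [succ_nsmul, inf_add_sub_inf _ _ _ hu, sub_inf_eq_posPart]
  have h2 : Tendsto (fun n : ℕ => (x - x ⊓ (n • u)) ⊓ u) atTop (𝓝 ((x - y) ⊓ u)) :=
    (tendsto_const_nhds.sub hy).inf_nhds tendsto_const_nhds
  have h3 : Tendsto (fun n : ℕ => x ⊓ ((n + 1) • u) - x ⊓ (n • u)) atTop (𝓝 (y - y)) :=
    ((tendsto_add_atTop_iff_nat 1).2 hy).sub hy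
  rw [sub_self] at h3
  exact le_of_tendsto_of_tendsto' h2 h3 h1

/-- A sublattice is spanned by the components of a weak unit `u`: the truncations `x ⊓ (n u)` of a
positive `x` converge to `x`, and each is a multiple of an element of the interval `[0, u]`. -/
theorem IsWeakUnit.mem_closure_span_components {u : E} (hu : IsWeakUnit V u)
    (h : IsPAdditive q E) (hV : IsClosedSublattice V) {x : E} (hxV : x ∈ V) :
    x ∈ closure (Submodule.span ℝ {b | b ∈ V ∧ IsComponent u b} : Set E) := by
  have key : ∀ x ∈ V, 0 ≤ x →
      x ∈ (Submodule.span ℝ {b | b ∈ V ∧ IsComponent u b}).topologicalClosure := by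
    intro x hxV hx
    obtain ⟨y, hyV, hy0, hyx, hdisj, hlim⟩ := h.exists_band_component hV hu.nonneg hx hu.mem hxV
    have hxy : x - y = 0 := hu.eq_zero _ (V.sub_mem hxV hyV)
      (by rwa [abs_of_nonneg (sub_nonneg.2 hyx)])
    rw [sub_eq_zero] at hxy
    subst hxy
    refine (Submodule.isClosed_topologicalClosure _).mem_of_tendsto
      ((tendsto_add_atTop_iff_nat 1).2 hlim) (Eventually.of_forall fun n => ?_)
    have hn : (0 : ℝ) < (n + 1 : ℕ) := by positivity
    have h1 : ((n + 1 : ℕ) : ℝ) • (((n + 1 : ℕ) : ℝ)⁻¹ • (x ⊓ ((n + 1) • u))) =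
        x ⊓ ((n + 1) • u) := by rw [smul_smul, mul_inv_cancel₀ hn.ne', one_smul]
    show x ⊓ ((n + 1) • u) ∈ _
    rw [← h1]
    refine Submodule.smul_mem _ _ ?_
    refine h.mem_closure_span_components_of_le hV hu.nonneg hu.mem
      (smul_nonneg (inv_nonneg.2 hn.le) (le_inf hx (nsmul_nonneg hu.nonneg _))) ?_
      (V.smul_mem _ (hV.inf_mem hxV (V.smul_of_tower_mem _ hu.mem)))
    rw [inv_smul_le_iff_of_pos hn, Nat.cast_smul_eq_nsmul]
    exact inf_le_right
  rw [← posPart_sub_negPart x]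
  exact Submodule.sub_mem _ (key _ (hV.posPart_mem hxV) (posPart_nonneg _))
    (key _ (hV.negPart_mem hxV) (negPart_nonneg _))

/-- A separable closed sublattice has a weak order unit: a weighted sum of the absolute values of
a dense sequence. -/
theorem IsClosedSublattice.exists_isWeakUnit [TopologicalSpace.SeparableSpace E]
    (hV : IsClosedSublattice V) : ∃ u, IsWeakUnit V u := by
  have := UniformSpace.secondCountable_of_separable E
  obtain ⟨s, hs⟩ := TopologicalSpace.exists_dense_seq V
  set c : ℕ → ℝ := fun n => (1 / 2) ^ n * (1 + ‖s n‖)⁻¹ with hc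
  have hc0 : ∀ n, 0 < c n := fun n => by positivity
  have hsum : Summable fun n => c n • |(s n : E)| := by
    refine Summable.of_norm_bounded (g := fun n : ℕ => (1 / 2 : ℝ) ^ n)
      (summable_geometric_of_lt_one (by norm_num) (by norm_num)) fun n => ?_
    rw [norm_smul, norm_abs_eq_norm, Real.norm_of_nonneg (hc0 n).le, hc]
    have h1 : (1 + ‖s n‖)⁻¹ * ‖(s n : E)‖ ≤ 1 := by
      rw [inv_mul_le_iff₀ (by positivity)]; simp
    calc (1 / 2 : ℝ) ^ n * (1 + ‖s n‖)⁻¹ * ‖(s n : E)‖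
        = (1 / 2 : ℝ) ^ n * ((1 + ‖s n‖)⁻¹ * ‖(s n : E)‖) := by ring
      _ ≤ (1 / 2 : ℝ) ^ n * 1 := by gcongr
      _ = _ := mul_one _
  have hterm : ∀ n, 0 ≤ c n • |(s n : E)| := fun n => smul_nonneg (hc0 n).le (abs_nonneg _)
  have hnn : 0 ≤ ∑' n, c n • |(s n : E)| :=
    ge_of_tendsto' hsum.hasSum.tendsto_sum_nat fun n => Finset.sum_nonneg fun i _ => hterm i
  have hle : ∀ n, c n • |(s n : E)| ≤ ∑' n, c n • |(s n : E)| := fun n => by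
    refine ge_of_tendsto hsum.hasSum.tendsto_sum_nat ?_
    filter_upwards [eventually_gt_atTop n] with m hm
    exact Finset.single_le_sum (f := fun n => c n • |(s n : E)|) (fun i _ => hterm i)
      (Finset.mem_range.2 hm)
  refine ⟨∑' n, c n • |(s n : E)|, ?_, hnn, fun x hxV hx => ?_⟩
  · exact hV.isClosed.mem_of_tendsto hsum.hasSum.tendsto_sum_nat (Eventually.of_forall fun n =>
      V.sum_mem fun i _ => V.smul_mem _ (hV.abs_mem _ (s i).2))
  · have h1 : ∀ n, |x| ⊓ |(s n : E)| = 0 := fun n => by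
      have h2 : |x| ⊓ (c n • |(s n : E)|) = 0 :=
        inf_eq_zero_of_le hx (abs_nonneg _) (hterm n) le_rfl (hle n)
      have h3 := disjoint_smul (abs_nonneg x) (hterm n) h2 (inv_nonneg.2 (hc0 n).le)
      rwa [smul_smul, inv_mul_cancel₀ (hc0 n).ne', one_smul] at h3
    have h4 : ∀ y : V, |x| ⊓ |(y : E)| = 0 := fun y => by
      refine hs.induction (P := fun y : V => |x| ⊓ |(y : E)| = 0) ?_ ?_ y
      · rintro _ ⟨n, rfl⟩; exact h1 n
      · have : Continuous fun y : V => |x| ⊓ ((y : E) ⊔ -(y : E)) := by fun_prop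
        exact isClosed_eq this continuous_const
    have h5 := h4 ⟨x, hxV⟩
    rw [inf_idem] at h5
    rw [← norm_eq_zero, ← norm_abs_eq_norm, h5, norm_zero]

/-- A sequence of components of the weak unit whose linear span is dense. -/
theorem IsWeakUnit.exists_seq_components [TopologicalSpace.SeparableSpace E] {u : E}
    (hu : IsWeakUnit V u) (h : IsPAdditive q E) (hV : IsClosedSublattice V) :
    ∃ c : ℕ → E, (∀ n, c n ∈ V) ∧ (∀ n, IsComponent u (c n)) ∧
      (V : Set E) ⊆ closure (Submodule.span ℝ (range c)) := by
  have := UniformSpace.secondCountable_of_separable E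
  have : Nonempty {b | b ∈ V ∧ IsComponent u b} := ⟨⟨u, hu.mem, .self hu.nonneg⟩⟩
  obtain ⟨s, hs⟩ := TopologicalSpace.exists_dense_seq {b | b ∈ V ∧ IsComponent u b}
  refine ⟨fun n => s n, fun n => (s n).2.1, fun n => (s n).2.2, fun x hx => ?_⟩
  have h1 : {b | b ∈ V ∧ IsComponent u b} ⊆
      ((Submodule.span ℝ (range fun n => (s n : E))).topologicalClosure : Set E) := by
    intro b hb
    refine hs.induction (P := fun y => (y : E) ∈
      (Submodule.span ℝ (range fun n => (s n : E))).topologicalClosure) ?_ ?_ ⟨b, hb⟩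
    · rintro _ ⟨n, rfl⟩
      exact Submodule.le_topologicalClosure _ (Submodule.subset_span ⟨n, rfl⟩)
    · exact (Submodule.isClosed_topologicalClosure _).preimage continuous_subtype_val
  have h2 := closure_mono (Submodule.span_le.2 h1) (hu.mem_closure_span_components h hV hx)
  rwa [(Submodule.isClosed_topologicalClosure _).closure_eq] at h2

end Components

/-! ### Isomorphisms of Banach lattices -/

section Isomorphisms

variable {E F G : Type*} [NormedAddCommGroup E] [NormedSpace ℝ E] [Lattice E] [IsBanachLattice E]
  [NormedAddCommGroup F] [NormedSpace ℝ F] [Lattice F] [IsBanachLattice F]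
  [NormedAddCommGroup G] [NormedSpace ℝ G] [Lattice G]

/-- A surjective linear isometry which commutes with the absolute value preserves both lattice
operations. -/
def BanachLatticeIso.ofMapAbs (L : E ≃ₗᵢ[ℝ] F) (hL : ∀ x, L |x| = |L x|) :
    BanachLatticeIso E F where
  __ := L
  map_sup' x y := by
    show L (x ⊔ y) = L x ⊔ L y
    rw [sup_eq_half_smul, sup_eq_half_smul, map_smul, map_add, map_add, hL, map_sub]
  map_inf' x y := by
    show L (x ⊓ y) = L x ⊓ L y
    rw [inf_eq_half_smul, inf_eq_half_smul, map_smul, map_sub, map_add, hL, map_sub]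

end Isomorphisms

/-! ### Norms of sums of disjoint elements -/

section DisjointSums

variable {E : Type*} [NormedAddCommGroup E] [NormedSpace ℝ E] [Lattice E] [IsBanachLattice E]
variable {q : ℝ} {ι : Type*}

theorem abs_add_of_disjoint {x y : E} (h : |x| ⊓ |y| = 0) : |x + y| = |x| + |y| := by
  apply le_antisymm (abs_add_le x y)
  have h1 : |x| + |y| = |(|x| - |y|)| := by
    rw [add_eq_sup_of_inf_eq_zero h]
    have h2 := sup_sub_inf_eq_abs_sub |x| |y|
    rw [h, sub_zero] at h2
    rw [h2, abs_sub_comm]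
  rw [h1]
  have := abs_abs_sub_abs_le x (-y)
  rwa [abs_neg, sub_neg_eq_add] at this

theorem disjoint_sum {x : E} (hx : 0 ≤ x) (s : Finset ι) (u : ι → E) (hu : ∀ i ∈ s, 0 ≤ u i)
    (h : ∀ i ∈ s, x ⊓ u i = 0) : x ⊓ ∑ i ∈ s, u i = 0 := by
  classical
  induction s using Finset.induction_on with
  | empty => simpa using hx
  | insert a s ha ih =>
    rw [Finset.sum_insert ha]
    exact disjoint_add hx (hu a (by simp)) (Finset.sum_nonneg fun i hi => hu i (by simp [hi]))
      (h a (by simp)) (ih (fun i hi => hu i (by simp [hi])) fun i hi => h i (by simp [hi]))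

theorem disjoint_smul_smul {x y : E} (hx : 0 ≤ x) (hy : 0 ≤ y) (h : x ⊓ y = 0) {c d : ℝ}
    (hc : 0 ≤ c) (hd : 0 ≤ d) : (c • x) ⊓ (d • y) = 0 := by
  rw [inf_comm]
  refine disjoint_smul (smul_nonneg hd hy) hx ?_ hc
  rw [inf_comm]
  exact disjoint_smul hx hy h hd

theorem abs_sum_smul_of_disjoint (s : Finset ι) (u : ι → E) (c : ι → ℝ) (hu : ∀ i ∈ s, 0 ≤ u i)
    (h : ∀ i ∈ s, ∀ j ∈ s, i ≠ j → u i ⊓ u j = 0) :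
    |∑ i ∈ s, c i • u i| = ∑ i ∈ s, |c i| • u i := by
  classical
  induction s using Finset.induction_on with
  | empty => simp
  | insert a s ha ih =>
    have ih' := ih (fun i hi => hu i (by simp [hi]))
      fun i hi j hj hij => h i (by simp [hi]) j (by simp [hj]) hij
    have ha0 := hu a (by simp)
    rw [Finset.sum_insert ha, Finset.sum_insert ha, abs_add_of_disjoint, ih', abs_smul_eq,
      abs_of_nonneg ha0]
    rw [ih', abs_smul_eq, abs_of_nonneg ha0]
    refine disjoint_sum (smul_nonneg (abs_nonneg _) ha0) _ _
      (fun i hi => smul_nonneg (abs_nonneg _) (hu i (by simp [hi]))) fun i hi => ?_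
    refine disjoint_smul_smul ha0 (hu i (by simp [hi])) ?_ (abs_nonneg _) (abs_nonneg _)
    exact h a (by simp) i (by simp [hi]) (by rintro rfl; exact ha hi)

theorem IsPAdditive.norm_sum_smul_of_disjoint (hE : IsPAdditive q E) (s : Finset ι) (u : ι → E)
    (c : ι → ℝ) (hu : ∀ i ∈ s, 0 ≤ u i) (h : ∀ i ∈ s, ∀ j ∈ s, i ≠ j → u i ⊓ u j = 0) :
    ‖∑ i ∈ s, c i • u i‖ ^ q = ∑ i ∈ s, |c i| ^ q * ‖u i‖ ^ q := by
  classical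
  rw [← norm_abs_eq_norm, abs_sum_smul_of_disjoint s u c hu h]
  induction s using Finset.induction_on with
  | empty => simp [Real.zero_rpow hE.pos.ne']
  | insert a s ha ih =>
    have ha0 := hu a (by simp)
    rw [Finset.sum_insert ha, Finset.sum_insert ha, hE.add_of_disjoint,
      ih (fun i hi => hu i (by simp [hi]))
        fun i hi j hj hij => h i (by simp [hi]) j (by simp [hj]) hij,
      norm_smul, Real.norm_eq_abs, abs_abs, Real.mul_rpow (abs_nonneg _) (norm_nonneg _)]
    · exact smul_nonneg (abs_nonneg _) ha0
    · exact Finset.sum_nonneg fun i hi => smul_nonneg (abs_nonneg _) (hu i (by simp [hi]))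
    refine disjoint_sum (smul_nonneg (abs_nonneg _) ha0) _ _
      (fun i hi => smul_nonneg (abs_nonneg _) (hu i (by simp [hi]))) fun i hi => ?_
    refine disjoint_smul_smul ha0 (hu i (by simp [hi])) ?_ (abs_nonneg _) (abs_nonneg _)
    exact h a (by simp) i (by simp [hi]) (by rintro rfl; exact ha hi)

end DisjointSums

/-! ### The Boolean algebra generated by a sequence of components -/

section Pieces

variable {E : Type*} [NormedAddCommGroup E] [NormedSpace ℝ E] [Lattice E] [IsBanachLattice E]

/-- The atom of the Boolean algebra of components of `e` generated by `b 0, …, b (n - 1)` which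
lies below exactly those `b i` with `i ∈ A`. -/
def piece (e : E) (b : ℕ → E) : ℕ → Finset ℕ → E
  | 0, _ => e
  | n + 1, A => if n ∈ A then piece e b n A ⊓ b n else piece e b n A ⊓ (e - b n)

variable {e : E} {b : ℕ → E}

theorem piece_zero (A : Finset ℕ) : piece e b 0 A = e := rfl

theorem piece_succ (n : ℕ) (A : Finset ℕ) : piece e b (n + 1) A =
    if n ∈ A then piece e b n A ⊓ b n else piece e b n A ⊓ (e - b n) := rfl

theorem piece_congr {n : ℕ} {A B : Finset ℕ} (h : ∀ i < n, i ∈ A ↔ i ∈ B) :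
    piece e b n A = piece e b n B := by
  induction n with
  | zero => rfl
  | succ n ih =>
    simp only [piece_succ, h n (Nat.lt_succ_self n), ih fun i hi => h i (hi.trans n.lt_succ_self)]

theorem isComponent_piece (he : 0 ≤ e) (hb : ∀ n, IsComponent e (b n)) (n : ℕ) (A : Finset ℕ) :
    IsComponent e (piece e b n A) := by
  induction n with
  | zero => exact .self he
  | succ n ih =>
    rw [piece_succ]
    split_ifs
    exacts [ih.inf (hb n), ih.inf (hb n).compl]

theorem piece_succ_le (n : ℕ) (A : Finset ℕ) : piece e b (n + 1) A ≤ piece e b n A := by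
  rw [piece_succ]; split_ifs <;> exact inf_le_left

theorem piece_insert (n : ℕ) (A : Finset ℕ) :
    piece e b (n + 1) (insert n A) = piece e b n A ⊓ b n := by
  rw [piece_succ, if_pos (Finset.mem_insert_self _ _), piece_congr (B := A)]
  intro i hi
  simp [hi.ne]

theorem piece_of_notMem {n : ℕ} {A : Finset ℕ} (hn : n ∉ A) :
    piece e b (n + 1) A = piece e b n A ⊓ (e - b n) := by
  rw [piece_succ, if_neg hn]

theorem piece_eq_add (he : 0 ≤ e) (hb : ∀ n, IsComponent e (b n)) {n : ℕ} {A : Finset ℕ}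
    (hn : n ∉ A) : piece e b n A = piece e b (n + 1) A + piece e b (n + 1) (insert n A) := by
  have h := isComponent_piece he hb n A
  rw [piece_insert, piece_of_notMem hn, add_comm, (hb n).inf_add_inf_compl h.nonneg h.le]

theorem piece_disjoint_of_mem (he : 0 ≤ e) (hb : ∀ n, IsComponent e (b n)) {n i : ℕ}
    {A B : Finset ℕ} (hi : i < n) (hA : i ∈ A) (hB : i ∉ B) :
    piece e b n A ⊓ piece e b n B = 0 := by
  induction n with
  | zero => omega
  | succ n ih =>
    have hA0 := (isComponent_piece he hb (n + 1) A).nonneg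
    have hB0 := (isComponent_piece he hb (n + 1) B).nonneg
    rcases Nat.lt_succ_iff_lt_or_eq.1 hi with h | rfl
    · exact inf_eq_zero_of_le (ih h) hA0 hB0 (piece_succ_le _ _) (piece_succ_le _ _)
    · refine inf_eq_zero_of_le (hb i).inf_sub hA0 hB0 ?_ ?_
      · rw [piece_succ, if_pos hA]; exact inf_le_right
      · rw [piece_succ, if_neg hB]; exact inf_le_right

theorem piece_disjoint (he : 0 ≤ e) (hb : ∀ n, IsComponent e (b n)) {n : ℕ} {A B : Finset ℕ}
    (hA : A ∈ (Finset.range n).powerset) (hB : B ∈ (Finset.range n).powerset) (hAB : A ≠ B) :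
    piece e b n A ⊓ piece e b n B = 0 := by
  rw [Finset.mem_powerset] at hA hB
  obtain ⟨i, hi⟩ : ∃ i, ¬(i ∈ A ↔ i ∈ B) := by
    by_contra! h; exact hAB (Finset.ext h)
  by_cases hiA : i ∈ A
  · exact piece_disjoint_of_mem he hb (Finset.mem_range.1 (hA hiA)) hiA (by tauto)
  · rw [inf_comm]
    exact piece_disjoint_of_mem he hb (i := i) (Finset.mem_range.1 (hB (by tauto))) (by tauto) hiA

theorem sum_piece_inf (he : 0 ≤ e) (hb : ∀ n, IsComponent e (b n)) {x : E} (hx : 0 ≤ x) (n : ℕ) :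
    ∑ A ∈ (Finset.range n).powerset, piece e b n A ⊓ x = e ⊓ x := by
  induction n with
  | zero => simp [piece_zero]
  | succ n ih =>
    rw [Finset.range_add_one, Finset.sum_powerset_insert (by simp), ← Finset.sum_add_distrib, ← ih]
    refine Finset.sum_congr rfl fun A hA => ?_
    have hn : n ∉ A := fun h => by simpa using Finset.mem_powerset.1 hA h
    rw [piece_eq_add he hb hn, inf_comm, inf_comm _ x, inf_comm _ x, inf_add_of_disjoint hx]
    · exact (isComponent_piece he hb _ _).nonneg
    · exact (isComponent_piece he hb _ _).nonneg
    · rw [inf_comm]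
      exact piece_disjoint_of_mem he hb n.lt_succ_self (Finset.mem_insert_self _ _) hn

/-- Functions on finite sets of natural numbers which only depend on the trace on an initial
segment; they serve as coefficients of step functions over the pieces. -/
def cylinderFun : Submodule ℝ (Finset ℕ → ℝ) where
  carrier := {f | ∃ n, ∀ A, f A = f (A ∩ Finset.range n)}
  zero_mem' := ⟨0, fun _ => rfl⟩
  add_mem' := by
    rintro f g ⟨n, hn⟩ ⟨m, hm⟩
    refine ⟨max n m, fun A => ?_⟩
    have h1 : Finset.range (max n m) ∩ Finset.range n = Finset.range n :=
      Finset.inter_eq_right.2 (Finset.range_mono (le_max_left _ _))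
    have h2 : Finset.range (max n m) ∩ Finset.range m = Finset.range m :=
      Finset.inter_eq_right.2 (Finset.range_mono (le_max_right _ _))
    simp only [Pi.add_apply]
    rw [hn A, hm A, hn (A ∩ Finset.range (max n m)), hm (A ∩ Finset.range (max n m)),
      Finset.inter_assoc, Finset.inter_assoc, h1, h2]
  smul_mem' := by
    rintro c f ⟨n, hn⟩
    exact ⟨n, fun A => by simp only [Pi.smul_apply]; rw [hn A]⟩

/-- The step element with coefficients `f` over the pieces of level `n`. -/
def stepSum (e : E) (b : ℕ → E) (n : ℕ) (f : Finset ℕ → ℝ) : E :=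
  ∑ A ∈ (Finset.range n).powerset, f A • piece e b n A

theorem stepSum_succ (he : 0 ≤ e) (hb : ∀ n, IsComponent e (b n)) {n : ℕ} {f : Finset ℕ → ℝ}
    (hf : ∀ A, f A = f (A ∩ Finset.range n)) : stepSum e b (n + 1) f = stepSum e b n f := by
  unfold stepSum
  rw [Finset.range_add_one, Finset.sum_powerset_insert (by simp), ← Finset.sum_add_distrib]
  refine Finset.sum_congr rfl fun A hA => ?_
  have hn : n ∉ A := fun h => by simpa using Finset.mem_powerset.1 hA h
  have h1 : f (insert n A) = f A := by
    rw [hf (insert n A), hf A, Finset.insert_inter_of_notMem (by simp)]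
  rw [h1, ← smul_add, ← piece_eq_add he hb hn]

theorem stepSum_of_le (he : 0 ≤ e) (hb : ∀ n, IsComponent e (b n)) {n m : ℕ} {f : Finset ℕ → ℝ}
    (hf : ∀ A, f A = f (A ∩ Finset.range n)) (h : n ≤ m) : stepSum e b m f = stepSum e b n f := by
  induction m, h using Nat.le_induction with
  | base => rfl
  | succ m hm ih =>
    rw [stepSum_succ he hb, ih]
    intro A
    rw [hf A, hf (A ∩ Finset.range m), Finset.inter_assoc,
      Finset.inter_eq_right.2 (Finset.range_mono hm)]

theorem stepSum_eq (he : 0 ≤ e) (hb : ∀ n, IsComponent e (b n)) {n m : ℕ} {f : Finset ℕ → ℝ}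
    (hn : ∀ A, f A = f (A ∩ Finset.range n)) (hm : ∀ A, f A = f (A ∩ Finset.range m)) :
    stepSum e b n f = stepSum e b m f := by
  rcases le_total n m with h | h
  · exact (stepSum_of_le he hb hn h).symm
  · exact stepSum_of_le he hb hm h

/-- The step element with coefficients `f`, at any level on which `f` depends. -/
def stepMap (he : 0 ≤ e) (hb : ∀ n, IsComponent e (b n)) : cylinderFun →ₗ[ℝ] E where
  toFun f := stepSum e b f.2.choose f
  map_add' f g := by
    have hf := f.2.choose_spec
    have hg := g.2.choose_spec
    have hfg := (f + g).2.choose_spec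
    set n := f.2.choose
    set m := g.2.choose
    set k := (f + g).2.choose
    rw [← stepSum_of_le he hb hf (le_max_left n (max m k)),
      ← stepSum_of_le he hb hg ((le_max_left m k).trans (le_max_right n _)),
      ← stepSum_of_le he hb hfg ((le_max_right m k).trans (le_max_right n _))]
    simp only [stepSum, Submodule.coe_add, Pi.add_apply, add_smul, Finset.sum_add_distrib]
  map_smul' c f := by
    have hf := f.2.choose_spec
    have hcf := (c • f).2.choose_spec
    set n := f.2.choose
    set m := (c • f).2.choose
    rw [← stepSum_of_le he hb hf (le_max_left n m), ← stepSum_of_le he hb hcf (le_max_right n m)]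
    simp only [stepSum, Submodule.coe_smul, Pi.smul_apply, smul_eq_mul, mul_smul, Finset.smul_sum,
      RingHom.id_apply]

theorem stepMap_apply (he : 0 ≤ e) (hb : ∀ n, IsComponent e (b n)) (f : cylinderFun) {n : ℕ}
    (hn : ∀ A, (f : Finset ℕ → ℝ) A = (f : Finset ℕ → ℝ) (A ∩ Finset.range n)) :
    stepMap he hb f = stepSum e b n f :=
  stepSum_eq he hb f.2.choose_spec hn

/-- The cylinder function `A ↦ 1` if `i ∈ A`, whose step element is `b i`. -/
def memFun (i : ℕ) : cylinderFun :=
  ⟨fun A => if i ∈ A then 1 else 0, i + 1, fun A => by simp⟩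

theorem stepMap_memFun (he : 0 ≤ e) (hb : ∀ n, IsComponent e (b n)) (i : ℕ) :
    stepMap he hb (memFun i) = b i := by
  rw [stepMap_apply he hb (memFun i) (n := i + 1) (fun A => by simp [memFun]), stepSum,
    Finset.range_add_one, Finset.sum_powerset_insert (by simp), Finset.sum_eq_zero, zero_add]
  · rw [← inf_eq_right.2 (hb i).le, ← sum_piece_inf he hb (hb i).nonneg i]
    refine Finset.sum_congr rfl fun A _ => ?_
    rw [piece_insert]
    simp [memFun]
  · intro A hA
    have hn : i ∉ A := fun h => by simpa using Finset.mem_powerset.1 hA h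
    simp [memFun, hn]

theorem stepMap_single (he : 0 ≤ e) (hb : ∀ n, IsComponent e (b n)) {n : ℕ} {A : Finset ℕ}
    (hA : A ∈ (Finset.range n).powerset) : piece e b n A ∈ LinearMap.range (stepMap he hb) := by
  let f : cylinderFun := ⟨fun B => if B ∩ Finset.range n = A then 1 else 0, n, fun B => by simp⟩
  have hf : ∀ B, (f : Finset ℕ → ℝ) B = if B ∩ Finset.range n = A then 1 else 0 := fun _ => rfl
  refine ⟨f, ?_⟩
  rw [stepMap_apply he hb f (n := n) (fun B => by simp [hf]), stepSum, Finset.sum_eq_single A]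
  · rw [hf, if_pos (Finset.inter_eq_left.2 (Finset.mem_powerset.1 hA)), one_smul]
  · intro B hB hBA
    rw [hf, if_neg, zero_smul]
    rwa [Finset.inter_eq_left.2 (Finset.mem_powerset.1 hB)]
  · exact fun h => absurd hA h

theorem denseRange_stepMap (he : 0 ≤ e) (hb : ∀ n, IsComponent e (b n))
    (hd : ∀ x, x ∈ closure (Submodule.span ℝ (range b) : Set E)) :
    DenseRange (stepMap he hb) := by
  intro x
  refine closure_mono ?_ (hd x)
  have : Submodule.span ℝ (range b) ≤ LinearMap.range (stepMap he hb) := by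
    rw [Submodule.span_le]
    rintro _ ⟨i, rfl⟩
    exact ⟨memFun i, stepMap_memFun he hb i⟩
  exact this

end Pieces

/-! ### Isomorphisms from systems of components -/

section Uniqueness

variable {E G : Type*} [NormedAddCommGroup E] [NormedSpace ℝ E] [Lattice E] [IsBanachLattice E]
  [NormedAddCommGroup G] [NormedSpace ℝ G] [Lattice G] [IsBanachLattice G] {q : ℝ}

/-- Two `q`-additive Banach lattices, each densely spanned by the pieces of a sequence of
components of a positive element, are isomorphic as soon as corresponding pieces have equal
norms. -/
theorem IsPAdditive.exists_iso_of_norm_piece_eq (hE : IsPAdditive q E) (hG : IsPAdditive q G)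
    {e : E} {b : ℕ → E} (he : 0 ≤ e) (hb : ∀ n, IsComponent e (b n))
    (hR : DenseRange (stepMap he hb))
    {e' : G} {b' : ℕ → G} (he' : 0 ≤ e') (hb' : ∀ n, IsComponent e' (b' n))
    (hR' : DenseRange (stepMap he' hb'))
    (hn : ∀ n A, A ∈ (Finset.range n).powerset → ‖piece e b n A‖ = ‖piece e' b' n A‖) :
    ∃ L : BanachLatticeIso E G, ∀ i, L.toLinearIsometryEquiv (b i) = b' i := by
  -- the norm of a step element depends only on its coefficients and the norms of the pieces
  have hnorm : ∀ f : cylinderFun, ‖stepMap he' hb' f‖ = ‖stepMap he hb f‖ := by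
    intro f
    obtain ⟨n, hfn⟩ := f.2
    rw [stepMap_apply he' hb' f hfn, stepMap_apply he hb f hfn]
    have h1 : ‖stepSum e' b' n f‖ ^ q = ‖stepSum e b n f‖ ^ q := by
      unfold stepSum
      rw [hG.norm_sum_smul_of_disjoint _ _ _ (fun A _ => (isComponent_piece he' hb' n A).nonneg)
        fun A hA B hB => piece_disjoint he' hb' hA hB,
        hE.norm_sum_smul_of_disjoint _ _ _ (fun A _ => (isComponent_piece he hb n A).nonneg)
        fun A hA B hB => piece_disjoint he hb hA hB]
      exact Finset.sum_congr rfl fun A hA => by rw [hn n A hA]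
    exact (Real.rpow_left_inj (norm_nonneg _) (norm_nonneg _) hE.pos.ne').1 h1
  let L : E ≃ₗᵢ[ℝ] G := (LinearEquiv.refl ℝ cylinderFun).extendOfIsometry
    (stepMap he hb) (stepMap he' hb') hR hR' hnorm
  have hL : ∀ f, L (stepMap he hb f) = stepMap he' hb' f := fun f =>
    LinearEquiv.extendOfIsometry_eq ..
  -- the absolute value of a step element is taken coefficientwise
  have habs : ∀ x, L |x| = |L x| := by
    refine hR.induction (P := fun x => L |x| = |L x|) ?_ ?_
    · rintro _ ⟨f, rfl⟩
      obtain ⟨n, hfn⟩ := f.2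
      let g : cylinderFun := ⟨fun A => |(f : Finset ℕ → ℝ) A|, n,
        fun A => congrArg _ (hfn A)⟩
      have h1 : |stepMap he hb f| = stepMap he hb g := by
        rw [stepMap_apply he hb f hfn, stepMap_apply he hb g (n := n)
          (fun A => congrArg abs (hfn A))]
        exact abs_sum_smul_of_disjoint _ _ _ (fun A _ => (isComponent_piece he hb n A).nonneg)
          fun A hA B hB => piece_disjoint he hb hA hB
      have h2 : |stepMap he' hb' f| = stepMap he' hb' g := by
        rw [stepMap_apply he' hb' f hfn, stepMap_apply he' hb' g (n := n)
          (fun A => congrArg abs (hfn A))]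
        exact abs_sum_smul_of_disjoint _ _ _ (fun A _ => (isComponent_piece he' hb' n A).nonneg)
          fun A hA B hB => piece_disjoint he' hb' hA hB
      rw [h1, hL, hL, h2]
    · have h1 : Continuous fun x : E => L (x ⊔ -x) := by fun_prop
      have h2 : Continuous fun x : E => L x ⊔ -L x := by fun_prop
      exact isClosed_eq h1 h2
  refine ⟨.ofMapAbs L habs, fun i => ?_⟩
  have := hL (memFun i)
  rwa [stepMap_memFun, stepMap_memFun] at this

end Uniqueness

/-! ### The Banach lattice `L_p` -/

section LpLattice

variable {p : ℝ≥0∞} [Fact (1 ≤ p)] {Ω : Type*} [m0 : MeasurableSpace Ω] {μ : Measure Ω}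

/-- Mathlib provides the order, the solid norm and completeness of `L_p`; only the compatibility
with scalar multiplication is to be checked. -/
instance instIsBanachLatticeLp : IsBanachLattice (Lp ℝ p μ) where
  smul_le_smul_of_nonneg_left c hc f g hfg := by
    rw [← Lp.coeFn_le] at hfg ⊢
    filter_upwards [hfg, Lp.coeFn_smul c f, Lp.coeFn_smul c g] with x h1 h2 h3
    rw [h2, h3]
    exact smul_le_smul_of_nonneg_left h1 hc
  smul_le_smul_of_nonneg_right f hf c d hcd := by
    rw [← Lp.coeFn_le] at hf ⊢
    filter_upwards [hf, Lp.coeFn_smul c f, Lp.coeFn_smul d f, Lp.coeFn_zero ℝ p μ]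
      with x h1 h2 h3 h4
    rw [h4] at h1
    rw [h2, h3]
    exact smul_le_smul_of_nonneg_right hcd h1

theorem toReal_pos_of_fact (hp : p ≠ ∞) : 0 < p.toReal :=
  ENNReal.toReal_pos (zero_lt_one.trans_le (Fact.out : 1 ≤ p)).ne' hp

theorem ofReal_norm_rpow_eq_lintegral (hp : p ≠ ∞) (f : Lp ℝ p μ) :
    ENNReal.ofReal (‖f‖ ^ p.toReal) = ∫⁻ x, ‖f x‖ₑ ^ p.toReal ∂μ := by
  have h0 : p ≠ 0 := (zero_lt_one.trans_le (Fact.out : 1 ≤ p)).ne'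
  have hq := toReal_pos_of_fact hp
  rw [← ENNReal.ofReal_rpow_of_nonneg (norm_nonneg _) hq.le, Lp.norm_def,
    ENNReal.ofReal_toReal (Lp.eLpNorm_ne_top f), eLpNorm_eq_lintegral_rpow_enorm_toReal h0 hp,
    ← ENNReal.rpow_mul, one_div, inv_mul_cancel₀ hq.ne', ENNReal.rpow_one]

/-- Superadditivity is the pointwise inequality `a ^ p + b ^ p ≤ (a + b) ^ p` for `a, b ≥ 0`; if one
of `a` and `b` is zero it is an equality. -/
theorem isPAdditive_Lp (hp : p ≠ ∞) : IsPAdditive p.toReal (Lp ℝ p μ) := by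
  have h1 : 1 ≤ p.toReal := by
    rw [← ENNReal.toReal_one]; exact (ENNReal.toReal_le_toReal (by simp) hp).2 Fact.out
  have hr : ∀ f : Lp ℝ p μ, 0 ≤ ‖f‖ ^ p.toReal := fun f => by positivity
  refine ⟨h1, fun f g hf hg => ?_, fun f g hf hg hfg => ?_⟩
  · rw [← ENNReal.ofReal_le_ofReal_iff (hr _), ENNReal.ofReal_add (hr _) (hr _),
      ofReal_norm_rpow_eq_lintegral hp, ofReal_norm_rpow_eq_lintegral hp,
      ofReal_norm_rpow_eq_lintegral hp, ← lintegral_add_left']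
    · rw [← Lp.coeFn_le] at hf hg
      refine lintegral_mono_ae ?_
      filter_upwards [hf, hg, Lp.coeFn_zero ℝ p μ, Lp.coeFn_add f g] with x h2 h3 h4 h5
      rw [h4] at h2 h3
      simp only [Pi.zero_apply] at h2 h3
      rw [h5, Pi.add_apply]
      refine (ENNReal.add_rpow_le_rpow_add _ _ h1).trans (le_of_eq ?_)
      rw [Real.enorm_of_nonneg h2, Real.enorm_of_nonneg h3, Real.enorm_of_nonneg (add_nonneg h2 h3),
        ENNReal.ofReal_add h2 h3]
    · exact (Lp.aestronglyMeasurable f).enorm.pow_const _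
  · have : ENNReal.ofReal (‖f + g‖ ^ p.toReal) =
        ENNReal.ofReal (‖f‖ ^ p.toReal + ‖g‖ ^ p.toReal) := by
      rw [ENNReal.ofReal_add (hr _) (hr _), ofReal_norm_rpow_eq_lintegral hp,
        ofReal_norm_rpow_eq_lintegral hp, ofReal_norm_rpow_eq_lintegral hp, ← lintegral_add_left']
      · refine lintegral_congr_ae ?_
        have hfg' := Lp.coeFn_inf f g
        rw [hfg] at hfg'
        filter_upwards [hfg', Lp.coeFn_zero ℝ p μ, Lp.coeFn_add f g] with x h2 h4 h5
        rw [h4, Pi.inf_apply] at h2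
        rw [h5, Pi.add_apply]
        rcases le_total (f x) (g x) with h | h
        · rw [inf_eq_left.2 h] at h2
          simp [← h2, ENNReal.zero_rpow_of_pos (toReal_pos_of_fact hp)]
        · rw [inf_eq_right.2 h] at h2
          simp [← h2, ENNReal.zero_rpow_of_pos (toReal_pos_of_fact hp)]
      · exact (Lp.aestronglyMeasurable f).enorm.pow_const _
    rwa [ENNReal.ofReal_eq_ofReal_iff (hr _) (add_nonneg (hr _) (hr _))] at this

theorem coeFn_toLp_indicator {A : Set Ω} (hA : MeasurableSet A) (f : Lp ℝ p μ) :
    ((Lp.memLp f).indicator hA).toLp (A.indicator f) =ᵐ[μ] A.indicator f :=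
  MemLp.coeFn_toLp _

/-- Multiplication by the indicator function of a measurable set, as a linear map of `L_p`. -/
def indicatorLinear (p : ℝ≥0∞) [Fact (1 ≤ p)] (μ : Measure Ω) {A : Set Ω} (hA : MeasurableSet A) :
    Lp ℝ p μ →ₗ[ℝ] Lp ℝ p μ where
  toFun f := ((Lp.memLp f).indicator hA).toLp (A.indicator f)
  map_add' f g := by
    apply Lp.ext
    filter_upwards [coeFn_toLp_indicator hA f, coeFn_toLp_indicator hA g,
      coeFn_toLp_indicator hA (f + g), Lp.coeFn_add f g,
      Lp.coeFn_add (((Lp.memLp f).indicator hA).toLp (A.indicator f))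
        (((Lp.memLp g).indicator hA).toLp (A.indicator g))] with x h1 h2 h3 h4 h5
    rw [h3, h5, Pi.add_apply, h1, h2]
    by_cases h : x ∈ A
    · simp only [indicator_of_mem h, h4, Pi.add_apply]
    · simp only [indicator_of_notMem h, add_zero]
  map_smul' c f := by
    apply Lp.ext
    filter_upwards [coeFn_toLp_indicator hA f, coeFn_toLp_indicator hA (c • f), Lp.coeFn_smul c f,
      Lp.coeFn_smul c (((Lp.memLp f).indicator hA).toLp (A.indicator f))] with x h1 h2 h3 h4
    rw [h2, RingHom.id_apply, h4, Pi.smul_apply, h1]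
    by_cases h : x ∈ A
    · simp only [indicator_of_mem h, h3, Pi.smul_apply]
    · simp only [indicator_of_notMem h, smul_zero]

theorem indicatorLinear_coeFn {A : Set Ω} (hA : MeasurableSet A) (f : Lp ℝ p μ) :
    indicatorLinear p μ hA f =ᵐ[μ] A.indicator f :=
  coeFn_toLp_indicator hA f

theorem norm_indicatorLinear_le {A : Set Ω} (hA : MeasurableSet A) (f : Lp ℝ p μ) :
    ‖indicatorLinear p μ hA f‖ ≤ 1 * ‖f‖ := by
  rw [one_mul]
  refine Lp.norm_le_norm_of_ae_le ?_
  filter_upwards [indicatorLinear_coeFn hA f] with x hx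
  rw [hx]
  exact norm_indicator_le_norm_self _ _

/-- Multiplication by the indicator function of a measurable set, a contraction of `L_p`. -/
def indicatorL (p : ℝ≥0∞) [Fact (1 ≤ p)] (μ : Measure Ω) {A : Set Ω} (hA : MeasurableSet A) :
    Lp ℝ p μ →L[ℝ] Lp ℝ p μ :=
  (indicatorLinear p μ hA).mkContinuous 1 (norm_indicatorLinear_le hA)

theorem indicatorL_coeFn {A : Set Ω} (hA : MeasurableSet A) (f : Lp ℝ p μ) :
    indicatorL p μ hA f =ᵐ[μ] A.indicator f :=
  indicatorLinear_coeFn hA f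

theorem indicatorL_indicatorConstLp [IsFiniteMeasure μ] {A s : Set Ω} (hA : MeasurableSet A)
    (hs : MeasurableSet s) (c : ℝ) :
    indicatorL p μ hA (indicatorConstLp p hs (measure_ne_top μ s) c) =
      indicatorConstLp p (hA.inter hs) (measure_ne_top μ _) c := by
  apply Lp.ext
  filter_upwards [indicatorL_coeFn hA (indicatorConstLp p hs (measure_ne_top μ s) c),
    indicatorConstLp_coeFn (p := p) (hs := hs) (hμs := measure_ne_top μ s) (c := c),
    indicatorConstLp_coeFn (p := p) (hs := hA.inter hs) (hμs := measure_ne_top μ _) (c := c)]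
    with x h1 h2 h3
  rw [h1, h3, ← Set.indicator_indicator]
  by_cases h : x ∈ A <;> simp [h, h2]

end LpLattice

/-! ### Indicator functions from a generating family -/

section GeneratingFamilies

variable {p : ℝ≥0∞} [Fact (1 ≤ p)] {Ω : Type*} {m m0 : MeasurableSpace Ω} {μ : Measure Ω}

/-- The case of indicator functions of `indicatorL_mem_of_generateFrom`: the sets `s` with `1_(A ∩
s)` in the closed subspace `W` form a λ-system. -/
theorem indicatorConstLp_inter_mem [IsFiniteMeasure μ] (hp : p ≠ ∞) (hm : m ≤ m0)
    {C : Set (Set Ω)} (hgen : m = MeasurableSpace.generateFrom C) (hC : IsPiSystem C) {A : Set Ω}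
    (hA : MeasurableSet A) {W : Submodule ℝ (Lp ℝ p μ)} (hW : IsClosed (W : Set (Lp ℝ p μ)))
    (hAW : indicatorConstLp p hA (measure_ne_top μ A) (1 : ℝ) ∈ W)
    (hCW : ∀ s ∈ C, ∀ hs : MeasurableSet s,
      indicatorConstLp p (hA.inter hs) (measure_ne_top μ _) (1 : ℝ) ∈ W)
    (s : Set Ω) (hs : MeasurableSet[m] s) :
    indicatorConstLp p (hA.inter (hm s hs)) (measure_ne_top μ _) (1 : ℝ) ∈ W := by
  induction s, hs using MeasurableSpace.induction_on_inter hgen hC with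
  | empty =>
    have : indicatorConstLp p (hA.inter (hm ∅ (@MeasurableSet.empty _ m)))
        (measure_ne_top μ _) (1 : ℝ) = 0 := by
      apply Lp.ext
      filter_upwards [indicatorConstLp_coeFn (p := p)
        (hs := hA.inter (hm ∅ (@MeasurableSet.empty _ m))) (hμs := measure_ne_top μ _)
        (c := (1 : ℝ)),
        Lp.coeFn_zero ℝ p μ] with x h1 h2
      rw [h1, h2]; simp
    rw [this]; exact W.zero_mem
  | basic t ht =>
    exact hCW t ht (hm t (hgen ▸ MeasurableSpace.measurableSet_generateFrom ht))
  | compl t ht ih =>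
    have : indicatorConstLp p (hA.inter (hm tᶜ (@MeasurableSet.compl _ _ m ht)))
          (measure_ne_top μ _) (1 : ℝ) =
        indicatorConstLp p hA (measure_ne_top μ A) (1 : ℝ) -
        indicatorConstLp p (hA.inter (hm t ht)) (measure_ne_top μ _) (1 : ℝ) := by
      rw [eq_sub_iff_add_eq, ← indicatorConstLp_disjoint_union]
      · congr 1
        rw [← inter_union_distrib_left, compl_union_self, inter_univ]
      · exact (disjoint_compl_left).mono inter_subset_right inter_subset_right
    rw [this]
    exact W.sub_mem hAW ih
  | iUnion f hd hfm ih =>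
    -- the union is the limit in `L_p` of its finite parts
    have hfin : ∀ n, MeasurableSet (A ∩ ⋃ i ∈ Finset.range n, f i) := fun n =>
      hA.inter (Finset.measurableSet_biUnion _ fun i _ => hm _ (hfm i))
    have h1 : ∀ n, indicatorConstLp p (hfin n) (measure_ne_top μ _) (1 : ℝ) ∈ W := by
      intro n
      induction n with
      | zero =>
        have : indicatorConstLp p (hfin 0) (measure_ne_top μ _) (1 : ℝ) = 0 := by
          apply Lp.ext
          filter_upwards [indicatorConstLp_coeFn (p := p)
            (hs := hfin 0) (hμs := measure_ne_top μ _) (c := (1 : ℝ)),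
            Lp.coeFn_zero ℝ p μ] with x h1 h2
          rw [h1, h2]; simp
        rw [this]; exact W.zero_mem
      | succ n ihn =>
        have : indicatorConstLp p (hfin (n + 1)) (measure_ne_top μ _) (1 : ℝ) =
            indicatorConstLp p (hfin n) (measure_ne_top μ _) (1 : ℝ) +
            indicatorConstLp p (hA.inter (hm _ (hfm n))) (measure_ne_top μ _) (1 : ℝ) := by
          rw [← indicatorConstLp_disjoint_union]
          · congr 1
            rw [← inter_union_distrib_left, Finset.range_add_one, Finset.set_biUnion_insert,
              union_comm]
          · refine Disjoint.mono inter_subset_right inter_subset_right ?_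
            simp only [Set.disjoint_iUnion_left]
            intro i hi
            exact hd (Finset.mem_range.1 hi).ne
        rw [this]
        exact W.add_mem ihn (ih n)
    refine hW.mem_of_tendsto (b := atTop) (tendsto_indicatorConstLp_set hp (ht := hfin)
      (hμt := fun n => measure_ne_top μ _) ?_) (Eventually.of_forall h1)
    -- the symmetric differences decrease to the empty set
    have h2 : ∀ n, symmDiff (A ∩ ⋃ i ∈ Finset.range n, f i) (A ∩ ⋃ i, f i) =
        A ∩ ((⋃ i, f i) \ ⋃ i ∈ Finset.range n, f i) := by
      intro n
      have hsub : (⋃ i ∈ Finset.range n, f i) ⊆ ⋃ i, f i :=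
        iUnion₂_subset fun i _ => subset_iUnion f i
      rw [symmDiff_of_le (inter_subset_inter_right _ hsub), ← inter_sdiff_distrib_left]
    simp_rw [h2]
    have h3 := tendsto_measure_iInter_atTop (μ := μ)
      (s := fun n => A ∩ ((⋃ i, f i) \ ⋃ i ∈ Finset.range n, f i)) ?_ ?_ ⟨0, measure_ne_top μ _⟩
    · have h4 : (⋂ n, A ∩ ((⋃ i, f i) \ ⋃ i ∈ Finset.range n, f i)) = ∅ := by
        rw [eq_empty_iff_forall_notMem]
        intro x hx
        rw [mem_iInter] at hx
        obtain ⟨j, hj⟩ := mem_iUnion.1 (hx 0).2.1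
        exact (hx (j + 1)).2.2 (mem_iUnion₂.2 ⟨j, by simp, hj⟩)
      rwa [h4, measure_empty] at h3
    · exact fun n => (hA.inter ((MeasurableSet.iUnion fun i => hm _ (hfm i)).diff
        (Finset.measurableSet_biUnion _ fun i _ => hm _ (hfm i)))).nullMeasurableSet
    · intro a b hab
      refine inter_subset_inter_right _ (sdiff_subset_sdiff_right ?_)
      exact biUnion_subset_biUnion_left fun i hi => by
        simp only [Finset.coe_range, mem_Iio] at hi ⊢; omega

/-- A closed subspace of `L_p` which contains the indicator functions of `A` and of the sets
`A ∩ s`, for `s` in a π-system generating the σ-algebra `m`, contains `1_A f` for all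
`m`-measurable `f`. -/
theorem indicatorL_mem_of_generateFrom [IsFiniteMeasure μ] (hp : p ≠ ∞) (hm : m ≤ m0)
    {C : Set (Set Ω)} (hgen : m = MeasurableSpace.generateFrom C) (hC : IsPiSystem C) {A : Set Ω}
    (hA : MeasurableSet A) {W : Submodule ℝ (Lp ℝ p μ)} (hW : IsClosed (W : Set (Lp ℝ p μ)))
    (hAW : indicatorConstLp p hA (measure_ne_top μ A) (1 : ℝ) ∈ W)
    (hCW : ∀ s ∈ C, ∀ hs : MeasurableSet s,
      indicatorConstLp p (hA.inter hs) (measure_ne_top μ _) (1 : ℝ) ∈ W)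
    (f : Lp ℝ p μ) (hf : AEStronglyMeasurable[m] f μ) : indicatorL p μ hA f ∈ W := by
  refine Lp.induction_stronglyMeasurable hm hp (fun f => indicatorL p μ hA f ∈ W) ?_ ?_ ?_ f hf
  · intro c s hs hμs
    have h1 := indicatorConstLp_inter_mem hp hm hgen hC hA hW hAW hCW s hs
    rw [Lp.simpleFunc.coe_indicatorConst]
    rw [indicatorL_indicatorConstLp]
    have h2 : indicatorConstLp p (hA.inter (hm s hs)) (measure_ne_top μ _) c =
        c • indicatorConstLp p (hA.inter (hm s hs)) (measure_ne_top μ _) (1 : ℝ) := by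
      apply Lp.ext
      filter_upwards [Lp.coeFn_smul c (indicatorConstLp p (hA.inter (hm s hs))
          (measure_ne_top μ _) (1 : ℝ)),
        indicatorConstLp_coeFn (p := p) (hs := hA.inter (hm s hs)) (hμs := measure_ne_top μ _)
          (c := (1 : ℝ)),
        indicatorConstLp_coeFn (p := p) (hs := hA.inter (hm s hs)) (hμs := measure_ne_top μ _)
          (c := c)] with x h1 h2 h3
      rw [h1, h3, Pi.smul_apply, h2]
      by_cases h : x ∈ A ∩ s
      · simp only [indicator_of_mem h, smul_eq_mul, mul_one]
      · simp only [indicator_of_notMem h, smul_zero]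
    rw [h2]
    exact W.smul_mem _ h1
  · intro f g hf hg _ _ _ h1 h2
    simp only [map_add]
    exact W.add_mem h1 h2
  · have : Continuous fun f : lpMeas ℝ ℝ m p μ => indicatorL p μ hA (f : Lp ℝ p μ) :=
      (indicatorL p μ hA).continuous.comp continuous_subtype_val
    exact hW.preimage this

end GeneratingFamilies

/-! ### Measures on the Cantor space -/

section CantorMeasure

/-- The set of binary sequences whose first `n` terms are the indicator of `A`. -/
def binCylinder (n : ℕ) (A : Finset ℕ) : Set (ℕ → Bool) := {ω | ∀ i < n, ω i = decide (i ∈ A)}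

theorem isClopen_binCylinder (n : ℕ) (A : Finset ℕ) : IsClopen (binCylinder n A) := by
  have : binCylinder n A =
      ⋂ i ∈ Finset.range n, (fun ω : ℕ → Bool => ω i) ⁻¹' {decide (i ∈ A)} := by
    ext ω; simp [binCylinder]
  rw [this]
  exact isClopen_biInter_finset fun i _ => (isClopen_discrete _).preimage (continuous_apply i)

theorem measurableSet_binCylinder (n : ℕ) (A : Finset ℕ) : MeasurableSet (binCylinder n A) :=
  (isClopen_binCylinder n A).isClosed.measurableSet

theorem exists_mem_binCylinder (n : ℕ) (ω : ℕ → Bool) :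
    ∃ A ∈ (Finset.range n).powerset, ω ∈ binCylinder n A := by
  refine ⟨(Finset.range n).filter fun i => ω i = true, by simp, fun i hi => ?_⟩
  by_cases h : ω i = true <;> simp [h, hi]

theorem binCylinder_succ_of_notMem {n : ℕ} {A : Finset ℕ} (hn : n ∉ A) :
    binCylinder (n + 1) A = binCylinder n A ∩ {ω | ω n = false} := by
  ext ω
  simp only [binCylinder, mem_ofPred_eq, mem_inter_iff, Nat.lt_succ_iff_lt_or_eq, or_imp,
    forall_and, forall_eq, hn, decide_false]

theorem binCylinder_succ_of_mem {n : ℕ} {A : Finset ℕ} (hn : n ∈ A) :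
    binCylinder (n + 1) A = binCylinder n A ∩ {ω | ω n = true} := by
  ext ω
  simp only [binCylinder, mem_ofPred_eq, mem_inter_iff, Nat.lt_succ_iff_lt_or_eq, or_imp,
    forall_and, forall_eq, hn, decide_true]

theorem isPiSystem_binCylinder :
    IsPiSystem {s | ∃ n, ∃ A ∈ (Finset.range n).powerset, s = binCylinder n A} := by
  have key : ∀ n m : ℕ, n ≤ m → ∀ A B : Finset ℕ, (binCylinder n A ∩ binCylinder m B).Nonempty →
      binCylinder n A ∩ binCylinder m B = binCylinder m B := by
    rintro n m hnm A B ⟨ω, h1, h2⟩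
    refine inter_eq_right.2 fun ω' h3 i hi => ?_
    rw [h3 i (hi.trans_le hnm), ← h2 i (hi.trans_le hnm), h1 i hi]
  rintro _ ⟨n, A, hA, rfl⟩ _ ⟨m, B, hB, rfl⟩ hne
  rcases le_total n m with h | h
  · exact ⟨m, B, hB, key n m h A B hne⟩
  · rw [inter_comm] at hne ⊢
    exact ⟨n, A, hA, key m n h B A hne⟩

theorem generateFrom_binCylinder :
    (inferInstance : MeasurableSpace (ℕ → Bool)) = MeasurableSpace.generateFrom
      {s | ∃ n, ∃ A ∈ (Finset.range n).powerset, s = binCylinder n A} := by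
  apply le_antisymm
  · refine iSup_le fun i => ?_
    rw [← measurable_iff_comap_le]
    refine @measurable_to_bool _ (MeasurableSpace.generateFrom _) _ ?_
    have : (fun ω : ℕ → Bool => ω i) ⁻¹' {true} =
        ⋃ A ∈ {A ∈ (Finset.range (i + 1)).powerset | i ∈ A}, binCylinder (i + 1) A := by
      ext ω
      simp only [mem_preimage, mem_singleton_iff, mem_iUnion, exists_prop]
      constructor
      · intro h
        obtain ⟨A, hA, hω⟩ := exists_mem_binCylinder (i + 1) ω
        refine ⟨A, Finset.mem_filter.2 ⟨hA, ?_⟩, hω⟩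
        have := hω i i.lt_succ_self
        rw [h] at this
        simpa using this.symm
      · rintro ⟨A, hA, hω⟩
        rw [hω i i.lt_succ_self]
        simpa using (Finset.mem_filter.1 hA).2
    rw [this]
    refine Finset.measurableSet_biUnion _ fun A hA => ?_
    exact MeasurableSpace.measurableSet_generateFrom ⟨_, A, (Finset.mem_filter.1 hA).1, rfl⟩
  · refine MeasurableSpace.generateFrom_le ?_
    rintro _ ⟨n, A, _, rfl⟩
    exact measurableSet_binCylinder n A

variable {w : ℕ → Finset ℕ → ℝ}

/-- The weighted sum of point evaluations which approximates the measure with cylinder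
masses `w`. -/
def cylinderEval (w : ℕ → Finset ℕ → ℝ) (n : ℕ) (f : (ℕ → Bool) → ℝ) : ℝ :=
  ∑ A ∈ (Finset.range n).powerset, w n A * f fun i => decide (i ∈ A)

theorem sum_cylinder_weights
    (hw : ∀ n, ∀ A ∈ (Finset.range n).powerset, w n A = w (n + 1) A + w (n + 1) (insert n A))
    (n : ℕ) : ∑ A ∈ (Finset.range n).powerset, w n A = w 0 ∅ := by
  induction n with
  | zero => simp
  | succ n ih =>
    rw [Finset.range_add_one, Finset.sum_powerset_insert (by simp), ← Finset.sum_add_distrib, ← ih]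
    exact Finset.sum_congr rfl fun A hA => (hw n A hA).symm

/-- From level `k` on, the discrete measures give the cylinders of level `k` their prescribed
masses. -/
theorem cylinderEval_indicator
    (hw : ∀ n, ∀ A ∈ (Finset.range n).powerset, w n A = w (n + 1) A + w (n + 1) (insert n A))
    {k n : ℕ} (hkn : k ≤ n) {A : Finset ℕ} (hA : A ∈ (Finset.range k).powerset) :
    cylinderEval w n ((binCylinder k A).indicator 1) = w k A := by
  classical
  induction n, hkn using Nat.le_induction with
  | base =>
    unfold cylinderEval
    rw [Finset.sum_eq_single A]
    · rw [indicator_of_mem (show _ ∈ binCylinder k A from fun i _ => rfl)]; simp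
    · intro B hB hBA
      rw [indicator_of_notMem, mul_zero]
      intro h
      apply hBA
      rw [Finset.mem_powerset] at hA hB
      ext i
      by_cases hi : i < k
      · simpa using h i hi
      · exact ⟨fun h => absurd (Finset.mem_range.1 (hB h)) hi,
          fun h => absurd (Finset.mem_range.1 (hA h)) hi⟩
    · exact fun h => absurd hA h
  | succ n hkn ih =>
    rw [← ih]
    unfold cylinderEval
    rw [Finset.range_add_one, Finset.sum_powerset_insert (by simp), ← Finset.sum_add_distrib]
    refine Finset.sum_congr rfl fun B hB => ?_
    have h1 : (binCylinder k A).indicator (1 : (ℕ → Bool) → ℝ) (fun i => decide (i ∈ insert n B)) =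
        (binCylinder k A).indicator 1 (fun i => decide (i ∈ B)) := by
      have : (fun i => decide (i ∈ insert n B)) ∈ binCylinder k A ↔
          (fun i => decide (i ∈ B)) ∈ binCylinder k A := by
        simp only [binCylinder, mem_ofPred_eq]
        refine forall₂_congr fun i hi => ?_
        have : i ≠ n := by omega
        simp [this]
      simp only [indicator, this, Pi.one_apply]
    rw [h1, ← add_mul, ← hw n B hB]

/-- A consistent system of nonnegative cylinder masses on the Cantor space comes from a finite
measure: the weak limit, along an ultrafilter, of discrete measures with these masses. -/
theorem exists_measure_binCylinder (hw0 : ∀ n A, 0 ≤ w n A)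
    (hw : ∀ n, ∀ A ∈ (Finset.range n).powerset, w n A = w (n + 1) A + w (n + 1) (insert n A)) :
    ∃ μ : Measure (ℕ → Bool), IsFiniteMeasure μ ∧
      ∀ n, ∀ A ∈ (Finset.range n).powerset, μ.real (binCylinder n A) = w n A := by
  let U : Ultrafilter ℕ := hyperfilter ℕ
  have hlim : ∀ f : CompactlySupportedContinuousMap (ℕ → Bool) ℝ, ∃ l,
      Tendsto (fun n => cylinderEval w n f) U (𝓝 l) := by
    intro f
    obtain ⟨C, hC⟩ := (isCompact_range f.continuous).isBounded.exists_norm_le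
    have hmem : ∀ n, cylinderEval w n f ∈ Icc (-(w 0 ∅ * C)) (w 0 ∅ * C) := by
      intro n
      rw [mem_Icc, ← abs_le, ← sum_cylinder_weights hw n, Finset.sum_mul]
      refine (Finset.abs_sum_le_sum_abs _ _).trans (Finset.sum_le_sum fun A _ => ?_)
      rw [abs_mul, abs_of_nonneg (hw0 n A)]
      exact mul_le_mul_of_nonneg_left (hC _ (mem_range_self _)) (hw0 n A)
    obtain ⟨l, -, hl⟩ := isCompact_Icc.ultrafilter_le_nhds (U.map fun n => cylinderEval w n f)
      (le_principal_iff.2 (Filter.mem_map.2 (Filter.Eventually.of_forall hmem)))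
    exact ⟨l, hl⟩
  choose l hl using hlim
  -- limits along the ultrafilter define a positive functional, hence a measure; the value on the
  -- indicator function of a cylinder, which is continuous, is the limit of an eventually constant
  -- sequence
  let Λ₀ : CompactlySupportedContinuousMap (ℕ → Bool) ℝ →ₗ[ℝ] ℝ :=
    { toFun := l
      map_add' := fun f g => by
        refine tendsto_nhds_unique (hl (f + g)) (((hl f).add (hl g)).congr fun n => ?_)
        simp only [cylinderEval, CompactlySupportedContinuousMap.coe_add, Pi.add_apply, mul_add,
          Finset.sum_add_distrib]
      map_smul' := fun c f => by
        refine tendsto_nhds_unique (hl (c • f)) (((hl f).const_mul c).congr fun n => ?_)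
        simp only [cylinderEval, CompactlySupportedContinuousMap.coe_smul, Pi.smul_apply,
          smul_eq_mul, Finset.mul_sum]
        exact Finset.sum_congr rfl fun A _ => by ring }
  let Λ : CompactlySupportedContinuousMap (ℕ → Bool) ℝ →ₚ[ℝ] ℝ :=
    PositiveLinearMap.mk₀ Λ₀ fun f hf => ge_of_tendsto' (hl f) fun n =>
      Finset.sum_nonneg fun A _ => mul_nonneg (hw0 n A) (hf _)
  have hfin : IsFiniteMeasure (RealRMK.rieszMeasure Λ) := by
    refine ⟨?_⟩
    exact (isCompact_univ (X := ℕ → Bool)).measure_lt_top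
  refine ⟨RealRMK.rieszMeasure Λ, hfin, fun n A hA => ?_⟩
  have hcont : Continuous ((binCylinder n A).indicator (1 : (ℕ → Bool) → ℝ)) :=
    (isClopen_binCylinder n A).continuous_indicator continuous_one
  let F : CompactlySupportedContinuousMap (ℕ → Bool) ℝ :=
    ⟨⟨_, hcont⟩, HasCompactSupport.of_compactSpace _⟩
  have h1 := RealRMK.integral_rieszMeasure Λ F
  have h2 : ∫ ω, F ω ∂(RealRMK.rieszMeasure Λ) = (RealRMK.rieszMeasure Λ).real (binCylinder n A) :=
    integral_indicator_one (measurableSet_binCylinder n A)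
  have h3 : Λ F = w n A := by
    refine tendsto_nhds_unique (hl F) (tendsto_const_nhds.congr' ?_)
    have : ∀ᶠ m in (U : Filter ℕ), n ≤ m :=
      (Nat.hyperfilter_le_atTop) (eventually_ge_atTop n)
    filter_upwards [this] with m hm
    exact (cylinderEval_indicator hw hm hA).symm
  rw [← h2, h1, h3]

end CantorMeasure

/-! ### Indicator functions in `L_p` -/

section IndicatorsLp

variable {p : ℝ≥0∞} [Fact (1 ≤ p)] {Ω : Type*} [MeasurableSpace Ω] {μ : Measure Ω}
  [IsFiniteMeasure μ]

/-- The indicator function of a measurable set, as an element of `L_p` of a finite measure. -/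
def indLp (p : ℝ≥0∞) [Fact (1 ≤ p)] (μ : Measure Ω) [IsFiniteMeasure μ] {s : Set Ω}
    (hs : MeasurableSet s) : Lp ℝ p μ := indicatorConstLp p hs (measure_ne_top μ s) (1 : ℝ)

theorem indLp_coeFn (p : ℝ≥0∞) [Fact (1 ≤ p)] (μ : Measure Ω) [IsFiniteMeasure μ] {s : Set Ω}
    (hs : MeasurableSet s) :
    indLp p μ hs =ᵐ[μ] s.indicator fun _ => (1 : ℝ) :=
  indicatorConstLp_coeFn

theorem indLp_nonneg {s : Set Ω} (hs : MeasurableSet s) : 0 ≤ indLp p μ hs := by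
  rw [← Lp.coeFn_le]
  filter_upwards [indLp_coeFn p μ hs, Lp.coeFn_zero ℝ p μ] with x h1 h2
  rw [h1, h2]
  exact indicator_nonneg (fun _ _ => zero_le_one) _

theorem indLp_inf {s t : Set Ω} (hs : MeasurableSet s) (ht : MeasurableSet t) :
    indLp p μ hs ⊓ indLp p μ ht = indLp p μ (hs.inter ht) := by
  apply Lp.ext
  filter_upwards [indLp_coeFn p μ hs, indLp_coeFn p μ ht, indLp_coeFn p μ (hs.inter ht),
    Lp.coeFn_inf (indLp p μ hs) (indLp p μ ht)] with x h1 h2 h3 h4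
  rw [h4, Pi.inf_apply, h1, h2, h3]
  by_cases h : x ∈ s <;> by_cases h' : x ∈ t <;> simp [h, h']

theorem indLp_univ_sub {s : Set Ω} (hs : MeasurableSet s) :
    indLp p μ MeasurableSet.univ - indLp p μ hs = indLp p μ hs.compl := by
  apply Lp.ext
  filter_upwards [indLp_coeFn p μ hs, indLp_coeFn p μ MeasurableSet.univ, indLp_coeFn p μ hs.compl,
    Lp.coeFn_sub (indLp p μ MeasurableSet.univ) (indLp p μ hs)] with x h1 h2 h3 h4
  rw [h4, Pi.sub_apply, h1, h2, h3]
  by_cases h : x ∈ s <;> simp [h]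

theorem indLp_congr {s t : Set Ω} (hs : MeasurableSet s) (ht : MeasurableSet t) (h : s = t) :
    indLp p μ hs = indLp p μ ht := by
  subst h; rfl

theorem isComponent_indLp {s : Set Ω} (hs : MeasurableSet s) :
    IsComponent (indLp p μ MeasurableSet.univ) (indLp p μ hs) := by
  refine ⟨indLp_nonneg hs, ?_⟩
  rw [indLp_univ_sub, indLp_inf]
  apply Lp.ext
  filter_upwards [indLp_coeFn p μ (hs.inter hs.compl), Lp.coeFn_zero ℝ p μ]
    with x h1 h2
  rw [h1, h2]; simp

end IndicatorsLp

/-! ### Representation on the Cantor space -/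

section Kakutani

variable {p : ℝ≥0∞} [Fact (1 ≤ p)] {μ : Measure (ℕ → Bool)} [IsFiniteMeasure μ]

theorem measurableSet_coord (i : ℕ) : MeasurableSet {ω : ℕ → Bool | ω i = true} :=
  measurable_pi_apply (X := fun _ => Bool) i (measurableSet_singleton true)

/-- The pieces generated by the indicator functions of the coordinates are those of the cylinders.
-/
theorem piece_indLp (n : ℕ) (A : Finset ℕ) :
    piece (indLp p μ MeasurableSet.univ) (fun i => indLp p μ (measurableSet_coord i)) n A =
      indLp p μ (measurableSet_binCylinder n A) := by
  induction n with
  | zero =>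
    exact indLp_congr _ _ (by ext; simp [binCylinder])
  | succ n ih =>
    rw [piece_succ, ih, indLp_univ_sub, indLp_inf, indLp_inf]
    split_ifs with h
    · exact indLp_congr _ _ (binCylinder_succ_of_mem h).symm
    · refine indLp_congr _ _ ?_
      rw [binCylinder_succ_of_notMem h]
      congr 1; ext ω; simp

/-- Step functions over the cylinders are dense in `L_p` of the Cantor space. -/
theorem denseRange_stepMap_indLp (hp : p ≠ ∞) :
    DenseRange (stepMap (indLp_nonneg (p := p) (μ := μ) MeasurableSet.univ)
      fun i => isComponent_indLp (measurableSet_coord i)) := by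
  set T := stepMap (indLp_nonneg (p := p) (μ := μ) MeasurableSet.univ)
      fun i => isComponent_indLp (measurableSet_coord i)
  intro f
  have hle : ((LinearMap.range T).topologicalClosure : Set (Lp ℝ p μ)) = closure (range T) := rfl
  have hpc : ∀ n, ∀ A ∈ (Finset.range n).powerset, indLp p μ (measurableSet_binCylinder n A) ∈
      (LinearMap.range T).topologicalClosure := fun n A hA => by
    rw [← piece_indLp]
    exact Submodule.le_topologicalClosure _ (stepMap_single _ _ hA)
  have h := indicatorL_mem_of_generateFrom (μ := μ) hp le_rfl generateFrom_binCylinder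
    isPiSystem_binCylinder MeasurableSet.univ
    (W := (LinearMap.range T).topologicalClosure) (Submodule.isClosed_topologicalClosure _) ?_ ?_ f
    (Lp.aestronglyMeasurable f)
  · rw [← hle]
    have huniv : indicatorL p μ MeasurableSet.univ f = f := by
      apply Lp.ext
      filter_upwards [indicatorL_coeFn MeasurableSet.univ f] with x hx
      rw [hx, indicator_univ]
    rwa [huniv] at h
  · have := hpc 0 ∅ (by simp)
    rwa [indLp_congr _ MeasurableSet.univ (by ext; simp [binCylinder])] at this
  · rintro _ ⟨n, A, hA, rfl⟩ hs
    have := hpc n A hA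
    rwa [indLp_congr _ (MeasurableSet.univ.inter hs) (univ_inter _).symm] at this

/-- A separable `p`-additive Banach lattice, densely spanned by components `b i` of a positive
element, is isomorphic to `L_p` of a finite measure on the Cantor space, with `b i` corresponding
to the indicator function of the `i`-th coordinate. -/
theorem IsPAdditive.exists_iso_Lp_cantor (hp : p ≠ ∞) {E : Type*} [NormedAddCommGroup E]
    [NormedSpace ℝ E] [Lattice E] [IsBanachLattice E] (hE : IsPAdditive p.toReal E)
    {e : E} {b : ℕ → E} (he : 0 ≤ e) (hb : ∀ n, IsComponent e (b n))
    (hd : ∀ x, x ∈ closure (Submodule.span ℝ (range b) : Set E)) :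
    ∃ (μ : Measure (ℕ → Bool)) (_ : IsFiniteMeasure μ) (L : BanachLatticeIso E (Lp ℝ p μ)),
      ∀ i, L.toLinearIsometryEquiv (b i) = indLp p μ (measurableSet_coord i) := by
  have h0 : p ≠ 0 := (zero_lt_one.trans_le (Fact.out : 1 ≤ p)).ne'
  -- the masses `‖piece‖ ^ p` are consistent because the norm is additive on disjoint elements
  obtain ⟨μ, hμ, hm⟩ := exists_measure_binCylinder (w := fun n A => ‖piece e b n A‖ ^ p.toReal)
    (fun n A => by positivity) fun n A hA => by
      have hn : n ∉ A := fun h => by simpa using Finset.mem_powerset.1 hA h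
      rw [piece_eq_add he hb hn, hE.add_of_disjoint]
      · exact (isComponent_piece he hb _ _).nonneg
      · exact (isComponent_piece he hb _ _).nonneg
      · rw [inf_comm]
        exact piece_disjoint_of_mem he hb n.lt_succ_self (Finset.mem_insert_self _ _) hn
  obtain ⟨L, hL⟩ := hE.exists_iso_of_norm_piece_eq (isPAdditive_Lp (μ := μ) hp) he hb
    (denseRange_stepMap he hb hd) (indLp_nonneg MeasurableSet.univ)
    (fun i => isComponent_indLp (measurableSet_coord i)) (denseRange_stepMap_indLp hp) (by
      intro n A hA
      rw [piece_indLp, indLp, norm_indicatorConstLp h0 hp, hm n A hA, norm_one, one_mul, one_div,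
        Real.rpow_rpow_inv (norm_nonneg _) (toReal_pos_of_fact hp).ne'])
  exact ⟨μ, hμ, L, hL⟩

end Kakutani

/-! ### Representation of a lattice with a closed sublattice -/

section PairRepresentation

variable {E : Type*} [NormedAddCommGroup E] [NormedSpace ℝ E] [Lattice E] [IsBanachLattice E]
variable {q : ℝ} {F : Submodule ℝ E}

/-- The elements disjoint from a given positive element. -/
def disjointComplement (u : E) (hu : 0 ≤ u) : Submodule ℝ E where
  carrier := {x | |x| ⊓ u = 0}
  zero_mem' := by simpa using hu
  add_mem' := by
    intro x y hx hy
    have h : (|x| + |y|) ⊓ u = 0 := by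
      rw [inf_comm]
      exact disjoint_add hu (abs_nonneg _) (abs_nonneg _) (by rwa [inf_comm]) (by rwa [inf_comm])
    exact inf_eq_zero_of_le h (abs_nonneg _) hu (abs_add_le x y) le_rfl
  smul_mem' := by
    intro c x hx
    show |c • x| ⊓ u = 0
    rw [abs_smul_eq, inf_comm]
    exact disjoint_smul hu (abs_nonneg _) (by rwa [inf_comm]) (abs_nonneg _)

theorem isClosedSublattice_disjointComplement (u : E) (hu : 0 ≤ u) :
    IsClosedSublattice (disjointComplement u hu) := by
  refine ⟨?_, fun x hx => ?_⟩
  · have : Continuous fun x : E => (x ⊔ -x) ⊓ u := by fun_prop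
    exact isClosed_eq this continuous_const
  · show |(|x|)| ⊓ u = 0
    rw [abs_abs]; exact hx

theorem IsComponent.of_add {u v b : E} (hv : 0 ≤ v) (huv : u ⊓ v = 0) (hb : IsComponent u b) :
    IsComponent (u + v) b := by
  refine ⟨hb.nonneg, ?_⟩
  have h1 : u + v - b = (u - b) + v := by abel
  rw [h1]
  exact disjoint_add hb.nonneg hb.compl.nonneg hv hb.inf_sub
    (inf_eq_zero_of_le huv hb.nonneg hv hb.le le_rfl)

/-- A weak unit of a sublattice, plus a weak unit of its disjoint complement, is a weak unit of
the whole lattice. -/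
theorem isWeakUnit_add {u v : E} (hu0 : 0 ≤ u)
    (hv : IsWeakUnit (disjointComplement u hu0) v) :
    IsWeakUnit (⊤ : Submodule ℝ E) (u + v) := by
  refine ⟨trivial, add_nonneg hu0 hv.nonneg, fun x _ hx => hv.eq_zero x ?_ ?_⟩
  · exact inf_eq_zero_of_le hx (abs_nonneg _) hu0 le_rfl (le_add_of_nonneg_right hv.nonneg)
  · exact inf_eq_zero_of_le hx (abs_nonneg _) hv.nonneg le_rfl (le_add_of_nonneg_left hu0)

/-- The even-indexed coordinates of a binary sequence. -/
def evenPart (ω : ℕ → Bool) (i : ℕ) : Bool := ω (2 * i)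

theorem measurable_evenPart : Measurable evenPart :=
  measurable_pi_lambda _ fun i => measurable_pi_apply (2 * i)

/-- The σ-algebra generated by the even-indexed coordinates. -/
abbrev evenSigma : MeasurableSpace (ℕ → Bool) := MeasurableSpace.comap evenPart inferInstance

/-- The binary sequences with first term `true`. -/
def headTrue : Set (ℕ → Bool) := {x | x 0 = true}

theorem measurableSet_headTrue : MeasurableSet headTrue := measurableSet_coord 0

/-- The elements of `L_p(Ω, μ)` which factor through `π : Ω → X` and vanish off `π ⁻¹' A`. -/
def IsPulledBack {p : ℝ≥0∞} {Ω X : Type*} [MeasurableSpace Ω] [MeasurableSpace X] {μ : Measure Ω}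
    (π : Ω → X) (A : Set X) (f : Lp ℝ p μ) : Prop :=
  ∃ g : X → ℝ, Measurable g ∧ f =ᵐ[μ] (π ⁻¹' A).indicator (g ∘ π)

variable {p : ℝ≥0∞} [Fact (1 ≤ p)]

theorem BanachLatticeIso.map_inf {E G : Type*} [NormedAddCommGroup E] [NormedSpace ℝ E]
    [Lattice E] [NormedAddCommGroup G] [NormedSpace ℝ G] [Lattice G] (L : BanachLatticeIso E G)
    (x y : E) : L.toLinearIsometryEquiv (x ⊓ y) =
      L.toLinearIsometryEquiv x ⊓ L.toLinearIsometryEquiv y := L.map_inf' x y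

theorem BanachLatticeIso.map_sup {E G : Type*} [NormedAddCommGroup E] [NormedSpace ℝ E]
    [Lattice E] [NormedAddCommGroup G] [NormedSpace ℝ G] [Lattice G] (L : BanachLatticeIso E G)
    (x y : E) : L.toLinearIsometryEquiv (x ⊔ y) =
      L.toLinearIsometryEquiv x ⊔ L.toLinearIsometryEquiv y := L.map_sup' x y

/-- Under an isomorphism which carries components `c i` of `u = c 0` to the indicator functions
of the even coordinates, the pieces correspond to the cylinder sets of the even part. -/
theorem BanachLatticeIso.map_piece {μ : Measure (ℕ → Bool)} [IsFiniteMeasure μ]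
    (L : BanachLatticeIso E (Lp ℝ p μ)) {c : ℕ → E} (hc : ∀ n, IsComponent (c 0) (c n))
    (hL : ∀ i, L.toLinearIsometryEquiv (c i) = indLp p μ (measurableSet_coord (2 * i)))
    (n : ℕ) (B : Finset ℕ) :
    L.toLinearIsometryEquiv (piece (c 0) c n B) = indLp p μ
      ((measurable_evenPart measurableSet_headTrue).inter
        (measurable_evenPart (measurableSet_binCylinder n B))) := by
  have h0 := (hc 0).nonneg
  induction n with
  | zero =>
    rw [piece_zero, hL 0]
    exact indLp_congr _ _ (by ext; simp [binCylinder, headTrue, evenPart])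
  | succ n ih =>
    by_cases h : n ∈ B
    · rw [piece_succ, if_pos h, L.map_inf, ih, hL, indLp_inf]
      refine indLp_congr _ _ ?_
      rw [binCylinder_succ_of_mem h]
      ext ω; simp [evenPart, and_assoc]
    · have hp := isComponent_piece h0 hc n B
      have h1 : piece (c 0) c n B ⊓ (c 0 - c n) = piece (c 0) c n B - piece (c 0) c n B ⊓ c n := by
        rw [eq_sub_iff_add_eq, add_comm, (hc n).inf_add_inf_compl hp.nonneg hp.le]
      rw [piece_succ, if_neg h, h1, map_sub, L.map_inf, ih, hL, indLp_inf]
      apply Lp.ext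
      set S := evenPart ⁻¹' headTrue ∩ evenPart ⁻¹' binCylinder n B with hS
      have hSm : MeasurableSet S := (measurable_evenPart measurableSet_headTrue).inter
        (measurable_evenPart (measurableSet_binCylinder n B))
      filter_upwards [indLp_coeFn p μ hSm,
        indLp_coeFn p μ (hSm.inter (measurableSet_coord (2 * n))),
        indLp_coeFn p μ ((measurable_evenPart measurableSet_headTrue).inter
          (measurable_evenPart (measurableSet_binCylinder (n + 1) B))),
        Lp.coeFn_sub (indLp p μ hSm) (indLp p μ (hSm.inter (measurableSet_coord (2 * n))))]
        with ω h2 h3 h4 h5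
      rw [h5, Pi.sub_apply, h2, h3, h4, binCylinder_succ_of_notMem h]
      by_cases hω : ω ∈ S
      · have hω' := hω
        rw [hS, mem_inter_iff, mem_preimage, mem_preimage] at hω'
        by_cases hn : ω (2 * n) = true
        · simp [hω, hω'.1, hn, evenPart, indicator]
        · simp [hω, hω'.1, hω'.2, hn, evenPart, indicator]
      · have : ω ∉ evenPart ⁻¹' headTrue ∩
            evenPart ⁻¹' (binCylinder n B ∩ {x | x n = false}) :=
          fun h6 => hω ⟨h6.1, h6.2.1⟩
        rw [indicator_of_notMem hω, indicator_of_notMem this,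
          indicator_of_notMem (fun h6 => hω h6.1), sub_zero]

/-- If the components `c i` span `F` densely and correspond to the even coordinates, then `F`
corresponds to the functions of the even part: these form a closed subspace containing all `c i`,
and conversely are limits of linear combinations of pieces of the `c i`, which belong to `F`. -/
theorem mem_iff_isPulledBack_of_dense (hp : p ≠ ∞) {μ : Measure (ℕ → Bool)} [IsFiniteMeasure μ]
    (L : BanachLatticeIso E (Lp ℝ p μ)) (hF : IsClosedSublattice F) {c : ℕ → E}
    (hcF : ∀ n, c n ∈ F) (hc : ∀ n, IsComponent (c 0) (c n))
    (hd : (F : Set E) ⊆ closure (Submodule.span ℝ (range c)))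
    (hL : ∀ i, L.toLinearIsometryEquiv (c i) = indLp p μ (measurableSet_coord (2 * i))) (x : E) :
    x ∈ F ↔ IsPulledBack evenPart headTrue (L.toLinearIsometryEquiv x) := by
  have hA := measurable_evenPart measurableSet_headTrue
  constructor
  · intro hx
    -- the functions measurable with respect to the even part and supported on its head set form
    -- a closed subspace
    have hcl : IsClosed {f : Lp ℝ p μ | AEStronglyMeasurable[evenSigma] f μ} :=
      isClosed_aestronglyMeasurable measurable_evenPart.comap_le
    let R : Submodule ℝ (Lp ℝ p μ) := lpMeas ℝ ℝ evenSigma p μ ⊓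
      LinearMap.ker ((indicatorL p μ hA : Lp ℝ p μ →L[ℝ] Lp ℝ p μ) -
        ContinuousLinearMap.id ℝ (Lp ℝ p μ)).toLinearMap
    have hRcl : IsClosed (R : Set (Lp ℝ p μ)) := by
      refine IsClosed.inter hcl ?_
      exact ContinuousLinearMap.isClosed_ker _
    have hcR : ∀ i, L.toLinearIsometryEquiv (c i) ∈ R := by
      intro i
      rw [hL]
      refine ⟨?_, ?_⟩
      · have h1 : StronglyMeasurable[evenSigma]
            ({ω : ℕ → Bool | ω (2 * i) = true}.indicator fun _ => (1 : ℝ)) := by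
          refine StronglyMeasurable.indicator stronglyMeasurable_const ?_
          exact ⟨_, measurableSet_coord i, rfl⟩
        exact ⟨_, h1, indLp_coeFn p μ _⟩
      · show indicatorL p μ hA (indLp p μ (measurableSet_coord (2 * i))) -
          indLp p μ (measurableSet_coord (2 * i)) = 0
        rw [sub_eq_zero]
        have h2 := inf_eq_right.2 (hc i).le
        have h3 := L.map_inf (c 0) (c i)
        rw [h2, hL, hL, indLp_inf] at h3
        rw [indLp, indicatorL_indicatorConstLp]
        exact h3.symm
    have h1 : L.toLinearIsometryEquiv x ∈ R := by
      have h2 : IsClosed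
          (R.comap (L.toLinearIsometryEquiv.toLinearEquiv : E →ₗ[ℝ] Lp ℝ p μ) : Set E) :=
        hRcl.preimage L.toLinearIsometryEquiv.continuous
      have h3 : Submodule.span ℝ (range c) ≤
          R.comap (L.toLinearIsometryEquiv.toLinearEquiv : E →ₗ[ℝ] Lp ℝ p μ) := by
        rw [Submodule.span_le]; rintro _ ⟨i, rfl⟩; exact hcR i
      exact closure_minimal h3 h2 (hd hx)
    obtain ⟨⟨g, hg, hfg⟩, h4⟩ := h1
    have h5 : indicatorL p μ hA (L.toLinearIsometryEquiv x) = L.toLinearIsometryEquiv x :=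
      sub_eq_zero.1 h4
    obtain ⟨g', hg', rfl⟩ := hg.measurable.exists_eq_measurable_comp
    refine ⟨g', hg', ?_⟩
    have h6 := indicatorL_coeFn hA (L.toLinearIsometryEquiv x)
    rw [h5] at h6
    filter_upwards [h6, hfg] with ω h7 h8
    rw [h7]
    by_cases hω : ω ∈ evenPart ⁻¹' headTrue
    · rw [indicator_of_mem hω, indicator_of_mem hω, h8]
    · rw [indicator_of_notMem hω, indicator_of_notMem hω]
  · rintro ⟨g, hg, hfg⟩
    have hgen : evenSigma = MeasurableSpace.generateFrom
        (preimage evenPart '' {s | ∃ n, ∃ A ∈ (Finset.range n).powerset, s = binCylinder n A}) := by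
      rw [← MeasurableSpace.comap_generateFrom, ← generateFrom_binCylinder]
    have hW : IsClosed (F.comap (L.toLinearIsometryEquiv.symm.toLinearEquiv :
        Lp ℝ p μ →ₗ[ℝ] E) : Set (Lp ℝ p μ)) :=
      hF.isClosed.preimage L.toLinearIsometryEquiv.symm.continuous
    have hpF : ∀ n B, piece (c 0) c n B ∈ F := by
      intro n B
      induction n with
      | zero => exact hcF 0
      | succ n ih =>
        rw [piece_succ]; split_ifs
        exacts [hF.inf_mem ih (hcF n), hF.inf_mem ih (F.sub_mem (hcF 0) (hcF n))]
    have h := indicatorL_mem_of_generateFrom (μ := μ) hp measurable_evenPart.comap_le hgen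
      (isPiSystem_binCylinder.comap evenPart) hA hW ?_ ?_ (L.toLinearIsometryEquiv x) ?_
    · have h1 : indicatorL p μ hA (L.toLinearIsometryEquiv x) = L.toLinearIsometryEquiv x := by
        apply Lp.ext
        filter_upwards [indicatorL_coeFn hA (L.toLinearIsometryEquiv x), hfg] with ω h2 h3
        rw [h2]
        by_cases hω : ω ∈ evenPart ⁻¹' headTrue
        · rw [indicator_of_mem hω]
        · rw [h3, indicator_of_notMem hω, indicator_of_notMem hω]
      rw [h1] at h
      have h2 : L.toLinearIsometryEquiv.symm (L.toLinearIsometryEquiv x) ∈ F := h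
      rwa [LinearIsometryEquiv.symm_apply_apply] at h2
    · have h1 := hL 0
      show L.toLinearIsometryEquiv.symm _ ∈ F
      have h2 : indLp p μ (measurableSet_coord (2 * 0)) =
          indicatorConstLp p hA (measure_ne_top μ _) (1 : ℝ) := rfl
      rw [← h2, ← h1, LinearIsometryEquiv.symm_apply_apply]
      exact hcF 0
    · rintro _ ⟨_, ⟨n, B, hB, rfl⟩, rfl⟩ hs
      show L.toLinearIsometryEquiv.symm _ ∈ F
      have h1 := L.map_piece hc hL n B
      rw [indLp] at h1
      rw [← h1, LinearIsometryEquiv.symm_apply_apply]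
      exact hpF n B
    · refine ⟨_, ?_, hfg⟩
      refine StronglyMeasurable.indicator ?_ ⟨_, measurableSet_headTrue, rfl⟩
      exact (hg.comp (comap_measurable _)).stronglyMeasurable

/-- A separable `p`-additive Banach lattice with a closed sublattice `F` is isomorphic to `L_p`
of a finite measure on the Cantor space, in such a way that `F` corresponds to the functions of
the even part which vanish off the head set. -/
theorem IsPAdditive.exists_pair_representation [TopologicalSpace.SeparableSpace E] (hp : p ≠ ∞)
    (hE : IsPAdditive p.toReal E) (hF : IsClosedSublattice F) :
    ∃ (μ : Measure (ℕ → Bool)) (_ : IsFiniteMeasure μ) (L : BanachLatticeIso E (Lp ℝ p μ)),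
      ∀ x, x ∈ F ↔ IsPulledBack evenPart headTrue (L.toLinearIsometryEquiv x) := by
  -- `u` is a weak unit of `F` and `v` one of its disjoint complement; the components `b n` of `u +
  -- v` of even index span `F`, the first being `u` itself, and those of odd index span the whole
  -- lattice
  obtain ⟨u, hu⟩ := hF.exists_isWeakUnit
  obtain ⟨v, hv⟩ := (isClosedSublattice_disjointComplement u hu.nonneg).exists_isWeakUnit
  have huv : u ⊓ v = 0 := by
    have : |v| ⊓ u = 0 := hv.mem
    rwa [abs_of_nonneg hv.nonneg, inf_comm] at this
  have he := isWeakUnit_add hu.nonneg hv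
  obtain ⟨c, hcF, hcu, hcd⟩ := hu.exists_seq_components hE hF
  obtain ⟨d, -, hde, hdd⟩ := he.exists_seq_components hE IsClosedSublattice.top
  let c' : ℕ → E := fun n => Nat.casesOn n u c
  let b : ℕ → E := fun n => if n % 2 = 0 then c' (n / 2) else d (n / 2)
  have hc'F : ∀ n, c' n ∈ F := fun n => by cases n; exacts [hu.mem, hcF _]
  have hc'u : ∀ n, IsComponent u (c' n) := fun n => by
    cases n; exacts [.self hu.nonneg, hcu _]
  have hb : ∀ n, IsComponent (u + v) (b n) := fun n => by
    simp only [b]; split_ifs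
    exacts [(hc'u _).of_add hv.nonneg huv, hde _]
  have hbe : ∀ i, b (2 * i) = c' i := fun i => by simp [b]
  have hbo : ∀ i, b (2 * i + 1) = d i := fun i => by
    have h1 : (2 * i + 1) % 2 = 1 := by omega
    have h2 : (2 * i + 1) / 2 = i := by omega
    simp [b, h1, h2]
  have hd : ∀ x, x ∈ closure (Submodule.span ℝ (range b) : Set E) := fun x => by
    refine closure_mono (Submodule.span_mono ?_) (hdd (show x ∈ _ from trivial))
    rintro _ ⟨i, rfl⟩
    exact ⟨2 * i + 1, hbo i⟩
  obtain ⟨μ, hμ, L, hL⟩ := hE.exists_iso_Lp_cantor hp he.nonneg hb hd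
  refine ⟨μ, hμ, L, fun x => ?_⟩
  refine mem_iff_isPulledBack_of_dense hp L hF hc'F hc'u ?_ (fun i => by rw [← hbe, hL]) x
  refine hcd.trans (closure_mono (Submodule.span_mono ?_))
  rintro _ ⟨i, rfl⟩
  exact ⟨i + 1, rfl⟩

end PairRepresentation

/-! ### Weighted composition isomorphisms -/

section WeightedComposition

variable {p : ℝ≥0∞} [Fact (1 ≤ p)] {Ω Ω' : Type*} [MeasurableSpace Ω] [MeasurableSpace Ω']

/-- Data for a weighted composition operator `f ↦ w · (f ∘ τ)` from `L_p(ν)` onto `L_p(μ)`: the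
map `τ` carries the measure with density `w ^ p` to `ν`, and `σ` is a left inverse of `τ` almost
everywhere. -/
structure IsWeightedIso (p : ℝ≥0∞) (μ : Measure Ω) (ν : Measure Ω') (τ : Ω → Ω') (w : Ω → ℝ)
    (σ : Ω' → Ω) : Prop where
  measurable_map : Measurable τ
  measurable_weight : Measurable w
  weight_pos : ∀ z, 0 < w z
  measurable_inv : Measurable σ
  map_eq : (μ.withDensity fun z => ENNReal.ofReal (w z ^ p.toReal)).map τ = ν
  left_inv : ∀ᵐ z ∂μ, σ (τ z) = z

namespace IsWeightedIso

variable {μ : Measure Ω} {ν : Measure Ω'} {τ : Ω → Ω'} {w : Ω → ℝ} {σ : Ω' → Ω}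

theorem measurable_density (h : IsWeightedIso p μ ν τ w σ) :
    Measurable fun z => ENNReal.ofReal (w z ^ p.toReal) :=
  (h.measurable_weight.pow_const _).ennreal_ofReal

theorem absolutelyContinuous (h : IsWeightedIso p μ ν τ w σ) :
    μ ≪ μ.withDensity fun z => ENNReal.ofReal (w z ^ p.toReal) :=
  withDensity_absolutelyContinuous' h.measurable_density.aemeasurable
    (Eventually.of_forall fun z => by
      simpa using Real.rpow_pos_of_pos (h.weight_pos z) _)

theorem quasiMeasurePreserving (h : IsWeightedIso p μ ν τ w σ) :
    Measure.QuasiMeasurePreserving τ μ ν := by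
  refine ⟨h.measurable_map, ?_⟩
  have := h.absolutelyContinuous.map h.measurable_map
  rwa [h.map_eq] at this

theorem eLpNorm_eq (hp : p ≠ ∞) (h : IsWeightedIso p μ ν τ w σ) {f : Ω' → ℝ}
    (hf : AEStronglyMeasurable f ν) : eLpNorm (fun z => w z * f (τ z)) p μ = eLpNorm f p ν := by
  have h0 : p ≠ 0 := (zero_lt_one.trans_le (Fact.out : 1 ≤ p)).ne'
  rw [eLpNorm_eq_lintegral_rpow_enorm_toReal h0 hp, eLpNorm_eq_lintegral_rpow_enorm_toReal h0 hp]
  congr 1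
  have hm : AEMeasurable (fun y => ‖f y‖ₑ ^ p.toReal) ν := hf.enorm.pow_const _
  have h2 : AEMeasurable (fun z => ‖f (τ z)‖ₑ ^ p.toReal) μ :=
    hm.comp_quasiMeasurePreserving h.quasiMeasurePreserving
  rw [← h.map_eq] at hm
  have h1 : ∫⁻ y, ‖f y‖ₑ ^ p.toReal ∂ν = ∫⁻ y, ‖f y‖ₑ ^ p.toReal
      ∂((μ.withDensity fun z => ENNReal.ofReal (w z ^ p.toReal)).map τ) := by rw [h.map_eq]
  rw [h1, lintegral_map' hm h.measurable_map.aemeasurable,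
    lintegral_withDensity_eq_lintegral_mul₀ h.measurable_density.aemeasurable h2]
  refine lintegral_congr fun z => ?_
  rw [Pi.mul_apply, enorm_mul, ENNReal.mul_rpow_of_nonneg _ _ ENNReal.toReal_nonneg,
    Real.enorm_of_nonneg (h.weight_pos z).le,
    ENNReal.ofReal_rpow_of_nonneg (h.weight_pos z).le ENNReal.toReal_nonneg]

theorem memLp (hp : p ≠ ∞) (h : IsWeightedIso p μ ν τ w σ) (f : Lp ℝ p ν) :
    MemLp (fun z => w z * f (τ z)) p μ := by
  refine ⟨?_, ?_⟩
  · exact h.measurable_weight.aestronglyMeasurable.mul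
      ((Lp.aestronglyMeasurable f).comp_quasiMeasurePreserving h.quasiMeasurePreserving)
  · rw [h.eLpNorm_eq hp (Lp.aestronglyMeasurable f)]
    exact Lp.eLpNorm_lt_top f

/-- The weighted composition operator as a linear isometry. -/
def toLinearIsometry (hp : p ≠ ∞) (h : IsWeightedIso p μ ν τ w σ) : Lp ℝ p ν →ₗᵢ[ℝ] Lp ℝ p μ where
  toFun f := (h.memLp hp f).toLp _
  map_add' f g := by
    apply Lp.ext
    filter_upwards [(h.memLp hp f).coeFn_toLp, (h.memLp hp g).coeFn_toLp,
      (h.memLp hp (f + g)).coeFn_toLp, Lp.coeFn_add ((h.memLp hp f).toLp _)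
        ((h.memLp hp g).toLp _), h.quasiMeasurePreserving.ae (Lp.coeFn_add f g)]
      with z h1 h2 h3 h4 h5
    rw [h3, h4, Pi.add_apply, h1, h2, h5, Pi.add_apply, mul_add]
  map_smul' c f := by
    apply Lp.ext
    filter_upwards [(h.memLp hp f).coeFn_toLp, (h.memLp hp (c • f)).coeFn_toLp,
      Lp.coeFn_smul c ((h.memLp hp f).toLp _), h.quasiMeasurePreserving.ae (Lp.coeFn_smul c f)]
      with z h1 h2 h3 h4
    rw [h2, RingHom.id_apply, h3, Pi.smul_apply, h1, h4, Pi.smul_apply, smul_eq_mul, smul_eq_mul]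
    ring
  norm_map' f := by
    show ‖(h.memLp hp f).toLp _‖ = ‖f‖
    rw [Lp.norm_toLp, Lp.norm_def, h.eLpNorm_eq hp (Lp.aestronglyMeasurable f)]

theorem toLinearIsometry_coeFn (hp : p ≠ ∞) (h : IsWeightedIso p μ ν τ w σ) (f : Lp ℝ p ν) :
    h.toLinearIsometry hp f =ᵐ[μ] fun z => w z * f (τ z) :=
  (h.memLp hp f).coeFn_toLp

theorem toLinearIsometry_surjective (hp : p ≠ ∞) (h : IsWeightedIso p μ ν τ w σ) :
    Function.Surjective (h.toLinearIsometry hp) := by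
  intro g
  have hgm : Measurable g := (Lp.stronglyMeasurable g).measurable
  let f₀ : Ω' → ℝ := fun y => (w (σ y))⁻¹ * g (σ y)
  have hf₀ : Measurable f₀ :=
    (h.measurable_weight.comp h.measurable_inv).inv.mul (hgm.comp h.measurable_inv)
  have h1 : (fun z => w z * f₀ (τ z)) =ᵐ[μ] g := by
    filter_upwards [h.left_inv] with z hz
    simp only [f₀, hz]
    rw [mul_inv_cancel_left₀ (h.weight_pos z).ne']
  have hmem : MemLp f₀ p ν := by
    refine ⟨hf₀.aestronglyMeasurable, ?_⟩
    rw [← h.eLpNorm_eq hp hf₀.aestronglyMeasurable, eLpNorm_congr_ae h1]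
    exact Lp.eLpNorm_lt_top g
  refine ⟨hmem.toLp f₀, ?_⟩
  apply Lp.ext
  filter_upwards [h.toLinearIsometry_coeFn hp (hmem.toLp f₀), h1,
    h.quasiMeasurePreserving.ae hmem.coeFn_toLp] with z h2 h3 h4
  rw [h2, h4, h3]

/-- The isomorphism of Banach lattices given by weighted composition. -/
def toIso (hp : p ≠ ∞) (h : IsWeightedIso p μ ν τ w σ) :
    BanachLatticeIso (Lp ℝ p ν) (Lp ℝ p μ) :=
  .ofMapAbs (LinearIsometryEquiv.ofSurjective (h.toLinearIsometry hp)
    (h.toLinearIsometry_surjective hp)) fun f => by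
      rw [LinearIsometryEquiv.coe_ofSurjective]
      apply Lp.ext
      filter_upwards [h.toLinearIsometry_coeFn hp f, h.toLinearIsometry_coeFn hp |f|,
        Lp.coeFn_abs (h.toLinearIsometry hp f), h.quasiMeasurePreserving.ae (Lp.coeFn_abs f)]
        with z h1 h2 h3 h4
      rw [h2, h3, h1, h4, abs_mul, abs_of_pos (h.weight_pos z)]

theorem toIso_coeFn (hp : p ≠ ∞) (h : IsWeightedIso p μ ν τ w σ) (f : Lp ℝ p ν) :
    (h.toIso hp).toLinearIsometryEquiv f =ᵐ[μ] fun z => w z * f (τ z) :=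
  h.toLinearIsometry_coeFn hp f

end IsWeightedIso

end WeightedComposition

/-! ### Quantile functions of a kernel -/

section Quantile

/-- Lebesgue measure on the unit interval, as a measure on the line. -/
abbrev unitLeb : Measure ℝ := volume.restrict (Icc 0 1)

theorem ae_unitLeb_mem_Ioo : ∀ᵐ u ∂unitLeb, u ∈ Ioo (0 : ℝ) 1 := by
  have h : unitLeb = volume.restrict (Ioo (0 : ℝ) 1) :=
    Measure.restrict_congr_set Ioo_ae_eq_Icc.symm
  rw [h]
  exact ae_restrict_mem measurableSet_Ioo

variable {X : Type*} [MeasurableSpace X]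

/-- The quantile function of a family of probability measures on the line, as a function of the
level `u`; levels outside `(0, 1)`, where the infimum may be meaningless, get the value `0`. -/
def quantile (κ : Kernel X ℝ) (x : X) (u : ℝ) : ℝ :=
  if u ∈ Ioo (0 : ℝ) 1 then sInf {y | u ≤ (κ x).real (Iic y)} else 0

variable {κ : Kernel X ℝ} [IsMarkovKernel κ]

/-- The quantile function and the distribution function form a Galois connection. -/
theorem quantile_le_iff {x : X} {u : ℝ} (hu : u ∈ Ioo (0 : ℝ) 1) (y : ℝ) :
    quantile κ x u ≤ y ↔ u ≤ (κ x).real (Iic y) := by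
  have hcdf : ∀ y, (κ x).real (Iic y) = cdf (κ x) y := fun y => (cdf_eq_real _ y).symm
  rw [quantile, if_pos hu]
  simp only [hcdf]
  have hne : {y | u ≤ cdf (κ x) y}.Nonempty := by
    have := (tendsto_cdf_atTop (κ x)).eventually (eventually_ge_nhds hu.2)
    exact this.exists
  have hbdd : BddBelow {y | u ≤ cdf (κ x) y} := by
    obtain ⟨y₀, hy₀⟩ := ((tendsto_cdf_atBot (κ x)).eventually (eventually_lt_nhds hu.1)).exists
    refine ⟨y₀, fun y hy => ?_⟩
    by_contra! hlt
    exact absurd (hy.trans ((cdf (κ x)).mono hlt.le)) (not_le.2 hy₀)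
  constructor
  · intro h
    refine le_trans ?_ ((cdf (κ x)).mono h)
    -- right continuity: the infimum is attained
    have h1 : ∀ z, sInf {y | u ≤ cdf (κ x) y} < z → u ≤ cdf (κ x) z := fun z hz => by
      obtain ⟨y, hy, hyz⟩ := exists_lt_of_csInf_lt hne hz
      exact hy.trans ((cdf (κ x)).mono hyz.le)
    have h2 := (cdf (κ x)).right_continuous (sInf {y | u ≤ cdf (κ x) y})
    have h3 : Tendsto (cdf (κ x)) (𝓝[>] (sInf {y | u ≤ cdf (κ x) y}))
        (𝓝 (cdf (κ x) (sInf {y | u ≤ cdf (κ x) y}))) :=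
      h2.mono_left (nhdsWithin_mono _ Ioi_subset_Ici_self)
    exact ge_of_tendsto h3 (eventually_nhdsWithin_of_forall h1)
  · intro h
    exact csInf_le hbdd h

theorem measurable_quantile : Measurable fun z : X × ℝ => quantile κ z.1 z.2 := by
  refine measurable_of_Iic fun y => ?_
  have h1 : (fun z : X × ℝ => quantile κ z.1 z.2) ⁻¹' Iic y =
      ({z | z.2 ∈ Ioo (0 : ℝ) 1} ∩ {z | z.2 ≤ (κ z.1).real (Iic y)}) ∪
      ({z | z.2 ∈ Ioo (0 : ℝ) 1}ᶜ ∩ {_z | 0 ≤ y}) := by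
    ext z
    by_cases hz : z.2 ∈ Ioo (0 : ℝ) 1
    · simp [quantile_le_iff hz, -mem_Ioo, hz]
    · simp [quantile, -mem_Ioo, hz]
  rw [h1]
  have h2 : MeasurableSet {z : X × ℝ | z.2 ∈ Ioo (0 : ℝ) 1} := measurable_snd measurableSet_Ioo
  have h3 : Measurable fun z : X × ℝ => (κ z.1).real (Iic y) :=
    ((κ.measurable_coe measurableSet_Iic).comp measurable_fst).ennreal_toReal
  exact (h2.inter (measurableSet_le measurable_snd h3)).union
    (h2.compl.inter (MeasurableSet.const _))

/-- The quantile function carries Lebesgue measure on the unit interval to the given measure. -/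
theorem map_quantile (x : X) : unitLeb.map (quantile κ x) = κ x := by
  have hm : Measurable (quantile κ x) := measurable_quantile.comp measurable_prodMk_left
  have : IsProbabilityMeasure unitLeb := ⟨by simp⟩
  have : IsProbabilityMeasure (unitLeb.map (quantile κ x)) :=
    Measure.isProbabilityMeasure_map hm.aemeasurable
  refine Measure.ext_of_Iic _ _ fun y => ?_
  rw [Measure.map_apply hm measurableSet_Iic]
  have h1 : quantile κ x ⁻¹' Iic y =ᵐ[unitLeb] Iic ((κ x).real (Iic y)) := by
    filter_upwards [ae_unitLeb_mem_Ioo] with u hu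
    exact propext (quantile_le_iff hu y)
  have h2 : (κ x).real (Iic y) ≤ 1 := measureReal_le_one
  have h3 : 0 ≤ (κ x).real (Iic y) := measureReal_nonneg
  rw [measure_congr h1, Measure.restrict_apply measurableSet_Iic]
  have h4 : Iic ((κ x).real (Iic y)) ∩ Icc (0 : ℝ) 1 = Icc 0 ((κ x).real (Iic y)) := by
    ext u; simp only [mem_inter_iff, mem_Iic, mem_Icc]
    constructor
    · rintro ⟨h, h', -⟩; exact ⟨h', h⟩
    · rintro ⟨h, h'⟩; exact ⟨h', h, h'.trans h2⟩
  rw [h4, Real.volume_Icc, sub_zero, ofReal_measureReal]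

theorem map_prodMk_quantile (ν : Measure X) [IsFiniteMeasure ν] :
    (ν.prod unitLeb).map (fun z => (z.1, quantile κ z.1 z.2)) = ν ⊗ₘ κ := by
  have hm : Measurable fun z : X × ℝ => (z.1, quantile κ z.1 z.2) :=
    measurable_fst.prodMk measurable_quantile
  ext s hs
  rw [Measure.map_apply hm hs, Measure.prod_apply (hm hs), Measure.compProd_apply hs]
  refine lintegral_congr fun x => ?_
  have hmx : Measurable (quantile κ x) := measurable_quantile.comp measurable_prodMk_left
  rw [← map_quantile (κ := κ) x, Measure.map_apply hmx (measurable_prodMk_left hs)]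
  rfl

/-- Where the quantile function is injective on rationals, the distribution function is its left
inverse. -/
theorem cdf_quantile_of_injective {x : X} (hx : ∀ a b : ℚ, 0 < (a : ℝ) → a < b → (b : ℝ) < 1 →
    quantile κ x a ≠ quantile κ x b) {u : ℝ} (hu : u ∈ Ioo (0 : ℝ) 1) :
    (κ x).real (Iic (quantile κ x u)) = u := by
  have h1 : u ≤ (κ x).real (Iic (quantile κ x u)) := (quantile_le_iff hu _).1 le_rfl
  by_contra hne
  have hlt : u < (κ x).real (Iic (quantile κ x u)) := lt_of_le_of_ne h1 (Ne.symm hne)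
  have h2 : (κ x).real (Iic (quantile κ x u)) ≤ 1 := measureReal_le_one
  -- a jump of the distribution function above `u` makes the quantile function constant on `[u, b]`
  obtain ⟨a, ha1, ha2⟩ := exists_rat_btwn hlt
  obtain ⟨b, hb1, hb2⟩ := exists_rat_btwn ha2
  have ha : (a : ℝ) ∈ Ioo (0 : ℝ) 1 := ⟨hu.1.trans ha1, ha2.trans_le h2⟩
  have hb : (b : ℝ) ∈ Ioo (0 : ℝ) 1 := ⟨ha.1.trans hb1, hb2.trans_le h2⟩
  have mono : ∀ {s t : ℝ}, s ∈ Ioo (0 : ℝ) 1 → t ∈ Ioo (0 : ℝ) 1 → s ≤ t →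
      quantile κ x s ≤ quantile κ x t := fun hs ht hst =>
    (quantile_le_iff hs _).2 (hst.trans ((quantile_le_iff ht _).1 le_rfl))
  refine hx a b ha.1 (by exact_mod_cast hb1) hb.2 (le_antisymm (mono ha hb hb1.le) ?_)
  exact ((quantile_le_iff hb _).2 hb2.le).trans (mono hu ha ha1.le)

/-- A coincidence of quantiles at levels `a < b` produces a point of mass at least `b - a`. -/
theorem sub_le_measure_singleton_quantile {x : X} {a b : ℝ} (ha : 0 < a) (hab : a < b)
    (hb : b < 1) (h : quantile κ x a = quantile κ x b) :
    ENNReal.ofReal (b - a) ≤ κ x {quantile κ x a} := by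
  have hm : Measurable (quantile κ x) := measurable_quantile.comp measurable_prodMk_left
  have ha' : a ∈ Ioo (0 : ℝ) 1 := ⟨ha, hab.trans hb⟩
  have hb' : b ∈ Ioo (0 : ℝ) 1 := ⟨ha.trans hab, hb⟩
  have mono : ∀ {s t : ℝ}, s ∈ Ioo (0 : ℝ) 1 → t ∈ Ioo (0 : ℝ) 1 → s ≤ t →
      quantile κ x s ≤ quantile κ x t := fun hs ht hst =>
    (quantile_le_iff hs _).2 (hst.trans ((quantile_le_iff ht _).1 le_rfl))
  rw [← map_quantile (κ := κ) x, Measure.map_apply hm (measurableSet_singleton _)]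
  have hsub : Icc a b ⊆ quantile κ x ⁻¹' {quantile κ x a} := fun u hu => by
    have hu' : u ∈ Ioo (0 : ℝ) 1 := ⟨ha.trans_le hu.1, hu.2.trans_lt hb⟩
    exact le_antisymm ((mono hu' hb' hu.2).trans h.ge) (mono ha' hu' hu.1)
  refine le_trans ?_ (measure_mono hsub)
  rw [Measure.restrict_apply measurableSet_Icc, inter_eq_left.2 (Icc_subset_Icc ha.le hb.le),
    Real.volume_Icc]

end Quantile

/-! ### Isomorphisms of measure spaces modulo null sets -/

section MeasureIso

variable {Ω Ω' Ω'' : Type*} [MeasurableSpace Ω] [MeasurableSpace Ω'] [MeasurableSpace Ω'']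

/-- `τ` is an isomorphism modulo null sets from `(Ω, μ)` onto `(Ω', ν)`: it is measure preserving
and has the measurable left inverse `σ` almost everywhere. -/
structure IsMeasureIso (μ : Measure Ω) (ν : Measure Ω') (τ : Ω → Ω') (σ : Ω' → Ω) : Prop where
  measurable_map : Measurable τ
  measurable_inv : Measurable σ
  map_eq : μ.map τ = ν
  left_inv : ∀ᵐ z ∂μ, σ (τ z) = z

namespace IsMeasureIso

variable {μ : Measure Ω} {ν : Measure Ω'} {ξ : Measure Ω''} {τ : Ω → Ω'} {σ : Ω' → Ω}

theorem symm [MeasurableEq Ω'] (h : IsMeasureIso μ ν τ σ) : IsMeasureIso ν μ σ τ := by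
  refine ⟨h.measurable_inv, h.measurable_map, ?_, ?_⟩
  · rw [← h.map_eq, Measure.map_map h.measurable_inv h.measurable_map,
      Measure.map_congr (f := σ ∘ τ) (g := id) h.left_inv, Measure.map_id]
  · have hs : MeasurableSet {y | τ (σ y) = y} :=
      measurableSet_eq_fun (h.measurable_map.comp h.measurable_inv) measurable_id
    rw [← h.map_eq, ae_map_iff h.measurable_map.aemeasurable hs]
    filter_upwards [h.left_inv] with z hz
    rw [hz]

theorem trans {τ' : Ω' → Ω''} {σ' : Ω'' → Ω'} (h : IsMeasureIso μ ν τ σ)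
    (h' : IsMeasureIso ν ξ τ' σ') : IsMeasureIso μ ξ (τ' ∘ τ) (σ ∘ σ') := by
  refine ⟨h'.measurable_map.comp h.measurable_map, h.measurable_inv.comp h'.measurable_inv, ?_, ?_⟩
  · rw [← Measure.map_map h'.measurable_map h.measurable_map, h.map_eq, h'.map_eq]
  · have h1 := h'.left_inv
    rw [← h.map_eq] at h1
    filter_upwards [h.left_inv, ae_of_ae_map h.measurable_map.aemeasurable h1] with z h2 h3
    simp [h2, h3]

theorem smul (c : ℝ≥0∞) (h : IsMeasureIso μ ν τ σ) : IsMeasureIso (c • μ) (c • ν) τ σ :=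
  ⟨h.measurable_map, h.measurable_inv, by rw [Measure.map_smul, h.map_eq],
    Measure.ae_smul_measure h.left_inv c⟩

/-- Isomorphisms between complementary parts can be glued. -/
theorem glue {μ₁ μ₂ : Measure Ω} {ν₁ ν₂ : Measure Ω'} {τ₁ τ₂ : Ω → Ω'} {σ₁ σ₂ : Ω' → Ω}
    (h₁ : IsMeasureIso μ₁ ν₁ τ₁ σ₁) (h₂ : IsMeasureIso μ₂ ν₂ τ₂ σ₂) {S : Set Ω} {T : Set Ω'}
    [DecidablePred (· ∈ S)] [DecidablePred (· ∈ T)]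
    (hS : MeasurableSet S) (hT : MeasurableSet T) (hS₁ : ∀ᵐ z ∂μ₁, z ∈ S) (hS₂ : ∀ᵐ z ∂μ₂, z ∉ S)
    (hT₁ : ∀ᵐ y ∂ν₁, y ∈ T) (hT₂ : ∀ᵐ y ∂ν₂, y ∉ T) :
    IsMeasureIso (μ₁ + μ₂) (ν₁ + ν₂) (S.piecewise τ₁ τ₂) (T.piecewise σ₁ σ₂) := by
  have hm : Measurable (S.piecewise τ₁ τ₂) :=
    Measurable.piecewise hS h₁.measurable_map h₂.measurable_map
  have e₁ : S.piecewise τ₁ τ₂ =ᵐ[μ₁] τ₁ := by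
    filter_upwards [hS₁] with z hz using piecewise_eq_of_mem _ _ _ hz
  have e₂ : S.piecewise τ₁ τ₂ =ᵐ[μ₂] τ₂ := by
    filter_upwards [hS₂] with z hz using piecewise_eq_of_notMem _ _ _ hz
  refine ⟨hm, Measurable.piecewise hT h₁.measurable_inv h₂.measurable_inv, ?_, ?_⟩
  · rw [Measure.map_add _ _ hm, Measure.map_congr e₁, Measure.map_congr e₂, h₁.map_eq, h₂.map_eq]
  · rw [ae_add_measure_iff]
    rw [← h₁.map_eq] at hT₁
    rw [← h₂.map_eq] at hT₂
    constructor
    · filter_upwards [e₁, ae_of_ae_map h₁.measurable_map.aemeasurable hT₁, h₁.left_inv]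
        with z h3 h4 h5
      rw [h3, piecewise_eq_of_mem _ _ _ h4, h5]
    · filter_upwards [e₂, ae_of_ae_map h₂.measurable_map.aemeasurable hT₂, h₂.left_inv]
        with z h3 h4 h5
      rw [h3, piecewise_eq_of_notMem _ _ _ h4, h5]

theorem toWeighted {p : ℝ≥0∞} {w : Ω → ℝ} (hw : Measurable w) (hw0 : ∀ z, 0 < w z)
    (h : IsMeasureIso (μ.withDensity fun z => ENNReal.ofReal (w z ^ p.toReal)) ν τ σ) :
    IsWeightedIso p μ ν τ w σ :=
  ⟨h.measurable_map, hw, hw0, h.measurable_inv, h.map_eq,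
    (withDensity_absolutelyContinuous' (hw.pow_const _).ennreal_ofReal.aemeasurable
      (Eventually.of_forall fun z => by simpa using Real.rpow_pos_of_pos (hw0 z) _)).ae_le
      h.left_inv⟩

end IsMeasureIso

end MeasureIso

/-! ### The unit square as a relatively atomless extension -/

section Classification

/-- A standard Borel probability space without atoms is isomorphic modulo null
sets to the unit interval, by the quantile function. -/
theorem exists_isMeasureIso_unitLeb {Y : Type*} [MeasurableSpace Y] [StandardBorelSpace Y]
    (ν : Measure Y) [IsProbabilityMeasure ν] (hν : ∀ y, ν {y} = 0) :
    ∃ (τ : ℝ → Y) (σ : Y → ℝ), IsMeasureIso unitLeb ν τ σ := by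
  obtain ⟨j, hj⟩ := exists_measurableEmbedding_real Y
  have : Nonempty Y := ν.nonempty_of_neZero
  obtain ⟨k, hk, hkj⟩ := hj.exists_measurable_extend measurable_id fun _ => this
  have hkj' : ∀ y, k (j y) = y := fun y => congrFun hkj y
  have : IsProbabilityMeasure (ν.map j) :=
    Measure.isProbabilityMeasure_map hj.measurable.aemeasurable
  let κ : Kernel Unit ℝ := Kernel.const Unit (ν.map j)
  have hκ : κ () = ν.map j := Kernel.const_apply _ _
  have hq : Measurable (quantile κ ()) := measurable_quantile.comp measurable_prodMk_left
  have hmap : unitLeb.map (quantile κ ()) = ν.map j := by rw [map_quantile, hκ]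
  have hatom : ∀ y, κ () {y} = 0 := fun y => by
    rw [hκ, Measure.map_apply hj.measurable (measurableSet_singleton y)]
    by_cases h : ∃ z, j z = y
    · obtain ⟨z, rfl⟩ := h
      have : j ⁻¹' {j z} = {z} := by ext z'; simp [hj.injective.eq_iff]
      rw [this, hν]
    · have : j ⁻¹' {y} = ∅ := by ext z; simpa using fun h' => h ⟨z, h'⟩
      rw [this, measure_empty]
  have hinj : ∀ a b : ℚ, 0 < (a : ℝ) → a < b → (b : ℝ) < 1 →
      quantile κ () a ≠ quantile κ () b := fun a b ha hab hb h => by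
    have hab' : (a : ℝ) < b := by exact_mod_cast hab
    have h1 := sub_le_measure_singleton_quantile ha hab' hb h
    rw [hatom, nonpos_iff_eq_zero, ENNReal.ofReal_eq_zero] at h1
    linarith
  have hF : Measurable fun y : Y => (κ ()).real (Iic (j y)) := by
    have : Monotone fun t : ℝ => (κ ()).real (Iic t) := fun s t hst =>
      measureReal_mono (Iic_subset_Iic.2 hst)
    exact this.measurable.comp hj.measurable
  refine ⟨k ∘ quantile κ (), fun y => (κ ()).real (Iic (j y)), hk.comp hq, hF, ?_, ?_⟩
  · rw [← Measure.map_map hk hq, hmap, Measure.map_map hk hj.measurable, hkj, Measure.map_id]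
  · have h1 : ∀ᵐ y ∂(unitLeb.map (quantile κ ())), j (k y) = y := by
      have hs : MeasurableSet {y | j (k y) = y} :=
        measurableSet_eq_fun (hj.measurable.comp hk) measurable_id
      rw [hmap, ae_map_iff hj.measurable.aemeasurable hs]
      exact Eventually.of_forall fun y => by rw [hkj']
    filter_upwards [ae_of_ae_map hq.aemeasurable h1, ae_unitLeb_mem_Ioo] with u h2 h3
    simp only [Function.comp_apply, h2]
    exact cdf_quantile_of_injective hinj h3

/-- A finite measure on a product with the line is isomorphic, over the first factor, to the
product of its marginal with the unit interval, provided that the conditional quantiles at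
different rational levels differ almost surely. -/
theorem isMeasureIso_quantile {X : Type*} [MeasurableSpace X] (ρ : Measure (X × ℝ))
    [IsFiniteMeasure ρ] (h : ∀ a b : ℚ, 0 < (a : ℝ) → a < b → (b : ℝ) < 1 →
      ρ.fst {x | quantile ρ.condKernel x a = quantile ρ.condKernel x b} = 0) :
    IsMeasureIso (ρ.fst.prod unitLeb) ρ (fun z => (z.1, quantile ρ.condKernel z.1 z.2))
      (fun z => (z.1, (ρ.condKernel z.1).real (Iic z.2))) := by
  refine ⟨measurable_fst.prodMk measurable_quantile, ?_, ?_, ?_⟩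
  · refine measurable_fst.prodMk ?_
    have h1 : MeasurableSet {z : (X × ℝ) × ℝ | z.2 ≤ z.1.2} :=
      measurableSet_le measurable_snd (measurable_snd.comp measurable_fst)
    let κ' : Kernel (X × ℝ) ℝ := ρ.condKernel.comap Prod.fst measurable_fst
    exact (Kernel.measurable_kernel_prodMk_left (κ := κ') h1).ennreal_toReal
  · rw [map_prodMk_quantile, Measure.disintegrate]
  · have h1 : ∀ᵐ x ∂ρ.fst, ∀ a b : ℚ, 0 < (a : ℝ) → a < b → (b : ℝ) < 1 →
        quantile ρ.condKernel x a ≠ quantile ρ.condKernel x b := by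
      rw [ae_all_iff]; intro a
      rw [ae_all_iff]; intro b
      by_cases hc : 0 < (a : ℝ) ∧ a < b ∧ (b : ℝ) < 1
      · have h2 := h a b hc.1 hc.2.1 hc.2.2
        have h3 : ∀ᵐ x ∂ρ.fst, quantile ρ.condKernel x a ≠ quantile ρ.condKernel x b := by
          rw [ae_iff]; simpa using h2
        filter_upwards [h3] with x hx _ _ _ using hx
      · exact Eventually.of_forall fun x h4 h5 h6 => absurd ⟨h4, h5, h6⟩ hc
    have h2 : ∀ᵐ z ∂(ρ.fst.prod unitLeb), ∀ a b : ℚ, 0 < (a : ℝ) → a < b → (b : ℝ) < 1 →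
        quantile ρ.condKernel z.1 a ≠ quantile ρ.condKernel z.1 b :=
      Measure.quasiMeasurePreserving_fst.ae h1
    have h3 : ∀ᵐ z ∂(ρ.fst.prod unitLeb), z.2 ∈ Ioo (0 : ℝ) 1 :=
      Measure.quasiMeasurePreserving_snd.ae ae_unitLeb_mem_Ioo
    filter_upwards [h2, h3] with z h4 h5
    simp only [cdf_quantile_of_injective h4 h5]

/-- The version of `exists_isMeasureIso_unitLeb` for measures of any finite total mass. -/
theorem exists_isMeasureIso_smul_unitLeb {Y : Type*} [MeasurableSpace Y] [StandardBorelSpace Y]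
    (ν : Measure Y) [IsFiniteMeasure ν] (hν : ∀ y, ν {y} = 0) (h0 : ν univ ≠ 0) :
    ∃ (τ : ℝ → Y) (σ : Y → ℝ), IsMeasureIso (ν univ • unitLeb) ν τ σ := by
  have h1 : IsProbabilityMeasure ((ν univ)⁻¹ • ν) := by
    refine ⟨?_⟩
    rw [Measure.smul_apply, smul_eq_mul, ENNReal.inv_mul_cancel h0 (measure_ne_top ν univ)]
  obtain ⟨τ, σ, h⟩ := exists_isMeasureIso_unitLeb ((ν univ)⁻¹ • ν) fun y => by
    rw [Measure.smul_apply, hν, smul_zero]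
  refine ⟨τ, σ, ?_⟩
  have := h.smul (ν univ)
  rwa [smul_smul, ENNReal.mul_inv_cancel h0 (measure_ne_top ν univ), one_smul] at this

/-- A finite measure `μ` on a standard Borel space with a map `π` to another one is isomorphic to
a multiple of Lebesgue measure on the unit square, with `π` corresponding to the first coordinate,
if the image measure has no atoms and no graph over `X` has positive measure. -/
theorem exists_isMeasureIso_square {Ω X : Type*} [MeasurableSpace Ω] [StandardBorelSpace Ω]
    [MeasurableSpace X] [StandardBorelSpace X] (μ : Measure Ω) [IsFiniteMeasure μ]
    (h0 : μ univ ≠ 0) {π : Ω → X} (hπ : Measurable π) (hatom : ∀ x, μ (π ⁻¹' {x}) = 0)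
    (hgraph : ∀ r : X → Ω, Measurable r → μ {ω | r (π ω) = ω} = 0) :
    ∃ (τ : ℝ × ℝ → Ω) (σ : Ω → ℝ × ℝ) (θ : ℝ → X) (θ' : X → ℝ),
      IsMeasureIso (μ univ • unitLeb.prod unitLeb) μ τ σ ∧ Measurable θ ∧ Measurable θ' ∧
      ∀ᵐ z ∂(unitLeb.prod unitLeb), π (τ z) = θ z.1 ∧ θ' (θ z.1) = z.1 := by
  -- with a Borel embedding `j` of `Ω` into the line, `μ` lives on `X × ℝ` by `ω ↦ (π ω, j ω)`,
  -- where the quantiles straighten the fibres; `θ` straightens the base `X`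
  obtain ⟨j, hj⟩ := exists_measurableEmbedding_real Ω
  have : Nonempty Ω := by
    by_contra h
    rw [not_nonempty_iff] at h
    exact h0 (by rw [univ_eq_empty_iff.2 h, measure_empty])
  obtain ⟨k, hk, hkj⟩ := hj.exists_measurable_extend measurable_id fun _ => this
  have hkj' : ∀ y, k (j y) = y := fun y => congrFun hkj y
  have hpj : Measurable fun ω => (π ω, j ω) := hπ.prodMk hj.measurable
  set ρ : Measure (X × ℝ) := μ.map fun ω => (π ω, j ω) with hρ
  have hfst : ρ.fst = μ.map π := Measure.fst_map_prodMk hj.measurable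
  have hiso₁ : IsMeasureIso μ ρ (fun ω => (π ω, j ω)) (fun z => k z.2) :=
    ⟨hpj, hk.comp measurable_snd, rfl, Eventually.of_forall fun ω => hkj' ω⟩
  have hiso₂ := isMeasureIso_quantile ρ fun a b ha hab hb => by
    have hab' : (a : ℝ) < b := by exact_mod_cast hab
    have ha' : Measurable fun x => quantile ρ.condKernel x a :=
      measurable_quantile.comp (measurable_id.prodMk measurable_const)
    have hb' : Measurable fun x => quantile ρ.condKernel x b :=
      measurable_quantile.comp (measurable_id.prodMk measurable_const)
    set A' := {x | quantile ρ.condKernel x a = quantile ρ.condKernel x b} with hA'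
    have hA'm : MeasurableSet A' := measurableSet_eq_fun ha' hb'
    -- the graph of the quantile of level `a` over `A'` has measure at least `(b - a) ρ.fst A'`
    set G : Set (X × ℝ) := {z | z.1 ∈ A' ∧ z.2 = quantile ρ.condKernel z.1 a} with hG
    have hGm : MeasurableSet G :=
      (measurable_fst hA'm).inter (measurableSet_eq_fun measurable_snd (ha'.comp measurable_fst))
    have hG0 : ρ G = 0 := by
      rw [hρ, Measure.map_apply hpj hGm]
      refine measure_mono_null ?_ (hgraph (fun x => k (quantile ρ.condKernel x a)) (hk.comp ha'))
      rintro ω ⟨-, h2⟩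
      show k (quantile ρ.condKernel (π ω) a) = ω
      have h2' : j ω = quantile ρ.condKernel (π ω) a := h2
      rw [← h2', hkj']
    have hle : ENNReal.ofReal (b - a) * ρ.fst A' ≤ ρ G := by
      conv_rhs => rw [← Measure.disintegrate ρ ρ.condKernel, Measure.compProd_apply hGm]
      rw [← setLIntegral_const, ← lintegral_indicator hA'm]
      refine lintegral_mono fun x => ?_
      by_cases hx : x ∈ A'
      · rw [indicator_of_mem hx]
        refine (sub_le_measure_singleton_quantile ha hab' hb hx).trans (measure_mono ?_)
        rintro _ rfl
        exact ⟨hx, rfl⟩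
      · rw [indicator_of_notMem hx]; exact zero_le
    rw [hG0, nonpos_iff_eq_zero, mul_eq_zero, ENNReal.ofReal_eq_zero] at hle
    exact hle.resolve_left (by linarith)
  obtain ⟨θ, θ', hθ⟩ := exists_isMeasureIso_smul_unitLeb ρ.fst
    (fun x => by rw [hfst, Measure.map_apply hπ (measurableSet_singleton x)]; exact hatom x)
    (by rwa [hfst, Measure.map_apply hπ MeasurableSet.univ])
  have huniv : ρ.fst univ = μ univ := by rw [hfst, Measure.map_apply hπ MeasurableSet.univ]; rfl
  rw [huniv] at hθ
  have hfin : IsFiniteMeasure (μ univ • unitLeb) := ⟨by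
    rw [Measure.smul_apply, smul_eq_mul]
    exact ENNReal.mul_lt_top (measure_lt_top _ _) (measure_lt_top _ _)⟩
  have hiso₃ : IsMeasureIso ((μ univ • unitLeb).prod unitLeb) (ρ.fst.prod unitLeb)
      (Prod.map θ id) (Prod.map θ' id) := by
    refine ⟨hθ.measurable_map.prodMap measurable_id, hθ.measurable_inv.prodMap measurable_id,
      ?_, ?_⟩
    · rw [← Measure.map_prod_map _ _ hθ.measurable_map measurable_id, hθ.map_eq, Measure.map_id]
    · filter_upwards [Measure.quasiMeasurePreserving_fst.ae hθ.left_inv] with z hz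
      simp [Prod.map, hz]
  rw [Measure.prod_smul_left] at hiso₃
  have hall := (hiso₃.trans hiso₂).trans hiso₁.symm
  refine ⟨_, _, θ, θ', hall, hθ.measurable_map, hθ.measurable_inv, ?_⟩
  have h1 : ∀ᵐ z ∂(μ univ • unitLeb.prod unitLeb), θ' (θ z.1) = z.1 := by
    filter_upwards [hiso₃.left_inv] with z hz
    exact congrArg Prod.fst hz
  have h2 : ∀ᵐ y ∂ρ, π (k y.2) = y.1 := by
    filter_upwards [hiso₁.symm.left_inv] with y hy
    exact congrArg Prod.fst hy
  have h3 : ∀ᵐ z ∂(μ univ • unitLeb.prod unitLeb),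
      π (k (quantile ρ.condKernel (θ z.1) z.2)) = θ z.1 := by
    rw [← (hiso₃.trans hiso₂).map_eq] at h2
    exact ae_of_ae_map (hiso₃.trans hiso₂).measurable_map.aemeasurable h2
  have h4 : unitLeb.prod unitLeb ≪ μ univ • unitLeb.prod unitLeb :=
    Measure.absolutelyContinuous_smul h0
  filter_upwards [h4.ae_le h1, h4.ae_le h3] with z h5 h6
  exact ⟨h6, h5⟩

end Classification

/-! ### Halving and absence of atoms -/

section Halving

/-- Every positive element of `S` splits into two parts in `S` which are almost disjoint and have
almost the same norm. -/
def Halves {E : Type*} [NormedAddCommGroup E] [Lattice E] (S : Set E) : Prop :=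
  ∀ h ∈ S, 0 ≤ h → ∀ ε : ℝ, 0 < ε → ∃ a ∈ S, ∃ b ∈ S, 0 ≤ a ∧ 0 ≤ b ∧ a + b = h ∧
    ‖a ⊓ b‖ ≤ ε ∧ |‖a‖ - ‖b‖| ≤ ε

/-- Every positive element of `E` splits into two almost disjoint parts which have almost the same
norm, also after truncation by any positive element of `S`, uniformly on bounded parts of `S`. -/
def HalvesOver {E : Type*} [NormedAddCommGroup E] [Lattice E] (S : Set E) : Prop :=
  ∀ h : E, 0 ≤ h → ∀ K ε : ℝ, 0 < ε → ∃ a b : E, 0 ≤ a ∧ 0 ≤ b ∧ a + b = h ∧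
    ‖a ⊓ b‖ ≤ ε ∧ |‖a‖ - ‖b‖| ≤ ε ∧ ∀ g ∈ S, 0 ≤ g → ‖g‖ ≤ K → |‖g ⊓ a‖ - ‖g ⊓ b‖| ≤ ε

section Transport

variable {E G : Type*} [NormedAddCommGroup E] [NormedSpace ℝ E] [Lattice E] [IsBanachLattice E]
  [NormedAddCommGroup G] [NormedSpace ℝ G] [Lattice G] [IsBanachLattice G]

theorem BanachLatticeIso.map_nonneg (L : BanachLatticeIso E G) {x : E} (hx : 0 ≤ x) :
    0 ≤ L.toLinearIsometryEquiv x := by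
  have h := L.map_sup x 0
  rw [sup_eq_left.2 hx, map_zero] at h
  rw [h]; exact le_sup_right

/-- The inverse of an isomorphism of Banach lattices. -/
def BanachLatticeIso.symm (L : BanachLatticeIso E G) : BanachLatticeIso G E where
  __ := L.toLinearIsometryEquiv.symm
  map_sup' x y := by
    show L.toLinearIsometryEquiv.symm (x ⊔ y) = L.toLinearIsometryEquiv.symm x ⊔
      L.toLinearIsometryEquiv.symm y
    apply L.toLinearIsometryEquiv.injective
    rw [L.map_sup]; simp
  map_inf' x y := by
    show L.toLinearIsometryEquiv.symm (x ⊓ y) = L.toLinearIsometryEquiv.symm x ⊓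
      L.toLinearIsometryEquiv.symm y
    apply L.toLinearIsometryEquiv.injective
    rw [L.map_inf]; simp

theorem BanachLatticeIso.symm_apply_apply (L : BanachLatticeIso E G) (x : E) :
    L.symm.toLinearIsometryEquiv (L.toLinearIsometryEquiv x) = x :=
  L.toLinearIsometryEquiv.symm_apply_apply x

theorem BanachLatticeIso.apply_symm_apply (L : BanachLatticeIso E G) (x : G) :
    L.toLinearIsometryEquiv (L.symm.toLinearIsometryEquiv x) = x :=
  L.toLinearIsometryEquiv.apply_symm_apply x

/-- The composition of isomorphisms of Banach lattices. -/
def BanachLatticeIso.trans {H : Type*} [NormedAddCommGroup H] [NormedSpace ℝ H] [Lattice H]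
    (L : BanachLatticeIso E G) (L' : BanachLatticeIso G H) : BanachLatticeIso E H where
  __ := L.toLinearIsometryEquiv.trans L'.toLinearIsometryEquiv
  map_sup' x y := by
    show L'.toLinearIsometryEquiv (L.toLinearIsometryEquiv _) = _
    rw [L.map_sup, L'.map_sup]; rfl
  map_inf' x y := by
    show L'.toLinearIsometryEquiv (L.toLinearIsometryEquiv _) = _
    rw [L.map_inf, L'.map_inf]; rfl

theorem BanachLatticeIso.norm_map (L : BanachLatticeIso E G) (x : E) :
    ‖L.toLinearIsometryEquiv x‖ = ‖x‖ := L.toLinearIsometryEquiv.norm_map x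

theorem Halves.map {S : Set E} {T : Set G} (L : BanachLatticeIso E G)
    (hST : ∀ x, x ∈ S ↔ L.toLinearIsometryEquiv x ∈ T) (hS : Halves S) : Halves T := by
  intro h hT h0 ε hε
  have hh := L.apply_symm_apply h
  obtain ⟨a, ha, b, hb, ha0, hb0, hab, h1, h2⟩ := hS (L.symm.toLinearIsometryEquiv h)
    (by rw [hST, hh]; exact hT) (L.symm.map_nonneg h0) ε hε
  refine ⟨_, (hST a).1 ha, _, (hST b).1 hb, L.map_nonneg ha0, L.map_nonneg hb0, ?_, ?_, ?_⟩
  · rw [← map_add, hab, hh]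
  · rwa [← L.map_inf, L.norm_map]
  · rwa [L.norm_map, L.norm_map]

theorem HalvesOver.map {S : Set E} {T : Set G} (L : BanachLatticeIso E G)
    (hST : ∀ x, x ∈ S ↔ L.toLinearIsometryEquiv x ∈ T) (hS : HalvesOver S) : HalvesOver T := by
  intro h h0 K ε hε
  have hh := L.apply_symm_apply h
  obtain ⟨a, b, ha0, hb0, hab, h1, h2, h3⟩ := hS (L.symm.toLinearIsometryEquiv h)
    (L.symm.map_nonneg h0) K ε hε
  refine ⟨_, _, L.map_nonneg ha0, L.map_nonneg hb0, ?_, ?_, ?_, fun g hg hg0 hgK => ?_⟩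
  · rw [← map_add, hab, hh]
  · rwa [← L.map_inf, L.norm_map]
  · rwa [L.norm_map, L.norm_map]
  · have hgg := L.apply_symm_apply g
    have := h3 (L.symm.toLinearIsometryEquiv g) (by rw [hST, hgg]; exact hg) (L.symm.map_nonneg hg0)
      (by rwa [L.symm.norm_map])
    rwa [← L.norm_map (_ ⊓ a), ← L.norm_map (_ ⊓ b), L.map_inf, L.map_inf, hgg] at this

/-- Comparable halves are impossible unless the element is small. -/
theorem norm_le_of_comparable_halves {a b h : E} {ε : ℝ} (hab : a + b = h) (hcomp : a ≤ b ∨ b ≤ a)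
    (h1 : ‖a ⊓ b‖ ≤ ε) (h2 : |‖a‖ - ‖b‖| ≤ ε) : ‖h‖ ≤ 3 * ε := by
  have h3 := norm_add_le a b
  rw [hab] at h3
  rw [abs_le] at h2
  rcases hcomp with h | h
  · rw [inf_eq_left.2 h] at h1; linarith
  · rw [inf_eq_right.2 h] at h1; linarith

end Transport

theorem ae_nonneg_of_nonneg {p : ℝ≥0∞} {Ω : Type*} [MeasurableSpace Ω]
    {μ : Measure Ω} {f : Lp ℝ p μ} (hf : 0 ≤ f) : ∀ᵐ x ∂μ, 0 ≤ f x := by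
  rw [← Lp.coeFn_le] at hf
  filter_upwards [hf, Lp.coeFn_zero ℝ p μ] with x h1 h2
  rwa [h2] at h1

variable {p : ℝ≥0∞} [Fact (1 ≤ p)] {Ω X : Type*} [MeasurableSpace Ω] [MeasurableSpace X]
  {μ : Measure Ω} [IsFiniteMeasure μ]

theorem measure_eq_zero_of_norm_indLp_le (hp : p ≠ ∞) {s : Set Ω} (hs : MeasurableSet s) {C : ℝ}
    (h : ∀ ε : ℝ, 0 < ε → ‖indLp p μ hs‖ ≤ C * ε) : μ s = 0 := by
  have h0 : p ≠ 0 := (zero_lt_one.trans_le (Fact.out : 1 ≤ p)).ne'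
  have h1 : ‖indLp p μ hs‖ ≤ 0 := by
    refine le_of_forall_pos_le_add fun δ hδ => ?_
    have h3 := h (δ / (|C| + 1)) (by positivity)
    refine h3.trans ?_
    rw [zero_add, mul_div_assoc', div_le_iff₀ (by positivity)]
    nlinarith [le_abs_self C]
  have h2 : ‖indLp p μ hs‖ = 0 := le_antisymm h1 (norm_nonneg _)
  rw [indLp, norm_indicatorConstLp h0 hp, norm_one, one_mul,
    Real.rpow_eq_zero measureReal_nonneg (one_div_pos.2 (toReal_pos_of_fact hp)).ne'] at h2
  rwa [measureReal_eq_zero_iff] at h2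

theorem ae_add_eq_indicator {s : Set Ω} {hs : MeasurableSet s} {a b : Lp ℝ p μ}
    (hab : a + b = indLp p μ hs) : ∀ᵐ x ∂μ, a x + b x = s.indicator (fun _ => (1 : ℝ)) x := by
  have h1 := Lp.coeFn_add a b
  rw [hab] at h1
  filter_upwards [h1, indLp_coeFn p μ hs] with x h2 h3
  rw [← h3, h2, Pi.add_apply]

/-- If two halves of an indicator function are constant on the set then they are comparable. -/
theorem le_or_le_of_const {s : Set Ω} {hs : MeasurableSet s} {a b : Lp ℝ p μ} (ha : 0 ≤ a)
    (hb : 0 ≤ b) (hab : a + b = indLp p μ hs) {α β : ℝ} (hα : ∀ᵐ x ∂μ, x ∈ s → a x = α)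
    (hβ : ∀ᵐ x ∂μ, x ∈ s → b x = β) : a ≤ b ∨ b ≤ a := by
  rcases le_total α β with h | h
  · left
    rw [← Lp.coeFn_le]
    filter_upwards [hα, hβ, ae_nonneg_of_nonneg ha, ae_nonneg_of_nonneg hb,
      ae_add_eq_indicator hab] with x h1 h2 h3 h4 h5
    by_cases hx : x ∈ s
    · rw [h1 hx, h2 hx]; exact h
    · rw [indicator_of_notMem hx] at h5; linarith
  · right
    rw [← Lp.coeFn_le]
    filter_upwards [hα, hβ, ae_nonneg_of_nonneg ha, ae_nonneg_of_nonneg hb,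
      ae_add_eq_indicator hab] with x h1 h2 h3 h4 h5
    by_cases hx : x ∈ s
    · rw [h1 hx, h2 hx]; exact h
    · rw [indicator_of_notMem hx] at h5; linarith

/-- A point is a null set, since on a point any two halves are comparable. -/
theorem HalvesOver.measure_singleton [MeasurableSingletonClass Ω] (hp : p ≠ ∞)
    {S : Set (Lp ℝ p μ)} (hS : HalvesOver S) (ω₀ : Ω) : μ {ω₀} = 0 := by
  refine measure_eq_zero_of_norm_indLp_le hp (measurableSet_singleton ω₀) (C := 3) fun ε hε => ?_
  obtain ⟨a, b, ha, hb, hab, h1, h2, -⟩ := hS _ (indLp_nonneg (measurableSet_singleton ω₀)) 0 ε hε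
  refine norm_le_of_comparable_halves hab (le_or_le_of_const ha hb hab (α := a ω₀) (β := b ω₀)
    (Eventually.of_forall ?_) (Eventually.of_forall ?_)) h1 h2
  · rintro x rfl; rfl
  · rintro x rfl; rfl

theorem isPulledBack_indLp {π : Ω → X} (hπ : Measurable π) {A C : Set X} (hC : MeasurableSet C)
    (hCA : C ⊆ A) : IsPulledBack π A (indLp p μ (hπ hC)) := by
  refine ⟨C.indicator 1, measurable_one.indicator hC, ?_⟩
  filter_upwards [indLp_coeFn p μ (hπ hC)] with ω h
  rw [h]
  by_cases hω : π ω ∈ C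
  · rw [indicator_of_mem (show ω ∈ π ⁻¹' C from hω),
      indicator_of_mem (show ω ∈ π ⁻¹' A from hCA hω), Function.comp_apply,
      indicator_of_mem hω, Pi.one_apply]
  · rw [indicator_of_notMem (show ω ∉ π ⁻¹' C from hω)]
    by_cases hA : ω ∈ π ⁻¹' A
    · rw [indicator_of_mem hA, Function.comp_apply, indicator_of_notMem hω]
    · rw [indicator_of_notMem hA]

/-- A fibre over `A` is a null set: the halves of its indicator function factor through `π`, so they
are constant on the fibre, and comparable. -/
theorem Halves.measure_fiber [MeasurableSingletonClass X] (hp : p ≠ ∞) {π : Ω → X}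
    (hπ : Measurable π) {A : Set X} (hS : Halves {f : Lp ℝ p μ | IsPulledBack π A f}) {x : X}
    (hx : x ∈ A) : μ (π ⁻¹' {x}) = 0 := by
  have hm := hπ (measurableSet_singleton x)
  refine measure_eq_zero_of_norm_indLp_le hp hm (C := 3) fun ε hε => ?_
  obtain ⟨a, ⟨g, -, hg⟩, b, ⟨g', -, hg'⟩, ha, hb, hab, h1, h2⟩ := hS (indLp p μ hm)
    (isPulledBack_indLp hπ (measurableSet_singleton x) (singleton_subset_iff.2 hx))
    (indLp_nonneg hm) ε hε
  refine norm_le_of_comparable_halves hab (le_or_le_of_const ha hb hab (α := g x) (β := g' x)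
    ?_ ?_) h1 h2
  · filter_upwards [hg] with ω h3 h4
    have h5 : π ω = x := h4
    rw [h3, indicator_of_mem (show ω ∈ π ⁻¹' A by rw [mem_preimage, h5]; exact hx),
      Function.comp_apply, h5]
  · filter_upwards [hg'] with ω h3 h4
    have h5 : π ω = x := h4
    rw [h3, indicator_of_mem (show ω ∈ π ⁻¹' A by rw [mem_preimage, h5]; exact hx),
      Function.comp_apply, h5]

theorem norm_indLp_le_univ {s : Set Ω} (hs : MeasurableSet s) :
    ‖indLp p μ hs‖ ≤ ‖indLp p μ MeasurableSet.univ‖ := by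
  refine norm_le_norm_of_nonneg_of_le (indLp_nonneg hs) ?_
  rw [← sub_nonneg, indLp_univ_sub]
  exact indLp_nonneg _

theorem coeFn_inf_indLp {s : Set Ω} (hs : MeasurableSet s) (a : Lp ℝ p μ) :
    ∀ᵐ x ∂μ, (indLp p μ hs ⊓ a : Lp ℝ p μ) x = s.indicator (fun _ => (1 : ℝ)) x ⊓ a x := by
  filter_upwards [Lp.coeFn_inf (indLp p μ hs) a, indLp_coeFn p μ hs] with x h1 h2
  rw [h1, Pi.inf_apply, h2]

/-- Relative atomlessness: under halving over the functions which factor through `π`, the graph of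
a map from `X` is a null set. On the graph all functions factor through `π`; so does the set where
the half `a` of its indicator function is bigger than the half `b`. After truncation by this set
and by its complement, the smaller half is at most `a ⊓ b`, and the bigger one has almost the same
norm. -/
theorem HalvesOver.measure_graph [MeasurableEq Ω] (hp : p ≠ ∞) {π : Ω → X}
    (hπ : Measurable π) {A : Set X} (hA : MeasurableSet A)
    (hS : HalvesOver {f : Lp ℝ p μ | IsPulledBack π A f}) {r : X → Ω} (hr : Measurable r) :
    μ (π ⁻¹' A ∩ {ω | r (π ω) = ω}) = 0 := by
  have hG : MeasurableSet (π ⁻¹' A ∩ {ω | r (π ω) = ω}) :=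
    (hπ hA).inter (measurableSet_eq_fun (hr.comp hπ) measurable_id)
  refine measure_eq_zero_of_norm_indLp_le hp hG (C := 6) fun ε hε => ?_
  obtain ⟨a, b, ha, hb, hab, h1, h2, h3⟩ := hS _ (indLp_nonneg hG)
    ‖indLp p μ MeasurableSet.univ‖ ε hε
  have ham : Measurable a := (Lp.stronglyMeasurable a).measurable
  -- on the graph `r (π ω) = ω` and `a + b = 1`, so that `a ≥ b` exactly over `C`
  set C : Set X := {x | 1 / 2 ≤ a (r x)} with hC
  have hCm : MeasurableSet C := measurableSet_le measurable_const (ham.comp hr)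
  have hg₁ := hπ (hA.inter hCm)
  have hg₂ := hπ (hA.diff hCm)
  have k₁ := h3 _ (isPulledBack_indLp hπ (hA.inter hCm) inter_subset_left) (indLp_nonneg hg₁)
    (norm_indLp_le_univ _)
  have k₂ := h3 _ (isPulledBack_indLp hπ (hA.diff hCm) sdiff_subset) (indLp_nonneg hg₂)
    (norm_indLp_le_univ _)
  -- the truncations of the smaller halves
  have l₁ : indLp p μ hg₁ ⊓ b ≤ a ⊓ b := by
    rw [← Lp.coeFn_le]
    filter_upwards [coeFn_inf_indLp hg₁ b, Lp.coeFn_inf a b, ae_nonneg_of_nonneg ha,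
      ae_nonneg_of_nonneg hb, ae_add_eq_indicator hab] with ω e1 e2 e3 e4 e5
    rw [e1, e2, Pi.inf_apply]
    refine le_inf ?_ inf_le_right
    by_cases hω : ω ∈ π ⁻¹' A ∩ {ω | r (π ω) = ω}
    · by_cases hωC : π ω ∈ C
      · have h6 : 1 / 2 ≤ a (r (π ω)) := hωC
        rw [show r (π ω) = ω from hω.2] at h6
        rw [indicator_of_mem hω] at e5
        exact inf_le_right.trans (by linarith)
      · rw [indicator_of_notMem (fun h => hωC h.2)]
        exact inf_le_left.trans e3
    · rw [indicator_of_notMem hω] at e5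
      exact inf_le_right.trans (by linarith)
  have l₂ : indLp p μ hg₂ ⊓ a ≤ a ⊓ b := by
    rw [← Lp.coeFn_le]
    filter_upwards [coeFn_inf_indLp hg₂ a, Lp.coeFn_inf a b, ae_nonneg_of_nonneg ha,
      ae_nonneg_of_nonneg hb, ae_add_eq_indicator hab] with ω e1 e2 e3 e4 e5
    rw [e1, e2, Pi.inf_apply]
    refine le_inf inf_le_right ?_
    by_cases hω : ω ∈ π ⁻¹' A ∩ {ω | r (π ω) = ω}
    · by_cases hωC : π ω ∈ C
      · rw [indicator_of_notMem (fun h => h.2 hωC)]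
        exact inf_le_left.trans e4
      · have h6 : a (r (π ω)) < 1 / 2 := not_le.1 hωC
        rw [show r (π ω) = ω from hω.2] at h6
        rw [indicator_of_mem hω] at e5
        exact inf_le_right.trans (by linarith)
    · rw [indicator_of_notMem hω] at e5
      exact inf_le_right.trans (by linarith)
  -- the truncations of both halves by both sets cover the graph; each of the four has norm at most
  -- `ε` or `2 ε`, in total `6 ε`
  have l₃ : indLp p μ hG ≤ (indLp p μ hg₁ ⊓ a + indLp p μ hg₁ ⊓ b) +
      (indLp p μ hg₂ ⊓ a + indLp p μ hg₂ ⊓ b) := by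
    rw [← Lp.coeFn_le]
    filter_upwards [coeFn_inf_indLp hg₁ a, coeFn_inf_indLp hg₁ b, coeFn_inf_indLp hg₂ a,
      coeFn_inf_indLp hg₂ b, ae_nonneg_of_nonneg ha, ae_nonneg_of_nonneg hb,
      ae_add_eq_indicator hab, indLp_coeFn p μ hG,
      Lp.coeFn_add (indLp p μ hg₁ ⊓ a + indLp p μ hg₁ ⊓ b) (indLp p μ hg₂ ⊓ a + indLp p μ hg₂ ⊓ b),
      Lp.coeFn_add (indLp p μ hg₁ ⊓ a) (indLp p μ hg₁ ⊓ b),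
      Lp.coeFn_add (indLp p μ hg₂ ⊓ a) (indLp p μ hg₂ ⊓ b)]
      with ω e1 e2 e3 e4 e5 e6 e7 e8 e9 e10 e11
    rw [e9, Pi.add_apply, e10, e11, Pi.add_apply, Pi.add_apply, e1, e2, e3, e4, e8]
    have hi₁ : 0 ≤ (π ⁻¹' (A ∩ C)).indicator (fun _ => (1 : ℝ)) ω :=
      indicator_nonneg (fun _ _ => zero_le_one) _
    have hi₂ : 0 ≤ (π ⁻¹' (A \ C)).indicator (fun _ => (1 : ℝ)) ω :=
      indicator_nonneg (fun _ _ => zero_le_one) _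
    by_cases hω : ω ∈ π ⁻¹' A ∩ {ω | r (π ω) = ω}
    · rw [indicator_of_mem hω] at e7 ⊢
      by_cases hωC : π ω ∈ C
      · rw [indicator_of_mem (show ω ∈ π ⁻¹' (A ∩ C) from ⟨hω.1, hωC⟩),
          inf_eq_right.2 (by linarith : a ω ≤ 1), inf_eq_right.2 (by linarith : b ω ≤ 1)]
        have m1 := le_inf hi₂ e5
        have m2 := le_inf hi₂ e6
        linarith
      · rw [indicator_of_mem (show ω ∈ π ⁻¹' (A \ C) from ⟨hω.1, hωC⟩),
          inf_eq_right.2 (by linarith : a ω ≤ 1), inf_eq_right.2 (by linarith : b ω ≤ 1)]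
        have m1 := le_inf hi₁ e5
        have m2 := le_inf hi₁ e6
        linarith
    · rw [indicator_of_notMem hω]
      have m1 := le_inf hi₂ e5
      have m2 := le_inf hi₂ e6
      have m3 := le_inf hi₁ e5
      have m4 := le_inf hi₁ e6
      linarith
  have n₁ : ‖indLp p μ hg₁ ⊓ b‖ ≤ ε :=
    (norm_le_norm_of_nonneg_of_le (le_inf (indLp_nonneg _) hb) l₁).trans h1
  have n₂ : ‖indLp p μ hg₂ ⊓ a‖ ≤ ε :=
    (norm_le_norm_of_nonneg_of_le (le_inf (indLp_nonneg _) ha) l₂).trans h1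
  have n₃ := norm_le_norm_of_nonneg_of_le (indLp_nonneg hG) l₃
  have n₄ := norm_add_le (indLp p μ hg₁ ⊓ a + indLp p μ hg₁ ⊓ b)
    (indLp p μ hg₂ ⊓ a + indLp p μ hg₂ ⊓ b)
  have n₅ := norm_add_le (indLp p μ hg₁ ⊓ a) (indLp p μ hg₁ ⊓ b)
  have n₆ := norm_add_le (indLp p μ hg₂ ⊓ a) (indLp p μ hg₂ ⊓ b)
  rw [abs_le] at k₁ k₂
  linarith

end Halving

/-! ### The two standard pairs -/

section Rectangle

variable {p : ℝ≥0∞} [Fact (1 ≤ p)]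

/-- The functions in `L_p([0, a] × [0, 1])` which depend only on the first coordinate on
`[0, 1] × [0, 1]` and vanish elsewhere. -/
def IsBaseFunction {a : ℝ} (f : Lp ℝ p (rectMeasure a)) : Prop :=
  ∃ g : ℝ → ℝ, Measurable g ∧ ∀ᵐ z ∂(rectMeasure a), f z = if z.1 ≤ 1 then g z.1 else 0

theorem rectMeasure_eq_prod (a : ℝ) :
    rectMeasure a = (volume.restrict (Icc 0 a)).prod unitLeb := by
  rw [rectMeasure, Measure.volume_eq_prod, ← Measure.prod_restrict]

/-- Lebesgue measure on the rectangle `(1, 2] × [0, 1]`. -/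
def rightMeasure : Measure (ℝ × ℝ) := (volume.restrict (Ioc 1 2)).prod unitLeb

theorem rectMeasure_two : rectMeasure 2 = rectMeasure 1 + rightMeasure := by
  have h : (Icc 0 2 : Set ℝ) = Icc 0 1 ∪ Ioc 1 2 :=
    (Icc_union_Ioc_eq_Icc zero_le_one one_le_two).symm
  have hd : Disjoint (Icc 0 1 : Set ℝ) (Ioc 1 2) :=
    disjoint_left.2 fun x h1 h2 => (h2.1.trans_le h1.2).false
  rw [rectMeasure_eq_prod, rectMeasure_eq_prod, rightMeasure, h,
    Measure.restrict_union hd measurableSet_Ioc, Measure.add_prod]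

theorem ae_rectMeasure_one_le : ∀ᵐ z ∂(rectMeasure 1), z.1 ≤ 1 := by
  rw [rectMeasure]
  filter_upwards [ae_restrict_mem (measurableSet_Icc.prod measurableSet_Icc)] with z hz
  exact hz.1.2

theorem ae_rightMeasure_not_le : ∀ᵐ z ∂rightMeasure, ¬ z.1 ≤ 1 := by
  rw [rightMeasure, Measure.prod_restrict]
  filter_upwards [ae_restrict_mem (measurableSet_Ioc.prod measurableSet_Icc)] with z hz
  exact not_le.2 hz.1.1

instance : IsProbabilityMeasure rightMeasure := by
  have : IsProbabilityMeasure ((volume : Measure ℝ).restrict (Ioc 1 2)) := ⟨by simp; norm_num⟩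
  have : IsProbabilityMeasure unitLeb := ⟨by simp [unitLeb]⟩
  rw [rightMeasure]; infer_instance

theorem rightMeasure_singleton (y : ℝ × ℝ) : rightMeasure {y} = 0 := by
  rw [rightMeasure, ← Prod.mk.eta (p := y), ← singleton_prod_singleton, Measure.prod_prod]
  simp

variable {Ω X : Type*} [MeasurableSpace Ω] [MeasurableSpace X] {μ : Measure Ω}

/-- A weighted composition isomorphism carries the functions which factor through `π` to the
functions of the first coordinate, provided that `π` corresponds to the first coordinate. -/
theorem IsWeightedIso.isPulledBack_iff {a : ℝ} (hp : p ≠ ∞) {τ : ℝ × ℝ → Ω} {w : ℝ × ℝ → ℝ}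
    {σ : Ω → ℝ × ℝ} (h : IsWeightedIso p (rectMeasure a) μ τ w σ) {π : Ω → X} (hπ : Measurable π)
    {A : Set X} (hA : MeasurableSet A) {θ : ℝ → X} {θ' : X → ℝ} (hθ : Measurable θ)
    (hθ' : Measurable θ') {c : ℝ} (hc : 0 < c)
    (h₁ : ∀ᵐ z ∂(rectMeasure a), z.1 ≤ 1 →
      w z = c ∧ π (τ z) ∈ A ∧ π (τ z) = θ z.1 ∧ θ' (θ z.1) = z.1)
    (h₂ : ∀ᵐ z ∂(rectMeasure a), ¬ z.1 ≤ 1 → π (τ z) ∉ A) (f : Lp ℝ p μ) :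
    IsPulledBack π A f ↔ IsBaseFunction ((h.toIso hp).toLinearIsometryEquiv f) := by
  constructor
  · rintro ⟨g, hg, hfg⟩
    refine ⟨fun x => c * g (θ x), (hg.comp hθ).const_mul c, ?_⟩
    filter_upwards [h.toIso_coeFn hp f, h.quasiMeasurePreserving.ae hfg, h₁, h₂] with z k1 k2 k3 k4
    rw [k1, k2]
    split_ifs with hz
    · obtain ⟨e1, e2, e3, -⟩ := k3 hz
      rw [indicator_of_mem (show τ z ∈ π ⁻¹' A from e2), e1, Function.comp_apply, e3]
    · rw [indicator_of_notMem (show τ z ∉ π ⁻¹' A from k4 hz), mul_zero]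
  · rintro ⟨g, hg, hfg⟩
    have hgm : Measurable fun y => c⁻¹ * g (θ' y) := (hg.comp hθ').const_mul _
    refine ⟨_, hgm, ?_⟩
    have hs : MeasurableSet {ω | f ω = (π ⁻¹' A).indicator ((fun y => c⁻¹ * g (θ' y)) ∘ π) ω} :=
      measurableSet_eq_fun (Lp.stronglyMeasurable f).measurable
        ((hgm.comp hπ).indicator (hπ hA))
    have key : ∀ᵐ z ∂((rectMeasure a).withDensity fun z => ENNReal.ofReal (w z ^ p.toReal)),
        f (τ z) = (π ⁻¹' A).indicator ((fun y => c⁻¹ * g (θ' y)) ∘ π) (τ z) := by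
      refine (withDensity_absolutelyContinuous _ _).ae_le ?_
      filter_upwards [h.toIso_coeFn hp f, hfg, h₁, h₂] with z k1 k2 k3 k4
      rw [k1] at k2
      split_ifs at k2 with hz
      · obtain ⟨e1, e2, e3, e4⟩ := k3 hz
        rw [indicator_of_mem (show τ z ∈ π ⁻¹' A from e2), Function.comp_apply, e3, e4, ← k2, e1,
          inv_mul_cancel_left₀ hc.ne']
      · rw [indicator_of_notMem (show τ z ∉ π ⁻¹' A from k4 hz)]
        exact (mul_eq_zero.1 k2).resolve_left (h.weight_pos z).ne'
    have h3 := (ae_map_iff h.measurable_map.aemeasurable hs).2 key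
    rwa [h.map_eq] at h3

theorem exists_rpow_eq_measure (hp : p ≠ ∞) {m : ℝ≥0∞} (h0 : m ≠ 0) (ht : m ≠ ∞) :
    ∃ c : ℝ, 0 < c ∧ ENNReal.ofReal (c ^ p.toReal) = m := by
  have h := ENNReal.toReal_pos h0 ht
  refine ⟨m.toReal ^ (1 / p.toReal), Real.rpow_pos_of_pos h _, ?_⟩
  rw [← Real.rpow_mul h.le, one_div_mul_cancel (toReal_pos_of_fact hp).ne', Real.rpow_one,
    ENNReal.ofReal_toReal ht]

/-- Classification of relatively atomless extensions: a finite measure `μ` with a map `π` such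
that points and, over `A`, fibres and graphs are null sets is represented on one of the two
standard rectangles, according to whether the complement of `π ⁻¹' A` is a null set. -/
theorem exists_iso_rectMeasure (hp : p ≠ ∞) [StandardBorelSpace Ω] [StandardBorelSpace X]
    [IsFiniteMeasure μ] {π : Ω → X} (hπ : Measurable π) {A : Set X} (hA : MeasurableSet A)
    (h0 : μ (π ⁻¹' A) ≠ 0) (hpt : ∀ ω, μ {ω} = 0) (hfib : ∀ x ∈ A, μ (π ⁻¹' {x}) = 0)
    (hgraph : ∀ r : X → Ω, Measurable r → μ (π ⁻¹' A ∩ {ω | r (π ω) = ω}) = 0) :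
    ∃ a : ℝ, (a = 1 ∨ a = 2) ∧ ∃ L : BanachLatticeIso (Lp ℝ p μ) (Lp ℝ p (rectMeasure a)),
      ∀ f, IsPulledBack π A f ↔ IsBaseFunction (L.toLinearIsometryEquiv f) := by
  classical
  have hB : MeasurableSet (π ⁻¹' A) := hπ hA
  -- the part over `A` is a multiple of the unit square
  obtain ⟨τ₁, σ₁, θ, θ', hiso₁, hθ, hθ', hπτ⟩ :=
    exists_isMeasureIso_square (μ.restrict (π ⁻¹' A)) (by simpa using h0) hπ
      (fun x => by
        rw [Measure.restrict_apply (hπ (measurableSet_singleton x))]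
        by_cases hx : x ∈ A
        · exact measure_mono_null inter_subset_left (hfib x hx)
        · refine measure_mono_null (t := ∅) ?_ measure_empty
          rintro ω ⟨h1, h2⟩
          exact hx (by rw [← show π ω = x from h1]; exact h2))
      (fun r hr => by
        have hm : MeasurableSet {ω | r (π ω) = ω} :=
          measurableSet_eq_fun (hr.comp hπ) measurable_id
        rw [Measure.restrict_apply hm, inter_comm]
        exact hgraph r hr)
  have hsq : unitLeb.prod unitLeb = rectMeasure 1 := (rectMeasure_eq_prod 1).symm
  rw [hsq, Measure.restrict_apply_univ] at hiso₁
  rw [hsq] at hπτ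
  -- the weights `c` with `c ^ p` the total masses make the isomorphism isometric
  obtain ⟨c₁, hc₁, hc₁m⟩ := exists_rpow_eq_measure hp h0 (measure_ne_top μ _)
  have hτ₁ : ∀ᵐ z ∂(rectMeasure 1), τ₁ z ∈ π ⁻¹' A := by
    have h1 : ∀ᵐ ω ∂(μ.restrict (π ⁻¹' A)), ω ∈ π ⁻¹' A := ae_restrict_mem hB
    rw [← hiso₁.map_eq] at h1
    have h2 := (ae_map_iff hiso₁.measurable_map.aemeasurable hB).1 h1
    rw [Measure.ae_ennreal_smul_measure_iff h0] at h2
    exact h2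
  by_cases hBc : μ (π ⁻¹' A)ᶜ = 0
  · have hμ : μ.restrict (π ⁻¹' A) = μ := Measure.restrict_eq_self_of_ae_mem hBc
    rw [hμ] at hiso₁
    refine ⟨1, Or.inl rfl, ?_⟩
    have hw : IsWeightedIso p (rectMeasure 1) μ τ₁ (fun _ => c₁) σ₁ :=
      IsMeasureIso.toWeighted measurable_const (fun _ => hc₁) (by rwa [hc₁m, withDensity_const])
    refine ⟨hw.toIso hp, fun f => hw.isPulledBack_iff hp hπ hA hθ hθ' hc₁ ?_ ?_ f⟩
    · filter_upwards [hπτ, hτ₁] with z h1 h2 _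
      exact ⟨rfl, h2, h1⟩
    · filter_upwards [ae_rectMeasure_one_le] with z h1 h2 using absurd h1 h2
  -- the complement is not null: it is atomless, hence a multiple of the right square by way of the
  -- unit interval, and the two parts are glued
  · obtain ⟨τ₂, σ₂, hiso₂⟩ := exists_isMeasureIso_smul_unitLeb (μ.restrict (π ⁻¹' A)ᶜ)
      (fun y => le_antisymm ((Measure.restrict_apply_le _ _).trans (hpt y).le) bot_le)
      (by simpa using hBc)
    rw [Measure.restrict_apply_univ] at hiso₂
    obtain ⟨τ₃, σ₃, hiso₃⟩ := exists_isMeasureIso_unitLeb rightMeasure rightMeasure_singleton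
    obtain ⟨c₂, hc₂, hc₂m⟩ := exists_rpow_eq_measure hp hBc (measure_ne_top μ _)
    have hiso₄ := ((hiso₃.symm).smul (μ (π ⁻¹' A)ᶜ)).trans hiso₂
    have hmem₂ : ∀ᵐ ω ∂(μ.restrict (π ⁻¹' A)ᶜ), ω ∉ π ⁻¹' A := ae_restrict_mem hB.compl
    have hS : MeasurableSet {z : ℝ × ℝ | z.1 ≤ 1} :=
      measurableSet_le measurable_fst measurable_const
    have hglue := hiso₁.glue hiso₄ (S := {z | z.1 ≤ 1}) (T := π ⁻¹' A) hS hB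
      (Measure.ae_smul_measure ae_rectMeasure_one_le _)
      (Measure.ae_smul_measure ae_rightMeasure_not_le _) (ae_restrict_mem hB) hmem₂
    rw [Measure.restrict_add_restrict_compl hB] at hglue
    refine ⟨2, Or.inr rfl, ?_⟩
    let w : ℝ × ℝ → ℝ := fun z => if z.1 ≤ 1 then c₁ else c₂
    have hwm : Measurable w := Measurable.ite hS measurable_const measurable_const
    have hdens : ((rectMeasure 2).withDensity fun z => ENNReal.ofReal (w z ^ p.toReal)) =
        μ (π ⁻¹' A) • rectMeasure 1 + μ (π ⁻¹' A)ᶜ • rightMeasure := by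
      rw [rectMeasure_two, withDensity_add_measure]
      congr 1
      · rw [← withDensity_const]
        refine withDensity_congr_ae ?_
        filter_upwards [ae_rectMeasure_one_le] with z hz
        rw [← hc₁m]; simp only [w, if_pos hz]
      · rw [← withDensity_const]
        refine withDensity_congr_ae ?_
        filter_upwards [ae_rightMeasure_not_le] with z hz
        rw [← hc₂m]; simp only [w, if_neg hz]
    rw [← hdens] at hglue
    have hw := IsMeasureIso.toWeighted (p := p) hwm
      (fun z => by simp only [w]; split_ifs <;> assumption) hglue
    have hτ₂ : ∀ᵐ z ∂rightMeasure, τ₂ (σ₃ z) ∉ π ⁻¹' A := by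
      have h1 := hmem₂
      rw [← hiso₄.map_eq] at h1
      have h2 := (ae_map_iff hiso₄.measurable_map.aemeasurable hB.compl).1 h1
      rw [Measure.ae_ennreal_smul_measure_iff hBc] at h2
      exact h2
    refine ⟨hw.toIso hp, fun f => hw.isPulledBack_iff hp hπ hA hθ hθ' hc₁ ?_ ?_ f⟩
    · rw [rectMeasure_two, ae_add_measure_iff]
      constructor
      · filter_upwards [hπτ, hτ₁] with z h1 h2 hz
        have e : Set.piecewise {z : ℝ × ℝ | z.1 ≤ 1} τ₁ (τ₂ ∘ σ₃) z = τ₁ z :=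
          piecewise_eq_of_mem _ _ _ hz
        rw [e]
        exact ⟨if_pos hz, h2, h1⟩
      · filter_upwards [ae_rightMeasure_not_le] with z h1 h2 using absurd h2 h1
    · rw [rectMeasure_two, ae_add_measure_iff]
      constructor
      · filter_upwards [ae_rectMeasure_one_le] with z h1 h2 using absurd h1 h2
      · filter_upwards [hτ₂] with z h1 hz
        have e : Set.piecewise {z : ℝ × ℝ | z.1 ≤ 1} τ₁ (τ₂ ∘ σ₃) z = τ₂ (σ₃ z) :=
          piecewise_eq_of_notMem _ _ _ hz
        rw [e]
        exact h1

/-- A separable `p`-additive Banach lattice `E` with a nonzero closed sublattice `F`, both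
atomless and `E` relatively so over `F`, is one of the two standard pairs. -/
theorem IsPAdditive.exists_iso_rectMeasure {E : Type*} [NormedAddCommGroup E] [NormedSpace ℝ E]
    [Lattice E] [IsBanachLattice E] [TopologicalSpace.SeparableSpace E] (hp : p ≠ ∞)
    (hE : IsPAdditive p.toReal E) {F : Submodule ℝ E} (hF : IsClosedSublattice F) (hF0 : F ≠ ⊥)
    (h₁ : Halves (F : Set E)) (h₂ : HalvesOver (F : Set E)) :
    ∃ a : ℝ, (a = 1 ∨ a = 2) ∧ ∃ L : BanachLatticeIso E (Lp ℝ p (rectMeasure a)),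
      ∀ x, x ∈ F ↔ IsBaseFunction (L.toLinearIsometryEquiv x) := by
  obtain ⟨μ, hμ, L, hL⟩ := hE.exists_pair_representation hp hF
  have k₁ : Halves {f : Lp ℝ p μ | IsPulledBack evenPart headTrue f} := h₁.map L hL
  have k₂ : HalvesOver {f : Lp ℝ p μ | IsPulledBack evenPart headTrue f} := h₂.map L hL
  have h0 : μ (evenPart ⁻¹' headTrue) ≠ 0 := by
    intro h0
    obtain ⟨x, hx, hx0⟩ := F.ne_bot_iff.1 hF0
    obtain ⟨g, -, hg⟩ := (hL x).1 hx
    refine hx0 (L.toLinearIsometryEquiv.map_eq_zero_iff.1 (Lp.ext ?_))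
    have h1 : ∀ᵐ ω ∂μ, ω ∉ evenPart ⁻¹' headTrue := measure_eq_zero_iff_ae_notMem.1 h0
    filter_upwards [hg, h1, Lp.coeFn_zero ℝ p μ] with ω e1 e2 e3
    rw [e1, e3, indicator_of_notMem e2, Pi.zero_apply]
  obtain ⟨a, ha, L', hL'⟩ := _root_.exists_iso_rectMeasure hp measurable_evenPart
    measurableSet_headTrue h0 (fun ω => k₂.measure_singleton hp ω)
    (fun x hx => k₁.measure_fiber hp measurable_evenPart hx)
    (fun r hr => k₂.measure_graph hp measurable_evenPart measurableSet_headTrue hr)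
  exact ⟨a, ha, L.trans L', fun x => (hL x).trans (hL' _)⟩

end Rectangle

/-! ### Halving in atomless `L_p` lattices -/

section Atomless

variable {Ω : Type*} [MeasurableSpace Ω]

/-- Of a subset of intermediate measure and its complement, the smaller one has at most half the
measure. -/
theorem IsAtomlessMeasure.exists_small_subset {ν : Measure Ω} [IsFiniteMeasure ν]
    (hν : IsAtomlessMeasure ν) {s : Set Ω} (hs : MeasurableSet s) (h0 : 0 < ν.real s) (n : ℕ) :
    ∃ t ⊆ s, MeasurableSet t ∧ 0 < ν.real t ∧ ν.real t ≤ ν.real s / 2 ^ n := by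
  induction n with
  | zero => exact ⟨s, subset_rfl, hs, h0, by simp⟩
  | succ n ih =>
    obtain ⟨t, hts, ht, ht0, htn⟩ := ih
    obtain ⟨u, hut, hu, hu0, hult⟩ := hν t ht (ENNReal.toReal_pos_iff.1 ht0).1
    have h1 : 0 < ν.real u := ENNReal.toReal_pos hu0.ne' (measure_ne_top ν u)
    have h2 : ν.real u < ν.real t :=
      (ENNReal.toReal_lt_toReal (measure_ne_top _ _) (measure_ne_top _ _)).2 hult
    have h3 : ν.real (t \ u) = ν.real t - ν.real u := measureReal_sdiff hut hu
    have h4 : ν.real s / 2 ^ (n + 1) = ν.real s / 2 ^ n / 2 := by rw [pow_succ]; field_simp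
    rcases le_total (ν.real u) (ν.real t / 2) with h | h
    · exact ⟨u, hut.trans hts, hu, h1, by rw [h4]; linarith⟩
    · exact ⟨t \ u, sdiff_subset.trans hts, ht.diff hu, by linarith, by rw [h4]; linarith⟩

/-- Sierpiński's theorem: an atomless finite measure attains all intermediate values. -/
theorem IsAtomlessMeasure.exists_subset_measureReal_eq {ν : Measure Ω} [IsFiniteMeasure ν]
    (hν : IsAtomlessMeasure ν) {s : Set Ω} (hs : MeasurableSet s) {c : ℝ} (hc0 : 0 ≤ c)
    (hc : c ≤ ν.real s) : ∃ t ⊆ s, MeasurableSet t ∧ ν.real t = c := by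
  -- a greedy choice of increasing sets of measure at most `c`
  let Adm : Set (Set Ω) := {t | t ⊆ s ∧ MeasurableSet t ∧ ν.real t ≤ c}
  let V : Set Ω → Set ℝ := fun t => {x | ∃ u ∈ Adm, t ⊆ u ∧ ν.real u = x}
  have hVb : ∀ t, BddAbove (V t) := fun t => ⟨c, by rintro _ ⟨u, hu, -, rfl⟩; exact hu.2.2⟩
  -- every admissible set has an admissible extension which is at least halfway to the supremum
  have step : ∀ t : Adm, ∃ u : Adm, t.1 ⊆ u.1 ∧ (ν.real t.1 + sSup (V t.1)) / 2 ≤ ν.real u.1 := by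
    rintro ⟨t, ht⟩
    have hmem : ν.real t ∈ V t := ⟨t, ht, subset_rfl, rfl⟩
    rcases (le_csSup (hVb t) hmem).eq_or_lt with h | h
    · exact ⟨⟨t, ht⟩, subset_rfl, by simp only [← h]; linarith⟩
    · obtain ⟨_, ⟨u, hu, htu, rfl⟩, hlt⟩ := exists_lt_of_lt_csSup ⟨_, hmem⟩
        (show (ν.real t + sSup (V t)) / 2 < sSup (V t) by linarith)
      exact ⟨⟨u, hu⟩, htu, hlt.le⟩
  choose next hsub hnext using step
  let T : ℕ → Adm := fun n => next^[n] ⟨∅, empty_subset _, MeasurableSet.empty, by simpa using hc0⟩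
  have hT : ∀ n, T (n + 1) = next (T n) := fun n => Function.iterate_succ_apply' _ _ _
  have hmono : Monotone fun n => (T n).1 := monotone_nat_of_le_succ fun n => by
    rw [hT]; exact hsub _
  set U : Set Ω := ⋃ n, (T n).1 with hU
  have hUm : MeasurableSet U := MeasurableSet.iUnion fun n => (T n).2.2.1
  have hUs : U ⊆ s := iUnion_subset fun n => (T n).2.1
  have hlim : Tendsto (fun n => ν.real (T n).1) atTop (𝓝 (ν.real U)) :=
    (ENNReal.tendsto_toReal (measure_ne_top _ _)).comp (tendsto_measure_iUnion_atTop hmono)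
  have hUc : ν.real U ≤ c := le_of_tendsto' hlim fun n => (T n).2.2.2
  refine ⟨U, hUs, hUm, le_antisymm hUc (not_lt.1 fun hlt => ?_)⟩
  have hd : ν.real (s \ U) = ν.real s - ν.real U := measureReal_sdiff hUs hUm
  -- a small set `D` outside the union `U` could be added, so every step goes at least halfway from
  -- its start to the measure of `U ∪ D`, which is impossible in the limit
  obtain ⟨n, hn⟩ : ∃ n : ℕ, ν.real (s \ U) / 2 ^ n ≤ c - ν.real U := by
    have h1 : Tendsto (fun n : ℕ => ν.real (s \ U) * (1 / 2) ^ n) atTop (𝓝 0) := by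
      simpa using (tendsto_pow_atTop_nhds_zero_of_lt_one (r := (1 / 2 : ℝ)) (by norm_num)
        (by norm_num)).const_mul (ν.real (s \ U))
    obtain ⟨n, hn⟩ := (h1.eventually (gt_mem_nhds (sub_pos.2 hlt))).exists
    exact ⟨n, by rw [one_div, inv_pow] at hn; exact hn.le⟩
  obtain ⟨D, hDs, hD, hD0, hDn⟩ := hν.exists_small_subset (hs.diff hUm) (by linarith) n
  have hUD : ν.real (U ∪ D) = ν.real U + ν.real D :=
    measureReal_union (disjoint_sdiff_right.mono_right hDs) hD
  have hadm : U ∪ D ∈ Adm :=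
    ⟨union_subset hUs (hDs.trans sdiff_subset), hUm.union hD, by linarith⟩
  have hlow : ∀ n,
      (ν.real (T n).1 + (ν.real U + ν.real D)) / 2 ≤ ν.real (T (n + 1)).1 := fun n => by
    have h1 : ν.real U + ν.real D ≤ sSup (V (T n).1) := le_csSup (hVb _)
      ⟨U ∪ D, hadm, (subset_iUnion (fun n => (T n).1) n).trans subset_union_left, hUD⟩
    have h2 := hnext (T n)
    rw [← hT] at h2
    linarith
  have := le_of_tendsto_of_tendsto' ((hlim.add_const (ν.real U + ν.real D)).div_const 2)
    ((tendsto_add_atTop_iff_nat 1).2 hlim) hlow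
  linarith

theorem IsAtomlessMeasure.withDensity {μ : Measure Ω} (hμ : IsAtomlessMeasure μ) {f : Ω → ℝ≥0∞}
    (hf : Measurable f) [IsFiniteMeasure (μ.withDensity f)] :
    IsAtomlessMeasure (μ.withDensity f) := by
  intro s hs h0
  have hpos : MeasurableSet {x | f x ≠ 0} := hf (measurableSet_singleton 0).compl
  have hiff : ∀ t, MeasurableSet t → (0 < μ.withDensity f t ↔ 0 < μ ({x | f x ≠ 0} ∩ t)) :=
    fun t ht => by
      rw [pos_iff_ne_zero, pos_iff_ne_zero, ne_eq, withDensity_apply_eq_zero hf]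
  obtain ⟨t, hts, ht, ht0, hlt⟩ := hμ _ (hpos.inter hs) ((hiff s hs).1 h0)
  refine ⟨t, hts.trans inter_subset_right, ht, ?_, ?_⟩
  · rw [hiff t ht]
    rwa [inter_eq_self_of_subset_right (hts.trans inter_subset_left)]
  · have h1 : 0 < μ.withDensity f (s \ t) := by
      rw [hiff _ (hs.diff ht), ← inter_sdiff_assoc, pos_iff_ne_zero]
      intro h2
      have h3 := measure_le_inter_add_sdiff μ ({x | f x ≠ 0} ∩ s) t
      rw [h2, add_zero] at h3
      exact (hlt.trans_le h3).not_ge (measure_mono inter_subset_right)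
    have h2 := measure_inter_add_sdiff (μ := μ.withDensity f) s ht
    rw [inter_eq_self_of_subset_right (hts.trans inter_subset_right)] at h2
    rw [← h2]
    exact ENNReal.lt_add_right (measure_ne_top _ _) h1.ne'

/-- Finitely many bounded functions can be approximately halved simultaneously: it suffices to
halve the sets on which all of them are almost constant. -/
theorem IsAtomlessMeasure.exists_halving {ν : Measure Ω} [IsFiniteMeasure ν]
    (hν : IsAtomlessMeasure ν) {m : ℕ} {f : Fin m → Ω → ℝ} (hf : ∀ i, Measurable (f i))
    (h0 : ∀ i x, 0 ≤ f i x) (h1 : ∀ i x, f i x ≤ 1) {δ : ℝ} (hδ : 0 < δ) :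
    ∃ B, MeasurableSet B ∧ ∀ i, |∫ x in B, f i x ∂ν - ∫ x in Bᶜ, f i x ∂ν| ≤ δ := by
  obtain ⟨n, hn⟩ := exists_nat_gt (ν.real univ / δ)
  have hn0 : (0 : ℝ) < n := (by positivity : 0 ≤ ν.real univ / δ).trans_lt hn
  -- the cells `c ⁻¹' {j}`, on which each `n * f i` is constant up to an error of `1`, are halved;
  -- hence `c` has the same distribution on the set `B` and on its complement
  let c : Ω → Fin m → Fin (n + 1) := fun x i => ⟨⌊n * f i x⌋₊, by
    have : ⌊n * f i x⌋₊ ≤ ⌊(n : ℝ)⌋₊ :=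
      Nat.floor_le_floor (mul_le_of_le_one_right hn0.le (h1 i x))
    rw [Nat.floor_natCast] at this
    omega⟩
  have hc : Measurable c := measurable_pi_lambda _ fun i => by
    have hm : Measurable fun x => ⌊n * f i x⌋₊ := Nat.measurable_floor.comp ((hf i).const_mul _)
    refine measurable_to_countable' fun j => ?_
    have : (fun x => c x i) ⁻¹' {j} = (fun x => ⌊n * f i x⌋₊) ⁻¹' {j.1} := by
      ext x; simp [c, Fin.ext_iff]
    rw [this]
    exact hm (measurableSet_singleton _)
  have hcell : ∀ j, MeasurableSet (c ⁻¹' {j}) := fun j => hc (measurableSet_singleton j)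
  have hex : ∀ j, ∃ t ⊆ c ⁻¹' {j}, MeasurableSet t ∧ ν.real t = ν.real (c ⁻¹' {j}) / 2 := fun j =>
    hν.exists_subset_measureReal_eq (hcell j) (by positivity)
      (half_le_self measureReal_nonneg)
  choose t hts ht hteq using hex
  have hB : MeasurableSet (⋃ j, t j) := MeasurableSet.iUnion ht
  refine ⟨⋃ j, t j, hB, fun i => ?_⟩
  have hmap : (ν.restrict (⋃ j, t j)).map c = (ν.restrict (⋃ j, t j)ᶜ).map c := by
    refine Measure.ext_of_singleton fun j => ?_
    rw [Measure.map_apply hc (measurableSet_singleton j),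
      Measure.map_apply hc (measurableSet_singleton j), Measure.restrict_apply (hcell j),
      Measure.restrict_apply (hcell j)]
    have e1 : c ⁻¹' {j} ∩ ⋃ j, t j = t j := by
      refine subset_antisymm ?_ fun x hx => ⟨hts j hx, mem_iUnion.2 ⟨j, hx⟩⟩
      rintro x ⟨hx, hx'⟩
      obtain ⟨k, hk⟩ := mem_iUnion.1 hx'
      have h2 : c x = j := hx
      have h3 : c x = k := hts k hk
      rwa [← h2, h3]
    have e2 : ν.real (c ⁻¹' {j} ∩ (⋃ j, t j)ᶜ) = ν.real (c ⁻¹' {j} ∩ ⋃ j, t j) := by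
      have := measureReal_inter_add_sdiff (μ := ν) (s := c ⁻¹' {j}) hB
      rw [sdiff_eq, e1, hteq] at this
      rw [e1, hteq]; linarith
    exact ((ENNReal.toReal_eq_toReal_iff' (measure_ne_top _ _) (measure_ne_top _ _)).1 e2).symm
  -- the function of `c` which approximates `f i`
  let φ : Ω → ℝ := fun x => (c x i : ℕ) / n
  have hφ : ∫ x in ⋃ j, t j, φ x ∂ν = ∫ x in (⋃ j, t j)ᶜ, φ x ∂ν := by
    have hψ : Measurable fun k : Fin m → Fin (n + 1) => ((k i : ℕ) : ℝ) / n :=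
      measurable_of_countable _
    have e := congrArg (fun ξ => ∫ k, ((k i : ℕ) : ℝ) / n ∂ξ) hmap
    rwa [integral_map hc.aemeasurable hψ.aestronglyMeasurable,
      integral_map hc.aemeasurable hψ.aestronglyMeasurable] at e
  have hφm : Measurable φ :=
    (measurable_of_countable fun k : Fin m → Fin (n + 1) => ((k i : ℕ) : ℝ) / n).comp hc
  have hle : ∀ x, φ x ≤ f i x := fun x => by
    simp only [φ, c]
    rw [div_le_iff₀ hn0, mul_comm (f i x)]
    exact Nat.floor_le (mul_nonneg hn0.le (h0 i x))
  have hge : ∀ x, f i x ≤ φ x + 1 / n := fun x => by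
    simp only [φ, c]
    rw [← add_div, le_div_iff₀ hn0, mul_comm (f i x)]
    exact (Nat.lt_floor_add_one _).le
  have hφ0 : ∀ x, 0 ≤ φ x := fun x => by positivity
  have hfi : Integrable (f i) ν := Integrable.of_bound (hf i).aestronglyMeasurable 1
    (Eventually.of_forall fun x => by rw [Real.norm_of_nonneg (h0 i x)]; exact h1 i x)
  have hφi : Integrable φ ν := Integrable.of_bound hφm.aestronglyMeasurable 1
    (Eventually.of_forall fun x => by
      rw [Real.norm_of_nonneg (hφ0 x)]; exact (hle x).trans (h1 i x))
  have hset : ∀ S, MeasurableSet S → |∫ x in S, f i x ∂ν - ∫ x in S, φ x ∂ν| ≤ ν.real S / n ∧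
      0 ≤ ∫ x in S, f i x ∂ν - ∫ x in S, φ x ∂ν := fun S hS => by
    rw [← integral_sub hfi.integrableOn hφi.integrableOn]
    have h3 : 0 ≤ ∫ x in S, (f i x - φ x) ∂ν := integral_nonneg fun x => sub_nonneg.2 (hle x)
    refine ⟨?_, h3⟩
    rw [abs_of_nonneg h3]
    calc ∫ x in S, (f i x - φ x) ∂ν ≤ ∫ x in S, (1 / n : ℝ) ∂ν :=
          integral_mono (hfi.sub hφi).integrableOn (integrable_const _)
            fun x => by simp only; linarith [hge x]
      _ = ν.real S / n := by
          rw [setIntegral_const, smul_eq_mul]; ring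
  have hb : ∀ S, ν.real S / n ≤ δ := fun S => by
    have h3 : ν.real S ≤ ν.real univ := measureReal_mono (subset_univ _)
    rw [div_lt_iff₀ hδ] at hn
    rw [div_le_iff₀ hn0]; linarith
  obtain ⟨k1, k2⟩ := hset _ hB
  obtain ⟨k3, k4⟩ := hset _ hB.compl
  rw [abs_of_nonneg k2] at k1
  rw [abs_of_nonneg k4] at k3
  have := hb (⋃ j, t j)
  have := hb (⋃ j, t j)ᶜ
  rw [abs_le]
  constructor <;> linarith

variable {p : ℝ≥0∞} [Fact (1 ≤ p)] {μ : Measure Ω}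

/-- The inequality which passes from almost equal `q`-th powers to almost equal numbers. -/
theorem abs_sub_rpow_le {q : ℝ} (hq : 1 ≤ q) {a b : ℝ} (ha : 0 ≤ a) (hb : 0 ≤ b) :
    |a - b| ^ q ≤ |a ^ q - b ^ q| := by
  wlog h : b ≤ a generalizing a b
  · rw [abs_sub_comm a, abs_sub_comm (a ^ q)]
    exact this hb ha (le_of_not_ge h)
  rw [abs_of_nonneg (sub_nonneg.2 h),
    abs_of_nonneg (sub_nonneg.2 (Real.rpow_le_rpow hb h (by linarith)))]
  have := Real.add_rpow_le_rpow_add (sub_nonneg.2 h) hb hq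
  rw [sub_add_cancel] at this
  linarith

theorem ofReal_norm_indicatorL_rpow (hp : p ≠ ∞) {B : Set Ω} (hB : MeasurableSet B)
    (w : Lp ℝ p μ) : ENNReal.ofReal (‖indicatorL p μ hB w‖ ^ p.toReal) =
      ∫⁻ x in B, ‖w x‖ₑ ^ p.toReal ∂μ := by
  rw [ofReal_norm_rpow_eq_lintegral hp, ← lintegral_indicator hB]
  refine lintegral_congr_ae ?_
  filter_upwards [indicatorL_coeFn hB w] with x hx
  rw [hx]
  by_cases hxB : x ∈ B
  · rw [indicator_of_mem hxB, indicator_of_mem hxB]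
  · rw [indicator_of_notMem hxB, indicator_of_notMem hxB, enorm_zero,
      ENNReal.zero_rpow_of_pos (toReal_pos_of_fact hp)]

/-- Finitely many elements below `h` can be approximately halved simultaneously by a set. -/
theorem IsAtomlessMeasure.exists_halving_Lp (hp : p ≠ ∞) (hμ : IsAtomlessMeasure μ) (h : Lp ℝ p μ)
    {m : ℕ} (w : Fin m → Lp ℝ p μ) (hw : ∀ i, |w i| ≤ |h|) {ε : ℝ} (hε : 0 < ε) :
    ∃ (B : Set Ω) (hB : MeasurableSet B),
      ∀ i, |‖indicatorL p μ hB (w i)‖ - ‖indicatorL p μ hB.compl (w i)‖| ≤ ε := by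
  have hq := toReal_pos_of_fact hp
  have hq1 : 1 ≤ p.toReal := (isPAdditive_Lp (μ := μ) hp).one_le
  have hhm : Measurable h := (Lp.stronglyMeasurable h).measurable
  have hwm : ∀ i, Measurable (w i) := fun i => (Lp.stronglyMeasurable (w i)).measurable
  have hdm : Measurable fun x => ‖h x‖ₑ ^ p.toReal := hhm.enorm.pow_const _
  -- with respect to the finite measure with density `|h| ^ p`, the norms are integrals of the
  -- bounded functions `(|w i| / |h|) ^ p`; the minimum with `1` only matters on a null set
  set ν : Measure Ω := μ.withDensity fun x => ‖h x‖ₑ ^ p.toReal with hν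
  have hfin : IsFiniteMeasure ν := isFiniteMeasure_withDensity (by
    rw [← ofReal_norm_rpow_eq_lintegral hp]; exact ENNReal.ofReal_ne_top)
  let f : Fin m → Ω → ℝ := fun i x => min 1 ((|w i x| / |h x|) ^ p.toReal)
  have hf0 : ∀ i x, 0 ≤ f i x := fun i x =>
    le_min zero_le_one (Real.rpow_nonneg (div_nonneg (abs_nonneg _) (abs_nonneg _)) _)
  have hfm : ∀ i, Measurable (f i) := fun i =>
    measurable_const.min (((hwm i).abs.div hhm.abs).pow_const _)
  obtain ⟨B, hB, hBi⟩ := (hμ.withDensity hdm).exists_halving hfm hf0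
    (fun i x => min_le_left _ _) (δ := ε ^ p.toReal) (Real.rpow_pos_of_pos hε _)
  refine ⟨B, hB, fun i => ?_⟩
  have key : ∀ S (hS : MeasurableSet S),
      ‖indicatorL p μ hS (w i)‖ ^ p.toReal = ∫ x in S, f i x ∂ν := fun S hS => by
    have hint : Integrable (f i) (ν.restrict S) :=
      Integrable.of_bound (hfm i).aestronglyMeasurable 1
        (Eventually.of_forall fun x => by
          rw [Real.norm_of_nonneg (hf0 i x)]; exact min_le_left _ _)
    have h1 : ENNReal.ofReal (‖indicatorL p μ hS (w i)‖ ^ p.toReal) =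
        ENNReal.ofReal (∫ x in S, f i x ∂ν) := by
      rw [ofReal_norm_indicatorL_rpow hp,
        ofReal_integral_eq_lintegral_ofReal hint (Eventually.of_forall (hf0 i)), hν,
        restrict_withDensity hS, lintegral_withDensity_eq_lintegral_mul _ hdm
          (hfm i).ennreal_ofReal]
      refine lintegral_congr_ae (ae_restrict_of_ae ?_)
      have h2 := hw i
      rw [← Lp.coeFn_le] at h2
      filter_upwards [h2, Lp.coeFn_abs (w i), Lp.coeFn_abs h] with x e1 e2 e3
      rw [e2, e3] at e1
      rw [Pi.mul_apply]
      by_cases hx : h x = 0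
      · have : w i x = 0 := by rwa [hx, abs_zero, abs_nonpos_iff] at e1
        rw [this, hx, enorm_zero, ENNReal.zero_rpow_of_pos hq, zero_mul]
      · have hx' := abs_pos.2 hx
        have h4 : (|w i x| / |h x|) ^ p.toReal ≤ 1 :=
          Real.rpow_le_one (by positivity) (div_le_one_of_le₀ e1 hx'.le) hq.le
        simp only [f]
        rw [min_eq_right h4, ← ofReal_norm, ← ofReal_norm, Real.norm_eq_abs, Real.norm_eq_abs,
          ENNReal.ofReal_rpow_of_nonneg (abs_nonneg _) hq.le,
          ENNReal.ofReal_rpow_of_nonneg (abs_nonneg _) hq.le,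
          ← ENNReal.ofReal_mul (Real.rpow_nonneg (abs_nonneg _) _),
          ← Real.mul_rpow (abs_nonneg _) (by positivity), mul_div_cancel₀ _ hx'.ne']
    rwa [ENNReal.ofReal_eq_ofReal_iff (Real.rpow_nonneg (norm_nonneg _) _)
      (integral_nonneg (hf0 i))] at h1
  have h1 := abs_sub_rpow_le hq1 (norm_nonneg (indicatorL p μ hB (w i)))
    (norm_nonneg (indicatorL p μ hB.compl (w i)))
  rw [key, key] at h1
  exact (Real.rpow_le_rpow_iff (abs_nonneg _) hε.le hq).1 (h1.trans (hBi i))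

/-- In a Banach lattice, every positive `h` and finitely many positive elements can be
approximately halved simultaneously by a component of `h`. -/
def HasHalvings (E : Type*) [NormedAddCommGroup E] [Lattice E] : Prop :=
  ∀ (h : E) (m : ℕ) (g : Fin m → E) (ε : ℝ), 0 ≤ h → (∀ i, 0 ≤ g i) → 0 < ε → ∃ a : E,
    0 ≤ a ∧ a ≤ h ∧ a ⊓ (h - a) = 0 ∧ ∀ i, |‖g i ⊓ a‖ - ‖g i ⊓ (h - a)‖| ≤ ε

/-- A set `B` which halves `h` and all the truncations `g i ⊓ h` gives the component `1_B h`. -/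
theorem IsAtomlessMeasure.hasHalvings (hp : p ≠ ∞) (hμ : IsAtomlessMeasure μ) :
    HasHalvings (Lp ℝ p μ) := by
  intro h m g ε h0 hg hε
  obtain ⟨B, hB, hBi⟩ := hμ.exists_halving_Lp hp h (fun i => g i ⊓ h)
    (fun i => by
      rw [abs_of_nonneg (le_inf (hg i) h0), abs_of_nonneg h0]; exact inf_le_right) hε
  have hh := ae_nonneg_of_nonneg h0
  have hle : indicatorL p μ hB h ≤ h := by
    rw [← Lp.coeFn_le]
    filter_upwards [indicatorL_coeFn hB h, hh] with x e1 e2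
    rw [e1]
    exact indicator_le_self' (fun _ _ => e2) x
  have hsub : h - indicatorL p μ hB h = indicatorL p μ hB.compl h := by
    apply Lp.ext
    filter_upwards [indicatorL_coeFn hB h, indicatorL_coeFn hB.compl h,
      Lp.coeFn_sub h (indicatorL p μ hB h)] with x e1 e2 e3
    rw [e3, Pi.sub_apply, e1, e2]
    by_cases hx : x ∈ B <;> simp [hx]
  have hinf : ∀ i {S} (hS : MeasurableSet S),
      g i ⊓ indicatorL p μ hS h = indicatorL p μ hS (g i ⊓ h) := fun i S hS => by
    apply Lp.ext
    filter_upwards [indicatorL_coeFn hS h, indicatorL_coeFn hS (g i ⊓ h), Lp.coeFn_inf (g i) h,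
      Lp.coeFn_inf (g i) (indicatorL p μ hS h), ae_nonneg_of_nonneg (hg i)] with x e1 e2 e3 e4 e5
    rw [e4, e2, Pi.inf_apply, e1]
    by_cases hx : x ∈ S
    · rw [indicator_of_mem hx, indicator_of_mem hx, e3, Pi.inf_apply]
    · rw [indicator_of_notMem hx, indicator_of_notMem hx, inf_eq_right.2 e5]
  refine ⟨indicatorL p μ hB h, ?_, hle, ?_, fun i => ?_⟩
  · rw [← Lp.coeFn_le]
    filter_upwards [indicatorL_coeFn hB h, hh, Lp.coeFn_zero ℝ p μ] with x e1 e2 e3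
    rw [e1, e3]
    exact indicator_nonneg (fun _ _ => e2) x
  · rw [hsub]
    apply Lp.ext
    filter_upwards [indicatorL_coeFn hB h, indicatorL_coeFn hB.compl h, hh,
      Lp.coeFn_inf (indicatorL p μ hB h) (indicatorL p μ hB.compl h),
      Lp.coeFn_zero ℝ p μ] with x e1 e2 e3 e4 e5
    rw [e4, Pi.inf_apply, e1, e2, e5]
    by_cases hx : x ∈ B <;> simp [hx, e3]
  · rw [hsub, hinf, hinf]
    exact hBi i

theorem HasHalvings.map {E G : Type*} [NormedAddCommGroup E] [NormedSpace ℝ E] [Lattice E]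
    [IsBanachLattice E] [NormedAddCommGroup G] [NormedSpace ℝ G] [Lattice G] [IsBanachLattice G]
    (L : BanachLatticeIso E G) (hG : HasHalvings G) : HasHalvings E := by
  intro h m g ε h0 hg hε
  obtain ⟨a, ha0, hah, hinf, ha⟩ := hG (L.toLinearIsometryEquiv h) m
    (fun i => L.toLinearIsometryEquiv (g i)) ε (L.map_nonneg h0) (fun i => L.map_nonneg (hg i)) hε
  have haa := L.apply_symm_apply a
  have hsub : L.toLinearIsometryEquiv (h - L.symm.toLinearIsometryEquiv a) =
      L.toLinearIsometryEquiv h - a := by rw [map_sub, haa]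
  refine ⟨L.symm.toLinearIsometryEquiv a, L.symm.map_nonneg ha0, ?_, ?_, fun i => ?_⟩
  · have := L.symm.map_nonneg (sub_nonneg.2 hah)
    rwa [map_sub, L.symm_apply_apply, sub_nonneg] at this
  · apply L.toLinearIsometryEquiv.injective
    rw [L.map_inf, hsub, haa, hinf, map_zero]
  · rw [← L.norm_map (_ ⊓ _), ← L.norm_map (g i ⊓ (h - _)), L.map_inf, L.map_inf, hsub, haa]
    exact ha i

end Atomless

/-! ### Axioms for pairs and their consequences -/

section Pairs

variable {E : Type*} [NormedAddCommGroup E] [NormedSpace ℝ E] [Lattice E] [IsBanachLattice E]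

/-- A substructure of the unit ball which is closed under doubling is the unit ball of a closed
sublattice. -/
theorem BLat.IsSubstructure.exists_isClosedSublattice {N : Set (UnitBall E)}
    (hN : BLat.IsSubstructure N) (hd : ∀ x, BLat.mid x BLat.zero ∈ N → x ∈ N) :
    ∃ F : Submodule ℝ E, IsClosedSublattice F ∧ ∀ x : UnitBall E, x ∈ N ↔ x.1 ∈ F := by
  let N' : Set E := Subtype.val '' N
  have hmem : ∀ x : UnitBall E, x.1 ∈ N' ↔ x ∈ N := fun x =>
    ⟨by rintro ⟨y, hy, h⟩; rwa [← Subtype.ext h], fun h => ⟨x, h, rfl⟩⟩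
  have hclosed : IsClosed N' :=
    (Metric.isClosed_closedBall.isClosedEmbedding_subtypeVal).isClosedMap _ hN.closed
  have hnorm : ∀ x ∈ N', ‖x‖ ≤ 1 := by
    rintro _ ⟨x, -, rfl⟩; exact mem_closedBall_zero_iff.1 x.2
  have hzero : (0 : E) ∈ N' := ⟨_, hN.zero_mem, rfl⟩
  have hmid : ∀ x ∈ N', ∀ y ∈ N', (1 / 2 : ℝ) • (x + y) ∈ N' := by
    rintro _ ⟨x, hx, rfl⟩ _ ⟨y, hy, rfl⟩; exact ⟨_, hN.mid_mem x hx y hy, rfl⟩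
  have hhalf : ∀ x ∈ N', (1 / 2 : ℝ) • x ∈ N' := fun x hx => by
    simpa using hmid x hx 0 hzero
  have hdouble : ∀ x, ‖x‖ ≤ 1 → (1 / 2 : ℝ) • x ∈ N' → x ∈ N' := fun x hx h => by
    have h1 : (BLat.mid ⟨x, mem_closedBall_zero_iff.2 hx⟩ BLat.zero : UnitBall E).1 =
        (1 / 2 : ℝ) • x := by
      show (1 / 2 : ℝ) • (x + 0) = _
      rw [add_zero]
    exact (hmem ⟨x, mem_closedBall_zero_iff.2 hx⟩).2 (hd _ ((hmem _).1 (by rwa [h1])))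
  -- for `x` in the unit ball after scaling by `2 ^ (-n)`, membership in `N` does not depend on `n`
  have hup : ∀ x (n k : ℕ), (1 / 2 : ℝ) ^ n • x ∈ N' → (1 / 2 : ℝ) ^ (n + k) • x ∈ N' := by
    intro x n k h
    induction k with
    | zero => exact h
    | succ k ih =>
      rw [← add_assoc, pow_succ', mul_smul]
      exact hhalf _ ih
  have hdown : ∀ x (m k : ℕ), ‖(1 / 2 : ℝ) ^ m • x‖ ≤ 1 → (1 / 2 : ℝ) ^ (m + k) • x ∈ N' →
      (1 / 2 : ℝ) ^ m • x ∈ N' := by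
    intro x m k
    induction k generalizing m with
    | zero => exact fun _ h => h
    | succ k ih =>
      intro h1 h2
      refine hdouble _ h1 ?_
      rw [← mul_smul, ← pow_succ']
      refine ih (m + 1) ?_ (by rwa [add_assoc, add_comm 1 k])
      rw [pow_succ', mul_smul, norm_smul, Real.norm_of_nonneg (by norm_num)]
      linarith
  have hiff : ∀ x (n m : ℕ), (1 / 2 : ℝ) ^ n • x ∈ N' → ‖(1 / 2 : ℝ) ^ m • x‖ ≤ 1 →
      (1 / 2 : ℝ) ^ m • x ∈ N' := by
    intro x n m h1 h2
    refine hdown x m n h2 ?_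
    rw [add_comm]
    exact hup x n m h1
  -- the sublattice consists of the elements some dyadic fraction of which belongs to `N`
  let G : AddSubgroup E :=
    { carrier := {x | ∃ n : ℕ, (1 / 2 : ℝ) ^ n • x ∈ N'}
      zero_mem' := ⟨0, by simpa using hzero⟩
      add_mem' := by
        rintro x y ⟨n, hx⟩ ⟨m, hy⟩
        refine ⟨n + m + 1, ?_⟩
        have h1 := hup x n m hx
        have h2 := hup y m n hy
        rw [add_comm] at h2
        rw [pow_succ', mul_smul, smul_add]
        exact hmid _ h1 _ h2
      neg_mem' := by
        rintro x ⟨n, y, hy, hyx⟩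
        exact ⟨n, BLat.neg y, hN.neg_mem y hy, by rw [smul_neg, ← hyx]; rfl⟩ }
  have hGclosed : IsClosed (G : Set E) := by
    refine isClosed_of_closure_subset fun x hx => ?_
    obtain ⟨n, hn⟩ : ∃ n : ℕ, ‖(1 / 2 : ℝ) ^ n • x‖ < 1 := by
      have h1 : Tendsto (fun n : ℕ => ‖(1 / 2 : ℝ) ^ n • x‖) atTop (𝓝 ‖(0 : ℝ) • x‖) :=
        ((tendsto_pow_atTop_nhds_zero_of_lt_one (by norm_num) (by norm_num)).smul_const x).norm
      rw [zero_smul, norm_zero] at h1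
      exact (h1.eventually (gt_mem_nhds zero_lt_one)).exists
    obtain ⟨u, hu, hux⟩ := mem_closure_iff_seq_limit.1 hx
    have h2 : Tendsto (fun k => (1 / 2 : ℝ) ^ n • u k) atTop (𝓝 ((1 / 2 : ℝ) ^ n • x)) :=
      hux.const_smul _
    refine ⟨n, hclosed.mem_of_tendsto h2 ?_⟩
    filter_upwards [h2.norm.eventually (gt_mem_nhds hn)] with k hk
    obtain ⟨m, hm⟩ := hu k
    exact hiff _ m n hm hk.le
  -- the scalars `s` with `s x ∈ G` form a closed subgroup which contains arbitrarily small numbers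
  have hsmul : ∀ (r : ℝ), ∀ x ∈ G, r • x ∈ G := by
    intro r x hx
    let H : AddSubgroup ℝ := G.comap ((AddMonoidHom.flip (smulAddHom ℝ E)) x)
    have hH : ∀ s, s ∈ H ↔ s • x ∈ G := fun s => Iff.rfl
    have hHc : IsClosed (H : Set ℝ) :=
      hGclosed.preimage (f := fun s : ℝ => s • x) (continuous_id.smul continuous_const)
    have hHmem : ∀ n : ℕ, (1 / 2 : ℝ) ^ n ∈ H := fun n => by
      obtain ⟨m, hm⟩ := hx
      refine (hH _).2 ?_
      rcases le_total n m with h | h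
      · refine ⟨m - n, ?_⟩
        rwa [← mul_smul, ← pow_add, Nat.sub_add_cancel h]
      · refine ⟨0, ?_⟩
        have := hup x m (n - m) hm
        rwa [Nat.add_sub_cancel' h, ← one_smul ℝ ((1 / 2 : ℝ) ^ n • x),
          ← pow_zero (1 / 2 : ℝ)] at this
    have hHd : Dense (H : Set ℝ) := AddSubgroup.dense_of_not_isolated_zero H fun ε hε => by
      obtain ⟨n, hn⟩ := exists_pow_lt_of_lt_one hε (by norm_num : (1 / 2 : ℝ) < 1)
      exact ⟨(1 / 2) ^ n, hHmem n, by positivity, hn⟩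
    have : r ∈ closure (H : Set ℝ) := hHd r
    rwa [hHc.closure_eq] at this
  refine ⟨{ G with smul_mem' := fun r x hx => hsmul r x hx }, ⟨hGclosed, ?_⟩, fun x => ?_⟩
  · rintro x ⟨n, y, hy, hyx⟩
    refine ⟨n, BLat.abs y, hN.abs_mem y hy, ?_⟩
    show |y.1| = _
    rw [hyx, abs_smul_eq, abs_of_nonneg (by positivity)]
  · constructor
    · intro h
      exact ⟨0, by simpa using (hmem x).2 h⟩
    · rintro ⟨n, hn⟩
      have := hiff x.1 n 0 hn (by simpa using mem_closedBall_zero_iff.1 x.2)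
      rw [pow_zero, one_smul] at this
      exact (hmem x).1 this

/-- The part `|y| ⊓ |h|` of `|h|` cut out by `y`. -/
def lowPart (h y : E) : E := |y| ⊓ |h|

/-- The rest of `|h|` beside the part cut out by `y`. -/
def highPart (h y : E) : E := |h| - lowPart h y

theorem lowPart_nonneg (h y : E) : 0 ≤ lowPart h y := le_inf (abs_nonneg _) (abs_nonneg _)

theorem highPart_nonneg (h y : E) : 0 ≤ highPart h y := sub_nonneg.2 inf_le_right

theorem lowPart_add_highPart (h y : E) : lowPart h y + highPart h y = |h| := by
  rw [highPart, add_sub_cancel]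

theorem norm_inf_sub_inf_le (x y x' y' : E) : ‖x ⊓ y - x' ⊓ y'‖ ≤ ‖x - x'‖ + ‖y - y'‖ :=
  norm_inf_sub_inf_le_add_norm _ _ _ _

theorem norm_lowPart_sub_le (h y h' y' : E) :
    ‖lowPart h y - lowPart h' y'‖ ≤ ‖y - y'‖ + ‖h - h'‖ :=
  (norm_inf_sub_inf_le _ _ _ _).trans
    (add_le_add (norm_abs_sub_abs _ _) (norm_abs_sub_abs _ _))

theorem norm_highPart_sub_le (h y h' y' : E) :
    ‖highPart h y - highPart h' y'‖ ≤ ‖y - y'‖ + 2 * ‖h - h'‖ := by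
  have h1 := norm_sub_le (|h| - |h'|) (lowPart h y - lowPart h' y')
  have h2 := norm_lowPart_sub_le h y h' y'
  have h3 := norm_abs_sub_abs h h'
  have h4 : highPart h y - highPart h' y' = |h| - |h'| - (lowPart h y - lowPart h' y') := by
    rw [highPart, highPart]; abel
  rw [h4]; linarith

/-- The failure of `y` to cut `|h|` into two disjoint parts of equal norm. -/
def halvingDefect (h y : E) : ℝ :=
  max ‖lowPart h y ⊓ highPart h y‖ |‖lowPart h y‖ - ‖highPart h y‖|

/-- The failure of `y` to halve `h` after truncation by `g`. -/
def truncatedDefect (h y g : E) : ℝ := |‖|g| ⊓ lowPart h y‖ - ‖|g| ⊓ highPart h y‖|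

theorem halvingDefect_le (h y h' y' : E) :
    halvingDefect h y ≤ halvingDefect h' y' + 2 * ‖y - y'‖ + 3 * ‖h - h'‖ := by
  have h1 := norm_lowPart_sub_le h y h' y'
  have h2 := norm_highPart_sub_le h y h' y'
  have h3 := norm_inf_sub_inf_le (lowPart h y) (highPart h y) (lowPart h' y') (highPart h' y')
  have h4 := norm_sub_norm_le (lowPart h y ⊓ highPart h y) (lowPart h' y' ⊓ highPart h' y')
  have h5 := abs_norm_sub_norm_le (lowPart h y) (lowPart h' y')
  have h6 := abs_norm_sub_norm_le (highPart h y) (highPart h' y')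
  have h7 := le_max_left ‖lowPart h' y' ⊓ highPart h' y'‖ |‖lowPart h' y'‖ - ‖highPart h' y'‖|
  have h8 := le_max_right ‖lowPart h' y' ⊓ highPart h' y'‖ |‖lowPart h' y'‖ - ‖highPart h' y'‖|
  refine max_le ?_ ?_
  · rw [halvingDefect]; linarith
  · have h9 := abs_le.1 h8
    rw [abs_le] at h5 h6 ⊢
    rw [halvingDefect]
    constructor <;> linarith

theorem truncatedDefect_le (h y g g' : E) :
    truncatedDefect h y g ≤ truncatedDefect h y g' + 2 * ‖g - g'‖ := by
  have h0 := norm_abs_sub_abs g g'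
  have h1 := norm_inf_sub_inf_le |g| (lowPart h y) |g'| (lowPart h y)
  have h2 := norm_inf_sub_inf_le |g| (highPart h y) |g'| (highPart h y)
  have h3 := abs_norm_sub_norm_le (|g| ⊓ lowPart h y) (|g'| ⊓ lowPart h y)
  have h4 := abs_norm_sub_norm_le (|g| ⊓ highPart h y) (|g'| ⊓ highPart h y)
  rw [sub_self, norm_zero, add_zero] at h1 h2
  have h5 := abs_le.1 (le_refl (truncatedDefect h y g'))
  rw [truncatedDefect, abs_le]
  rw [abs_le] at h3 h4
  constructor <;> linarith [h5.1, h5.2]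

/-- The properties of a beautiful pair which determine its separable models up to small
perturbations of `P`, in a form which can be expressed by sentences. To restrict quantifiers to
`P(M)`, multiples of `P` are added to the bounds; the constant `10` only has to exceed the Lipschitz
constants of the defects. -/
structure PairAxioms (P : UnitBall E → ℝ) : Prop where
  nonneg : ∀ x : UnitBall E, 0 ≤ P x
  zero : P BLat.zero ≤ 0
  neg : ∀ x : UnitBall E, P (BLat.neg x) ≤ P x
  mid : ∀ x y, P (BLat.mid x y) ≤ P x + P y
  abs : ∀ x : UnitBall E, P (BLat.abs x) ≤ P x
  double : ∀ x : UnitBall E, P x ≤ 4 * P (BLat.mid x BLat.zero)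
  dist : ∀ x : UnitBall E, ∀ ε : ℝ, 0 < ε → ∃ y : UnitBall E, P y ≤ ε ∧ Dist.dist x y ≤ P x + ε
  nontrivial : ∀ ε : ℝ, 0 < ε → ∃ x : UnitBall E, P x ≤ ε ∧ 1 - ε ≤ ‖x.1‖
  halves : ∀ h : UnitBall E, ∀ ε : ℝ, 0 < ε → ∃ y : UnitBall E, P y ≤ ε ∧
    halvingDefect h.1 y.1 ≤ 10 * P h + ε
  halvesOver : ∀ h : UnitBall E, ∀ ε : ℝ, 0 < ε → ∃ y : UnitBall E, ∀ g : UnitBall E,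
    halvingDefect h.1 y.1 ≤ ε ∧ truncatedDefect h.1 y.1 g.1 ≤ 10 * P g + ε

namespace PairAxioms

variable {P : UnitBall E → ℝ}

theorem isSubstructure (h : PairAxioms P) (hP : Continuous P) :
    BLat.IsSubstructure (BLat.zeroSet P) where
  closed := isClosed_eq hP continuous_const
  zero_mem := le_antisymm h.zero (h.nonneg _)
  neg_mem x hx := le_antisymm ((h.neg x).trans (le_of_eq hx)) (h.nonneg _)
  mid_mem x hx y hy := le_antisymm ((h.mid x y).trans (by
    rw [show P x = 0 from hx, show P y = 0 from hy, add_zero])) (h.nonneg _)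
  abs_mem x hx := le_antisymm ((h.abs x).trans (le_of_eq hx)) (h.nonneg _)

theorem exists_isClosedSublattice (h : PairAxioms P) (hP : Continuous P) :
    ∃ F : Submodule ℝ E, IsClosedSublattice F ∧ ∀ x : UnitBall E, x ∈ BLat.zeroSet P ↔ x.1 ∈ F :=
  (h.isSubstructure hP).exists_isClosedSublattice fun x hx =>
    le_antisymm ((h.double x).trans (by rw [show P (BLat.mid x BLat.zero) = 0 from hx, mul_zero]))
      (h.nonneg _)

/-- The approximations to `P(M)` which the axioms provide can be improved successively, and
converge to an element of `P(M)`. -/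
theorem exists_mem_zeroSet (h : PairAxioms P) (hP : LipschitzWith 1 P) (x : UnitBall E) {ε : ℝ}
    (hε : 0 < ε) : ∃ y ∈ BLat.zeroSet P, Dist.dist x y ≤ P x + ε := by
  have : CompleteSpace (UnitBall E) := Metric.isClosed_closedBall.completeSpace_coe
  set c : ℝ := ε / 8 with hc
  have hc0 : 0 < c := by positivity
  choose! next h1 h2 using fun (n : ℕ) (x : UnitBall E) =>
    h.dist x (c * (1 / 2) ^ n) (by positivity)
  let u : ℕ → UnitBall E := fun n => Nat.rec x (fun n y => next n y) n
  have hu : ∀ n, u (n + 1) = next n (u n) := fun n => rfl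
  have hPu : ∀ n, P (u (n + 1)) ≤ c * (1 / 2) ^ n := fun n => h1 n (u n)
  have hdist : ∀ n, Dist.dist (u (n + 1)) (u (n + 2)) ≤ 3 * c / 2 / 2 ^ n := fun n => by
    have h3 := h2 (n + 1) (u (n + 1))
    rw [← hu] at h3
    have h4 := hPu n
    have h5 : 3 * c / 2 / 2 ^ n = c * (1 / 2) ^ n + c * (1 / 2) ^ (n + 1) := by
      rw [pow_succ, one_div, inv_pow]; field_simp; ring
    linarith
  obtain ⟨y, hy⟩ := cauchySeq_tendsto_of_complete (u := fun n => u (n + 1))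
    (cauchySeq_of_le_geometric_two (C := 3 * c) hdist)
  refine ⟨y, ?_, ?_⟩
  · refine le_antisymm ?_ (h.nonneg y)
    have h3 : Tendsto (fun n : ℕ => c * (1 / 2 : ℝ) ^ n) atTop (𝓝 0) := by
      simpa using (tendsto_pow_atTop_nhds_zero_of_lt_one (r := (1 / 2 : ℝ)) (by norm_num)
        (by norm_num)).const_mul c
    exact le_of_tendsto_of_tendsto' ((hP.continuous.tendsto y).comp hy) h3 hPu
  · have h3 := dist_le_of_le_geometric_two_of_tendsto₀ (C := 3 * c) hdist hy
    have h4 := h2 0 x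
    have h5 := dist_triangle x (u 1) y
    have h6 : Dist.dist x (u 1) ≤ P x + c * (1 / 2) ^ 0 := h4
    simp only [zero_add] at h3
    rw [pow_zero] at h6
    linarith

theorem eq_infDist (h : PairAxioms P) (hP : LipschitzWith 1 P) (x : UnitBall E) :
    P x = Metric.infDist x (BLat.zeroSet P) := by
  refine le_antisymm ?_ ?_
  · refine (Metric.le_infDist ⟨_, (h.isSubstructure hP.continuous).zero_mem⟩).2 fun y hy => ?_
    have h1 := hP.dist_le_mul x y
    rw [NNReal.coe_one, one_mul, show P y = 0 from hy, Real.dist_eq, sub_zero,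
      abs_of_nonneg (h.nonneg x)] at h1
    exact h1
  · refine le_of_forall_pos_le_add fun ε hε => ?_
    obtain ⟨y, hy, hxy⟩ := h.exists_mem_zeroSet hP x hε
    exact (Metric.infDist_le_dist_of_mem hy).trans hxy

variable {F : Submodule ℝ E}

theorem ne_bot (h : PairAxioms P) (hP : LipschitzWith 1 P)
    (hF : ∀ x : UnitBall E, x ∈ BLat.zeroSet P ↔ x.1 ∈ F) : F ≠ ⊥ := by
  rintro rfl
  obtain ⟨x, hx, hx1⟩ := h.nontrivial (1 / 4) (by norm_num)
  obtain ⟨y, hy, hxy⟩ := h.exists_mem_zeroSet hP x (ε := 1 / 4) (by norm_num)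
  have h1 : y.1 = 0 := (Submodule.mem_bot ℝ).1 ((hF y).1 hy)
  rw [Subtype.dist_eq, h1, dist_zero_right] at hxy
  linarith

theorem exists_smul_mem_unitBall (x : E) {t : ℝ} (ht : 0 < t) (hxt : ‖x‖ ≤ t) :
    ∃ y : UnitBall E, x = t • y.1 := by
  refine ⟨⟨t⁻¹ • x, ?_⟩, (smul_inv_smul₀ ht.ne' x).symm⟩
  rw [mem_closedBall_zero_iff, norm_smul, norm_inv, Real.norm_of_nonneg ht.le, inv_mul_le_iff₀ ht,
    mul_one]
  exact hxt

/-- Scaling into the unit ball, and moving an almost halving `y` into `P(M)`. -/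
theorem halves_sublattice (h : PairAxioms P) (hP : LipschitzWith 1 P) (hFc : IsClosedSublattice F)
    (hF : ∀ x : UnitBall E, x ∈ BLat.zeroSet P ↔ x.1 ∈ F) : Halves (F : Set E) := by
  intro z hz hz0 ε hε
  obtain ⟨t, ht, hzt⟩ : ∃ t : ℝ, 0 < t ∧ ‖z‖ ≤ t := ⟨‖z‖ + 1, by positivity, by linarith⟩
  obtain ⟨x, rfl⟩ := exists_smul_mem_unitBall z ht hzt
  have hx0 : 0 ≤ x.1 := by
    have := smul_nonneg (inv_pos.2 ht).le hz0
    rwa [inv_smul_smul₀ ht.ne'] at this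
  have hxF : x.1 ∈ F := by
    have := F.smul_mem t⁻¹ hz
    rwa [inv_smul_smul₀ ht.ne'] at this
  have hPx : P x = 0 := (hF x).2 hxF
  set δ : ℝ := ε / (8 * t) with hδ
  have hδ0 : 0 < δ := by positivity
  obtain ⟨y, hy, hxy⟩ := h.halves x δ hδ0
  obtain ⟨y', hy', hyy'⟩ := h.exists_mem_zeroSet hP y hδ0
  have hy'F := (hF y').1 hy'
  have hdef : halvingDefect x.1 y'.1 ≤ 8 * δ := by
    have h1 := halvingDefect_le x.1 y'.1 x.1 y.1
    rw [sub_self, norm_zero] at h1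
    rw [Subtype.dist_eq, dist_eq_norm, norm_sub_rev] at hyy'
    linarith
  have htδ : t * (8 * δ) = ε := by rw [hδ]; field_simp
  have hlow : lowPart x.1 y'.1 ∈ F := hFc.inf_mem (hFc.abs_mem _ hy'F) (hFc.abs_mem _ hxF)
  refine ⟨t • lowPart x.1 y'.1, F.smul_mem t hlow, t • highPart x.1 y'.1,
    F.smul_mem t (F.sub_mem (hFc.abs_mem _ hxF) hlow), smul_nonneg ht.le (lowPart_nonneg _ _),
    smul_nonneg ht.le (highPart_nonneg _ _), ?_, ?_, ?_⟩
  · rw [← smul_add, lowPart_add_highPart, abs_of_nonneg hx0]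
  · rw [← smul_inf_of_nonneg ht.le, norm_smul, Real.norm_of_nonneg ht.le, ← htδ]
    exact mul_le_mul_of_nonneg_left ((le_max_left _ _).trans hdef) ht.le
  · rw [norm_smul, norm_smul, Real.norm_of_nonneg ht.le, ← mul_sub, abs_mul, abs_of_pos ht, ← htδ]
    exact mul_le_mul_of_nonneg_left ((le_max_right _ _).trans hdef) ht.le

/-- Scaling into the unit ball, together with the truncating elements of norm at most `K`. -/
theorem halvesOver_sublattice (h : PairAxioms P)
    (hF : ∀ x : UnitBall E, x ∈ BLat.zeroSet P ↔ x.1 ∈ F) : HalvesOver (F : Set E) := by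
  intro z hz0 K ε hε
  obtain ⟨t, ht, hzt, hKt⟩ : ∃ t : ℝ, 0 < t ∧ ‖z‖ ≤ t ∧ K ≤ t :=
    ⟨‖z‖ + |K| + 1, by positivity, by linarith [abs_nonneg K],
      by linarith [norm_nonneg z, le_abs_self K]⟩
  obtain ⟨x, rfl⟩ := exists_smul_mem_unitBall z ht hzt
  have hx0 : 0 ≤ x.1 := by
    have := smul_nonneg (inv_pos.2 ht).le hz0
    rwa [inv_smul_smul₀ ht.ne'] at this
  have htδ : t * (ε / t) = ε := by field_simp
  obtain ⟨y, hy⟩ := h.halvesOver x (ε / t) (by positivity)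
  have hdef := (hy BLat.zero).1
  refine ⟨t • lowPart x.1 y.1, t • highPart x.1 y.1, smul_nonneg ht.le (lowPart_nonneg _ _),
    smul_nonneg ht.le (highPart_nonneg _ _), ?_, ?_, ?_, fun g hgF hg0 hgK => ?_⟩
  · rw [← smul_add, lowPart_add_highPart, abs_of_nonneg hx0]
  · rw [← smul_inf_of_nonneg ht.le, norm_smul, Real.norm_of_nonneg ht.le]
    refine le_trans ?_ htδ.le
    exact mul_le_mul_of_nonneg_left ((le_max_left _ _).trans hdef) ht.le
  · rw [norm_smul, norm_smul, Real.norm_of_nonneg ht.le, ← mul_sub, abs_mul, abs_of_pos ht]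
    refine le_trans ?_ htδ.le
    exact mul_le_mul_of_nonneg_left ((le_max_right _ _).trans hdef) ht.le
  · obtain ⟨g', rfl⟩ := exists_smul_mem_unitBall g ht (hgK.trans hKt)
    have hg'0 : 0 ≤ g'.1 := by
      have := smul_nonneg (inv_pos.2 ht).le hg0
      rwa [inv_smul_smul₀ ht.ne'] at this
    have hg'F : g'.1 ∈ F := by
      have := F.smul_mem t⁻¹ hgF
      rwa [inv_smul_smul₀ ht.ne'] at this
    have h1 := (hy g').2
    rw [show P g' = 0 from (hF g').2 hg'F, mul_zero, zero_add, truncatedDefect,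
      abs_of_nonneg hg'0] at h1
    rw [← smul_inf_of_nonneg ht.le, ← smul_inf_of_nonneg ht.le, norm_smul, norm_smul,
      Real.norm_of_nonneg ht.le, ← mul_sub, abs_mul, abs_of_pos ht]
    exact (mul_le_mul_of_nonneg_left h1 ht.le).trans htδ.le

end PairAxioms

end Pairs

/-! ### Formulas and their values -/

namespace BLat

section Formulas

variable {K : Type} {n : ℕ}

/-- The term `(s ⊓ t) / 2`. -/
def Term.halfInf (s t : Term n) : Term n :=
  .mid (.mid s t) (.neg (.abs (.mid s (.neg t))))

/-- The term for a quarter of `lowPart h y`. -/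
def Term.low (h y : Term n) : Term n := .mid (.halfInf (.abs y) (.abs h)) .zero

/-- The term for a quarter of `highPart h y`. -/
def Term.high (h y : Term n) : Term n :=
  .mid (.mid (.abs h) .zero) (.neg (.halfInf (.abs y) (.abs h)))

/-- The formula `max φ ψ`. -/
def Formula.maxOf (φ ψ : Formula K n) : Formula K n :=
  .conn ⟨fun v => max (v 0) (v 1), by fun_prop⟩ ![φ, ψ]

/-- The formula `c + a φ + b ψ`. -/
def Formula.affine (c a b : ℝ) (φ ψ : Formula K n) : Formula K n :=
  .conn ⟨fun v => c + a * v 0 + b * v 1, by fun_prop⟩ ![φ, ψ]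

/-- The formula whose value is `halvingDefect h y`. -/
def Formula.halving (h y : Term n) : Formula K n :=
  .conn ⟨fun v => max (8 * v 0) |4 * v 1 - 4 * v 2|, by fun_prop⟩
    ![.norm (.halfInf (.low h y) (.high h y)), .norm (.low h y), .norm (.high h y)]

/-- The formula whose value is `truncatedDefect h y g`. -/
def Formula.truncated (h y g : Term n) : Formula K n :=
  .conn ⟨fun v => |8 * v 0 - 8 * v 1|, by fun_prop⟩
    ![.norm (.halfInf (.mid (.mid (.abs g) .zero) .zero) (.low h y)),
      .norm (.halfInf (.mid (.mid (.abs g) .zero) .zero) (.high h y))]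

variable {E : Type*} [NormedAddCommGroup E] [NormedSpace ℝ E] [Lattice E] [IsBanachLattice E]
  (v : Fin n → UnitBall E)

theorem Term.eval_halfInf (s t : Term n) :
    ((Term.halfInf s t).eval v).1 = (1 / 2 : ℝ) • ((s.eval v).1 ⊓ (t.eval v).1) := by
  show (1 / 2 : ℝ) • ((1 / 2 : ℝ) • ((s.eval v).1 + (t.eval v).1) +
    -|(1 / 2 : ℝ) • ((s.eval v).1 + -(t.eval v).1)|) = _
  rw [inf_eq_half_smul, abs_smul_eq, abs_of_pos (by norm_num : (0 : ℝ) < 1 / 2), ← sub_eq_add_neg,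
    ← sub_eq_add_neg, ← smul_sub]

theorem Term.eval_low (h y : Term n) :
    ((Term.low h y).eval v).1 = (1 / 4 : ℝ) • lowPart (h.eval v).1 (y.eval v).1 := by
  show (1 / 2 : ℝ) • (((Term.halfInf y.abs h.abs).eval v).1 + 0) = _
  rw [Term.eval_halfInf, add_zero, smul_smul]
  norm_num
  rfl

theorem Term.eval_high (h y : Term n) :
    ((Term.high h y).eval v).1 = (1 / 4 : ℝ) • highPart (h.eval v).1 (y.eval v).1 := by
  show (1 / 2 : ℝ) • ((1 / 2 : ℝ) • (|(h.eval v).1| + 0) +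
    -((Term.halfInf y.abs h.abs).eval v).1) = _
  rw [Term.eval_halfInf, add_zero, ← sub_eq_add_neg, ← smul_sub, smul_smul]
  norm_num
  rfl

variable (S : Set (UnitBall E)) (I : K → UnitBall E → ℝ)

theorem Formula.eval_maxOf (φ ψ : Formula K n) :
    (Formula.maxOf φ ψ).eval S I v = max (φ.eval S I v) (ψ.eval S I v) := rfl

theorem Formula.eval_affine (c a b : ℝ) (φ ψ : Formula K n) :
    (Formula.affine c a b φ ψ).eval S I v = c + a * φ.eval S I v + b * ψ.eval S I v := rfl

theorem Formula.eval_halving (h y : Term n) :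
    (Formula.halving h y : Formula K n).eval S I v =
      halvingDefect (h.eval v).1 (y.eval v).1 := by
  show max (8 * ‖((Term.halfInf (.low h y) (.high h y)).eval v).1‖)
    |4 * ‖((Term.low h y).eval v).1‖ - 4 * ‖((Term.high h y).eval v).1‖| = _
  rw [Term.eval_halfInf, Term.eval_low, Term.eval_high, ← smul_inf_of_nonneg (by norm_num),
    smul_smul, norm_smul, norm_smul, norm_smul, halvingDefect]
  norm_num
  congr 2 <;> ring_nf

theorem Formula.eval_truncated (h y g : Term n) :
    (Formula.truncated h y g : Formula K n).eval S I v =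
      truncatedDefect (h.eval v).1 (y.eval v).1 (g.eval v).1 := by
  have hg : ((Term.mid (.mid (.abs g) .zero) .zero).eval v).1 = (1 / 4 : ℝ) • |(g.eval v).1| := by
    show (1 / 2 : ℝ) • ((1 / 2 : ℝ) • (|(g.eval v).1| + 0) + 0) = _
    rw [add_zero, add_zero, smul_smul]; norm_num
  show |8 * ‖((Term.halfInf (.mid (.mid (.abs g) .zero) .zero) (.low h y)).eval v).1‖ -
    8 * ‖((Term.halfInf (.mid (.mid (.abs g) .zero) .zero) (.high h y)).eval v).1‖| = _
  rw [Term.eval_halfInf, Term.eval_halfInf, hg, Term.eval_low, Term.eval_high,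
    ← smul_inf_of_nonneg (by norm_num), ← smul_inf_of_nonneg (by norm_num),
    smul_smul, smul_smul, norm_smul, norm_smul, truncatedDefect]
  norm_num
  congr 1; ring

/-- The values of a formula are bounded, uniformly in the universe of the structure. -/
theorem Formula.exists_bound {I : K → UnitBall E → ℝ} (hI : ∀ k, ∃ C, ∀ x, |I k x| ≤ C)
    (φ : Formula K n) : ∃ C : ℝ, 0 ≤ C ∧ ∀ S v, |φ.eval S I v| ≤ C := by
  induction φ with
  | norm t =>
    refine ⟨1, zero_le_one, fun S v => ?_⟩
    show |‖(t.eval v).1‖| ≤ 1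
    rw [abs_of_nonneg (norm_nonneg _)]
    exact mem_closedBall_zero_iff.1 (t.eval v).2
  | dist s t =>
    refine ⟨2, zero_le_two, fun S v => ?_⟩
    show |Dist.dist (s.eval v) (t.eval v)| ≤ 2
    rw [abs_of_nonneg dist_nonneg, Subtype.dist_eq, dist_eq_norm]
    have h1 := mem_closedBall_zero_iff.1 (s.eval v).2
    have h2 := mem_closedBall_zero_iff.1 (t.eval v).2
    have h3 := norm_sub_le (s.eval v).1 (t.eval v).1
    linarith
  | pred k t =>
    obtain ⟨C, hC⟩ := hI k
    exact ⟨max C 0, le_max_right _ _, fun S v => (hC _).trans (le_max_left _ _)⟩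
  | @conn n m u φ ih =>
    choose C hC0 hC using ih
    obtain ⟨B, hB⟩ :=
      (isCompact_univ_pi fun i => isCompact_Icc (a := -C i) (b := C i)).bddAbove_image
        (u.continuous.abs.continuousOn)
    refine ⟨max B 0, le_max_right _ _, fun S v => le_max_of_le_left (hB ?_)⟩
    exact ⟨_, fun i _ => abs_le.1 (hC i S v), rfl⟩
  | sup φ ih =>
    obtain ⟨C, hC0, hC⟩ := ih
    refine ⟨C, hC0, fun S v => abs_le.2 ⟨?_, Real.iSup_le (fun x => (abs_le.1 (hC _ _)).2) hC0⟩⟩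
    rcases isEmpty_or_nonempty S with h | ⟨⟨x⟩⟩
    · show -C ≤ ⨆ x : S, _
      rw [Real.iSup_of_isEmpty]; linarith
    · exact le_ciSup_of_le ⟨C, by rintro _ ⟨y, rfl⟩; exact (abs_le.1 (hC _ _)).2⟩ x
        (abs_le.1 (hC _ _)).1
  | inf φ ih =>
    obtain ⟨C, hC0, hC⟩ := ih
    refine ⟨C, hC0, fun S v => abs_le.2 ⟨Real.le_iInf (fun x => (abs_le.1 (hC _ _)).1)
      (by linarith), ?_⟩⟩
    rcases isEmpty_or_nonempty S with h | ⟨⟨x⟩⟩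
    · show ⨅ x : S, _ ≤ C
      rw [Real.iInf_of_isEmpty]; linarith
    · exact ciInf_le_of_le ⟨-C, by rintro _ ⟨y, rfl⟩; exact (abs_le.1 (hC _ _)).1⟩ x
        (abs_le.1 (hC _ _)).2

variable {S I v}

theorem Formula.eval_sup_le_iff (hI : ∀ k, ∃ C, ∀ x, |I k x| ≤ C) (hS : S.Nonempty)
    (φ : Formula K (n + 1)) {c : ℝ} :
    φ.sup.eval S I v ≤ c ↔ ∀ x ∈ S, φ.eval S I (Fin.cons x v) ≤ c := by
  obtain ⟨C, -, hC⟩ := φ.exists_bound hI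
  have : Nonempty S := hS.to_subtype
  have h := ciSup_le_iff (a := c) (f := fun x : S => φ.eval S I (Fin.cons x.1 v))
    ⟨C, by rintro _ ⟨y, rfl⟩; exact (abs_le.1 (hC _ _)).2⟩
  exact h.trans ⟨fun h x hx => h ⟨x, hx⟩, fun h x => h x.1 x.2⟩

theorem Formula.eval_inf_le_iff (hI : ∀ k, ∃ C, ∀ x, |I k x| ≤ C) (hS : S.Nonempty)
    (φ : Formula K (n + 1)) {c : ℝ} :
    φ.inf.eval S I v ≤ c ↔ ∀ ε : ℝ, 0 < ε → ∃ x ∈ S, φ.eval S I (Fin.cons x v) ≤ c + ε := by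
  obtain ⟨C, -, hC⟩ := φ.exists_bound hI
  have : Nonempty S := hS.to_subtype
  have hb : BddBelow (range fun x : S => φ.eval S I (Fin.cons x.1 v)) :=
    ⟨-C, by rintro _ ⟨y, rfl⟩; exact (abs_le.1 (hC _ _)).1⟩
  constructor
  · intro h ε hε
    obtain ⟨x, hx⟩ := exists_lt_of_ciInf_lt (h.trans_lt (lt_add_of_pos_right c hε))
    exact ⟨x.1, x.2, hx.le⟩
  · intro h
    refine le_of_forall_pos_le_add fun ε hε => ?_
    obtain ⟨x, hx, hxe⟩ := h ε hε
    exact ciInf_le_of_le hb ⟨x, hx⟩ hxe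

end Formulas

end BLat

/-! ### Beautiful pairs satisfy the axioms -/

section Beautiful

variable {E : Type*} [NormedAddCommGroup E] [NormedSpace ℝ E] [Lattice E] [IsBanachLattice E]

/-- The component `a` of `|h|` cuts out itself as the lower part of `h`. -/
theorem HasHalvings.exists_unitBall (hE : HasHalvings E) (h : UnitBall E) {m : ℕ}
    (g : Fin m → UnitBall E) {ε : ℝ} (hε : 0 < ε) : ∃ y : UnitBall E,
      halvingDefect h.1 y.1 ≤ ε ∧ ∀ i, truncatedDefect h.1 y.1 (g i).1 ≤ ε := by
  obtain ⟨a, ha0, hah, hinf, ha⟩ := hE |h.1| (m + 1) (Fin.cons |h.1| fun i => |(g i).1|) ε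
    (abs_nonneg _) (fun i => by refine Fin.cases ?_ (fun i => ?_) i <;> simp [abs_nonneg]) hε
  have hl : lowPart h.1 a = a := by rw [lowPart, abs_of_nonneg ha0, inf_eq_left.2 hah]
  refine ⟨⟨a, ?_⟩, ?_, fun i => ?_⟩
  · rw [mem_closedBall_zero_iff]
    refine (norm_le_norm_of_nonneg_of_le ha0 hah).trans ?_
    rw [norm_abs_eq_norm]
    exact mem_closedBall_zero_iff.1 h.2
  · rw [halvingDefect, highPart, hl, hinf, norm_zero]
    have h1 := ha 0
    rw [Fin.cons_zero, inf_eq_right.2 hah, inf_eq_right.2 (sub_le_self _ ha0)] at h1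
    exact max_le hε.le h1
  · rw [truncatedDefect, highPart, hl]
    exact ha i.succ

theorem HasHalvings.of_isAtomlessLpLattice {p : ℝ≥0∞} [Fact (1 ≤ p)] (hp : p ≠ ∞) {E : Type}
    [NormedAddCommGroup E] [NormedSpace ℝ E] [Lattice E] [IsBanachLattice E]
    (hE : IsAtomlessLpLattice p E) : HasHalvings E := by
  obtain ⟨-, Ω, _, μ, hμ, ⟨L⟩⟩ := hE
  exact (hμ.hasHalvings hp).map L

namespace BLat

variable {P : UnitBall E → ℝ}

theorem IsElementaryPair.exists_dist_lt (h : IsElementaryPair P) (x : UnitBall E) {ε : ℝ}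
    (hε : 0 < ε) : ∃ y ∈ zeroSet P, Dist.dist x y < P x + ε := by
  refine (Metric.infDist_lt_iff ⟨_, h.1.1.zero_mem⟩).1 ?_
  rw [← h.2]; linarith

theorem IsElementaryPair.le_dist (h : IsElementaryPair P) (x : UnitBall E) {y : UnitBall E}
    (hy : y ∈ zeroSet P) : P x ≤ Dist.dist x y := by
  rw [h.2]; exact Metric.infDist_le_dist_of_mem hy

theorem exists_bound_empty (k : Empty) : ∃ C : ℝ, ∀ _ : UnitBall E, |k.elim| ≤ C := k.elim

/-- Approximate solutions of a condition with parameters in an elementary substructure can be found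
in the substructure. -/
theorem IsElementarySubstructure.inf_le {N : Set (UnitBall E)} (h : IsElementarySubstructure N)
    {n : ℕ} (φ : Formula Empty (n + 1)) {v : Fin n → UnitBall E} (hv : ∀ i, v i ∈ N)
    (hφ : ∀ ε : ℝ, 0 < ε → ∃ x, φ.evalL univ (Fin.cons x v) ≤ ε) {ε : ℝ} (hε : 0 < ε) :
    ∃ x ∈ N, φ.evalL univ (Fin.cons x v) ≤ ε := by
  have h1 : φ.inf.evalL univ v ≤ 0 :=
    (Formula.eval_inf_le_iff exists_bound_empty ⟨zero, mem_univ _⟩ φ).2 fun ε hε => by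
      obtain ⟨x, hx⟩ := hφ ε hε
      exact ⟨x, trivial, by rw [zero_add]; exact hx⟩
  rw [← h.2 n φ.inf v hv] at h1
  obtain ⟨x, hx, hxe⟩ := (Formula.eval_inf_le_iff exists_bound_empty ⟨_, h.1.zero_mem⟩ φ).1 h1 ε hε
  refine ⟨x, hx, ?_⟩
  rw [← h.2 (n + 1) φ _ fun i => by refine Fin.cases ?_ (fun i => ?_) i; exacts [hx, hv i]]
  rwa [zero_add] at hxe

/-- An elementary substructure is closed under doubling within the unit ball, because it contains
approximate solutions `z` of `z / 2 = x / 2`. -/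
theorem IsElementarySubstructure.mem_of_mid_zero_mem {N : Set (UnitBall E)}
    (h : IsElementarySubstructure N) (x : UnitBall E) (hx : mid x zero ∈ N) : x ∈ N := by
  rw [← h.1.closed.closure_eq, Metric.mem_closure_iff]
  intro ε hε
  obtain ⟨z, hz, hzx⟩ := h.inf_le (n := 1) (.dist (.mid (.var 0) .zero) (.var 1))
    (v := fun _ => mid x zero) (fun _ => hx) (fun ε hε => ⟨x, by
      show Dist.dist (mid x zero) (mid x zero) ≤ ε
      rw [dist_self]; exact hε.le⟩) (ε := ε / 4) (by positivity)
  refine ⟨z, hz, ?_⟩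
  have h1 : Dist.dist (mid z zero) (mid x zero) ≤ ε / 4 := hzx
  rw [Subtype.dist_eq, dist_eq_norm] at h1 ⊢
  have h2 : (mid z zero : UnitBall E).1 - (mid x zero : UnitBall E).1 =
      (1 / 2 : ℝ) • (z.1 - x.1) := by
    show (1 / 2 : ℝ) • (z.1 + 0) - (1 / 2 : ℝ) • (x.1 + 0) = _
    rw [add_zero, add_zero, smul_sub]
  rw [h2, norm_smul, Real.norm_of_nonneg (by norm_num), norm_sub_rev] at h1
  linarith

/-- If `y` in the sublattice is close to `x / 2`, then `2 y` is close to `x`. -/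
theorem IsElementaryPair.le_four_mul_mid (h : IsElementaryPair P) (x : UnitBall E) :
    P x ≤ 4 * P (mid x zero) := by
  obtain ⟨F, -, hF⟩ := h.1.1.exists_isClosedSublattice h.1.mem_of_mid_zero_mem
  refine le_of_forall_pos_le_add fun ε hε => ?_
  obtain ⟨y, hy, hxy⟩ := h.exists_dist_lt (mid x zero) (ε := ε / 4) (by positivity)
  set δ := P (mid x zero) + ε / 4 with hδ
  have hδ0 : 0 < δ := dist_nonneg.trans_lt hxy
  have h1 : ‖x.1 - (2 : ℝ) • y.1‖ ≤ 2 * δ := by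
    have e : x.1 - (2 : ℝ) • y.1 = (2 : ℝ) • ((mid x zero : UnitBall E).1 - y.1) := by
      show _ = (2 : ℝ) • ((1 / 2 : ℝ) • (x.1 + 0) - y.1)
      rw [add_zero, smul_sub, smul_smul]; norm_num
    rw [e, norm_smul, Real.norm_of_nonneg zero_le_two, ← dist_eq_norm, ← Subtype.dist_eq]
    linarith
  have h2 : ‖(2 : ℝ) • y.1‖ ≤ 1 + 2 * δ := by
    have h3 := norm_sub_norm_le ((2 : ℝ) • y.1) x.1
    have h4 := mem_closedBall_zero_iff.1 x.2
    rw [norm_sub_rev] at h3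
    linarith
  have h3 : 0 < 1 + 2 * δ := by linarith
  -- `2 y` may lie outside the unit ball, so it is scaled back
  let z : UnitBall E := ⟨(1 + 2 * δ)⁻¹ • (2 : ℝ) • y.1, by
    rw [mem_closedBall_zero_iff, norm_smul, norm_inv, Real.norm_of_nonneg h3.le,
      inv_mul_le_iff₀ h3, mul_one]
    exact h2⟩
  have hz : z ∈ zeroSet P := (hF z).2 (F.smul_mem _ (F.smul_mem _ ((hF y).1 hy)))
  refine (h.le_dist x hz).trans ?_
  have h4 : ‖(2 : ℝ) • y.1 - z.1‖ ≤ 2 * δ := by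
    have e : (2 : ℝ) • y.1 - z.1 = (1 - (1 + 2 * δ)⁻¹) • (2 : ℝ) • y.1 := by
      rw [sub_smul, one_smul]
    have e2 : 1 - (1 + 2 * δ)⁻¹ = 2 * δ / (1 + 2 * δ) := by field_simp; ring
    rw [e, e2, norm_smul, Real.norm_of_nonneg (by positivity), div_mul_eq_mul_div, div_le_iff₀ h3]
    exact mul_le_mul_of_nonneg_left h2 (by positivity)
  have h5 := norm_sub_le_norm_sub_add_norm_sub x.1 ((2 : ℝ) • y.1) z.1
  rw [Subtype.dist_eq, dist_eq_norm]
  linarith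

/-- The conditions that `y` halves `h`, exactly and also after truncation by `g ∈ P(M)`, form a type
over `P(M) ∪ {h}`. Halvings for finitely many `g` satisfy it approximately, and saturation over
`P(M)` provides a realisation. -/
theorem IsBeautifulPair.exists_halvesOver (hE : HasHalvings E) (hB : IsBeautifulPair P)
    (h : UnitBall E) : ∃ y : UnitBall E, ∀ g ∈ zeroSet P, halvingDefect h.1 y.1 ≤ 0 ∧
      truncatedDefect h.1 y.1 g.1 ≤ 0 := by
  let χ : Formula Empty (1 + 2) :=
    .maxOf (.halving (.var 1) (.var 0)) (.truncated (.var 1) (.var 0) (.var 2))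
  have hχ : ∀ (y : Fin 1 → UnitBall E) (g : UnitBall E),
      χ.evalL univ (Fin.append y ![h, g]) =
        max (halvingDefect h.1 (y 0).1) (truncatedDefect h.1 (y 0).1 g.1) := fun y g => by
    rw [Formula.evalL, Formula.eval_maxOf, Formula.eval_halving, Formula.eval_truncated]
    rfl
  have h0 : ∀ y g : E, 0 ≤ max (halvingDefect h.1 y) (truncatedDefect h.1 y g) := fun y g =>
    (abs_nonneg _).trans (le_max_right _ _)
  obtain ⟨y, -, hy⟩ := hB.2.2 {h} (finite_singleton h) 1
    {c | ∃ g ∈ zeroSet P, c = ⟨2, χ, ![h, g]⟩}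
    (by
      rintro _ ⟨g, hg, rfl⟩ i
      fin_cases i
      exacts [Or.inr rfl, Or.inl hg])
    (by
      intro Γ₀ hΓ₀ hfin ε hε
      have : Nonempty (UnitBall E) := ⟨zero⟩
      have hex : ∀ c ∈ Γ₀, ∃ g ∈ zeroSet P, c = ⟨2, χ, ![h, g]⟩ := fun c hc => hΓ₀ hc
      choose! g hg hgc using hex
      obtain ⟨m, ⟨e⟩⟩ : ∃ m : ℕ, Nonempty (Γ₀ ≃ Fin m) := by
        have := hfin.to_subtype
        exact ⟨_, ⟨Finite.equivFin Γ₀⟩⟩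
      obtain ⟨y, hy1, hy2⟩ := hE.exists_unitBall h (fun i => g (e.symm i).1) hε
      refine ⟨fun _ => y, fun _ => trivial, fun c hc => ?_⟩
      have h2 := hy2 (e ⟨c, hc⟩)
      rw [e.symm_apply_apply] at h2
      rw [hgc c hc]
      show |χ.evalL univ (Fin.append (fun _ => y) ![h, g c])| ≤ ε
      rw [hχ, abs_of_nonneg (h0 _ _)]
      exact max_le hy1 h2)
  refine ⟨y 0, fun g hg => ?_⟩
  have h1 := hy ⟨2, χ, ![h, g]⟩ ⟨g, hg, rfl⟩
  have h2 : χ.evalL univ (Fin.append y ![h, g]) = 0 := h1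
  rw [hχ] at h2
  exact max_le_iff.1 h2.le

/-- Beautiful pairs of atomless lattices satisfy the axioms: elementarity gives the halving
property of `P(M)`, saturation over `P(M)` the relative one of `M`. -/
theorem IsBeautifulPair.pairAxioms [Nontrivial E] (hE : HasHalvings E) (hB : IsBeautifulPair P) :
    PairAxioms P where
  nonneg x := by rw [hB.1.2]; exact Metric.infDist_nonneg
  zero := le_of_eq hB.1.1.1.zero_mem
  neg x := by
    refine le_of_forall_pos_le_add fun ε hε => ?_
    obtain ⟨y, hy, hxy⟩ := hB.1.exists_dist_lt x hε
    refine (hB.1.le_dist _ (hB.1.1.1.neg_mem y hy)).trans (le_trans (le_of_eq ?_) hxy.le)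
    rw [Subtype.dist_eq, Subtype.dist_eq]
    exact dist_neg_neg x.1 y.1
  mid x y := by
    refine le_of_forall_pos_le_add fun ε hε => ?_
    obtain ⟨x', hx', hxx'⟩ := hB.1.exists_dist_lt x (ε := ε / 2) (by positivity)
    obtain ⟨y', hy', hyy'⟩ := hB.1.exists_dist_lt y (ε := ε / 2) (by positivity)
    refine (hB.1.le_dist _ (hB.1.1.1.mid_mem x' hx' y' hy')).trans ?_
    have h1 : Dist.dist (BLat.mid x y) (BLat.mid x' y') ≤ Dist.dist x x' + Dist.dist y y' := by
      rw [Subtype.dist_eq, Subtype.dist_eq, Subtype.dist_eq, dist_eq_norm, dist_eq_norm,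
        dist_eq_norm]
      show ‖(1 / 2 : ℝ) • (x.1 + y.1) - (1 / 2 : ℝ) • (x'.1 + y'.1)‖ ≤ _
      rw [← smul_sub, norm_smul, Real.norm_of_nonneg (by norm_num), add_sub_add_comm]
      have h2 := norm_add_le (x.1 - x'.1) (y.1 - y'.1)
      have h3 := norm_nonneg (x.1 - x'.1 + (y.1 - y'.1))
      linarith
    linarith
  abs x := by
    refine le_of_forall_pos_le_add fun ε hε => ?_
    obtain ⟨y, hy, hxy⟩ := hB.1.exists_dist_lt x hε
    refine (hB.1.le_dist _ (hB.1.1.1.abs_mem y hy)).trans (le_trans ?_ hxy.le)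
    rw [Subtype.dist_eq, Subtype.dist_eq, dist_eq_norm, dist_eq_norm]
    exact norm_abs_sub_abs x.1 y.1
  double x := hB.1.le_four_mul_mid x
  dist x ε hε := by
    obtain ⟨y, hy, hxy⟩ := hB.1.exists_dist_lt x hε
    exact ⟨y, (le_of_eq hy).trans hε.le, hxy.le⟩
  nontrivial ε hε := by
    obtain ⟨e, he⟩ := exists_ne (0 : E)
    obtain ⟨x, hx⟩ : ∃ x : UnitBall E, ‖x.1‖ = 1 := by
      refine ⟨⟨‖e‖⁻¹ • e, ?_⟩, ?_⟩ <;>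
      simp [norm_smul, inv_mul_cancel₀ (norm_ne_zero_iff.2 he)]
    by_contra! hcon
    have h1 : (Formula.sup (.norm (.var 0)) : Formula Empty 0).evalL (zeroSet P) Fin.elim0 ≤
        1 - ε := by
      refine (Formula.eval_sup_le_iff exists_bound_empty ⟨_, hB.1.1.1.zero_mem⟩ _).2
        fun x hx => ?_
      exact (hcon x ((le_of_eq hx).trans hε.le)).le
    rw [hB.1.1.2 0 _ _ fun i => i.elim0] at h1
    have h2 : ‖x.1‖ ≤ 1 - ε :=
      (Formula.eval_sup_le_iff exists_bound_empty ⟨zero, mem_univ _⟩ _).1 h1 x trivial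
    linarith
  halves h ε hε := by
    obtain ⟨h', hh', hd⟩ := hB.1.exists_dist_lt h (ε := ε / 8) (by positivity)
    obtain ⟨y, hy, hyd⟩ := hB.1.1.inf_le (n := 1) (.halving (.var 1) (.var 0))
      (v := fun _ => h') (fun _ => hh') (fun ε hε => by
        obtain ⟨y, hy, -⟩ := hE.exists_unitBall h' (m := 0) Fin.elim0 hε
        refine ⟨y, ?_⟩
        rw [Formula.evalL, Formula.eval_halving]
        exact hy) (ε := ε / 8) (by positivity)
    rw [Formula.evalL, Formula.eval_halving] at hyd
    have hyd' : halvingDefect h'.1 y.1 ≤ ε / 8 := hyd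
    refine ⟨y, (le_of_eq hy).trans hε.le, ?_⟩
    have h1 := halvingDefect_le h.1 y.1 h'.1 y.1
    rw [sub_self, norm_zero] at h1
    rw [Subtype.dist_eq, dist_eq_norm] at hd
    have h2 : 0 ≤ P h := by rw [hB.1.2]; exact Metric.infDist_nonneg
    linarith
  halvesOver h ε hε := by
    obtain ⟨y, hy⟩ := hB.exists_halvesOver hE h
    refine ⟨y, fun g => ?_⟩
    obtain ⟨g', hg', hd⟩ := hB.1.exists_dist_lt g (ε := ε / 8) (by positivity)
    obtain ⟨h1, h2⟩ := hy g' hg'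
    refine ⟨h1.trans hε.le, ?_⟩
    have h3 := truncatedDefect_le h.1 y.1 g.1 g'.1
    rw [Subtype.dist_eq, dist_eq_norm] at hd
    have h4 : 0 ≤ P g := by rw [hB.1.2]; exact Metric.infDist_nonneg
    linarith

end BLat

end Beautiful

/-! ### Models satisfy the axioms -/

section Axiomatization

open BLat

section Sup

variable {E : Type*} [NormedAddCommGroup E] [NormedSpace ℝ E] [Lattice E] [IsBanachLattice E]
  {P : UnitBall E → ℝ}

theorem exists_bound_of_lipschitzWith (hP : LipschitzWith 1 P) (_ : Unit) :
    ∃ C : ℝ, ∀ x, |P x| ≤ C := by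
  refine ⟨|P BLat.zero| + 1, fun x => ?_⟩
  have h1 := hP.dist_le_mul x BLat.zero
  have h2 : Dist.dist x BLat.zero ≤ 1 := by
    rw [Subtype.dist_eq]
    exact x.2
  rw [NNReal.coe_one, one_mul, Real.dist_eq] at h1
  have h3 := abs_sub_abs_le_abs_sub (P x) (P BLat.zero)
  linarith

theorem eval_sup_univ_le_iff (hP : LipschitzWith 1 P) {n : ℕ} (φ : Formula Unit (n + 1))
    {v : Fin n → UnitBall E} {c : ℝ} : φ.sup.eval univ (fun _ => P) v ≤ c ↔
      ∀ x, φ.eval univ (fun _ => P) (Fin.cons x v) ≤ c :=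
  (Formula.eval_sup_le_iff (exists_bound_of_lipschitzWith hP) ⟨BLat.zero, mem_univ _⟩ φ).trans
    ⟨fun h x => h x (mem_univ x), fun h x _ => h x⟩

theorem eval_inf_univ_le_iff (hP : LipschitzWith 1 P) {n : ℕ} (φ : Formula Unit (n + 1))
    {v : Fin n → UnitBall E} {c : ℝ} : φ.inf.eval univ (fun _ => P) v ≤ c ↔
      ∀ ε : ℝ, 0 < ε → ∃ x, φ.eval univ (fun _ => P) (Fin.cons x v) ≤ c + ε :=
  (Formula.eval_inf_le_iff (exists_bound_of_lipschitzWith hP) ⟨BLat.zero, mem_univ _⟩ φ).trans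
    ⟨fun h ε hε => (h ε hε).imp fun _ hx => hx.2,
      fun h ε hε => (h ε hε).imp fun x hx => ⟨mem_univ x, hx⟩⟩

theorem IsPAdditive.map {q : ℝ} {G : Type*} [NormedAddCommGroup G] [NormedSpace ℝ G]
    [Lattice G] [IsBanachLattice G] (L : BanachLatticeIso E G) (hG : IsPAdditive q G) :
    IsPAdditive q E where
  one_le := hG.one_le
  superadd x y hx hy := by
    rw [← L.norm_map x, ← L.norm_map y, ← L.norm_map (x + y), map_add]
    exact hG.superadd _ _ (L.map_nonneg hx) (L.map_nonneg hy)
  add_of_disjoint x y hx hy hxy := by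
    rw [← L.norm_map x, ← L.norm_map y, ← L.norm_map (x + y), map_add]
    refine hG.add_of_disjoint _ _ (L.map_nonneg hx) (L.map_nonneg hy) ?_
    rw [← L.map_inf, hxy, map_zero]

theorem BanachLatticeIso.isometry_ballMap {E F : Type*} [NormedAddCommGroup E] [NormedSpace ℝ E]
    [Lattice E] [NormedAddCommGroup F] [NormedSpace ℝ F] [Lattice F] (L : BanachLatticeIso E F) :
    Isometry L.ballMap := Isometry.of_dist_eq fun x y => by
  rw [Subtype.dist_eq, Subtype.dist_eq]
  exact L.toLinearIsometryEquiv.dist_map x.1 y.1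

end Sup

variable {p : ℝ≥0∞} [Fact (1 ≤ p)] {E : Type*} [NormedAddCommGroup E] [NormedSpace ℝ E]
  [Lattice E] [IsBanachLattice E] {P : UnitBall E → ℝ}

/-- A closed condition `σ ≤ 0` which follows from `PairAxioms` and `p`-additivity holds in all
models: it is expressed by the sentence `max σ 0`, which vanishes in all beautiful pairs. -/
theorem IsModelALpLP.eval_le_zero (hp : p ≠ ∞) (h : IsModelALpLP p P) (σ : Formula Unit 0)
    (hσ : ∀ (E' : Type) [NormedAddCommGroup E'] [NormedSpace ℝ E'] [Lattice E'] [IsBanachLattice E']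
      (P' : UnitBall E' → ℝ), LipschitzWith 1 P' → PairAxioms P' → IsPAdditive p.toReal E' →
      σ.eval univ (fun _ => P') Fin.elim0 ≤ 0) :
    σ.eval univ (fun _ => P) Fin.elim0 ≤ 0 := by
  have h1 : (Formula.conn ⟨fun v => max (v 0) 0, by fun_prop⟩ ![σ] : Formula Unit 0).eval univ
      (fun _ => P) Fin.elim0 = 0 := by
    refine h.2 _ fun E' _ _ _ _ P' hE' hB => ?_
    have hnt := hE'.1
    have hL : LipschitzWith 1 P' := by
      rw [show P' = fun x => Metric.infDist x (zeroSet P') from funext hB.1.2]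
      exact Metric.lipschitz_infDist_pt _
    have hadd : IsPAdditive p.toReal E' := by
      obtain ⟨-, Ω, _, μ, -, ⟨L⟩⟩ := hE'
      exact (isPAdditive_Lp hp).map L
    exact max_eq_right (hσ E' P' hL
      (hB.pairAxioms (HasHalvings.of_isAtomlessLpLattice hp hE')) hadd)
  exact (le_max_left _ _).trans (le_of_eq h1)

/-- Each axiom is a sentence: quantifiers over elements become suprema and infima, and an infimum at
most `0` means a solution up to every `ε > 0`. -/
theorem IsModelALpLP.pairAxioms (hp : p ≠ ∞) (h : IsModelALpLP p P) : PairAxioms P where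
  nonneg := by
    have h1 := (eval_sup_univ_le_iff h.1 _).1 <| h.eval_le_zero hp
      (.sup (.affine 0 (-1) 0 (.pred () (.var 0)) (.pred () (.var 0))))
      fun E' _ _ _ _ P' hP' hA _ => (eval_sup_univ_le_iff hP' _).2 fun x => by
        show 0 + -1 * P' x + 0 * P' x ≤ 0
        linarith [hA.nonneg x]
    intro x
    have h2 : 0 + -1 * P x + 0 * P x ≤ 0 := h1 x
    linarith
  zero := h.eval_le_zero hp (.pred () .zero) fun E' _ _ _ _ P' _ hA _ => hA.zero
  neg := by
    have h1 := (eval_sup_univ_le_iff h.1 _).1 <| h.eval_le_zero hp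
      (.sup (.affine 0 1 (-1) (.pred () (.neg (.var 0))) (.pred () (.var 0))))
      fun E' _ _ _ _ P' hP' hA _ => (eval_sup_univ_le_iff hP' _).2 fun x => by
        show 0 + 1 * P' (BLat.neg x) + -1 * P' x ≤ 0
        linarith [hA.neg x]
    intro x
    have h2 : 0 + 1 * P (BLat.neg x) + -1 * P x ≤ 0 := h1 x
    linarith
  mid := by
    have h1 := (eval_sup_univ_le_iff h.1 _).1 <| h.eval_le_zero hp
      (.sup (.sup (.affine 0 1 (-1) (.pred () (.mid (.var 1) (.var 0)))
        (.affine 0 1 1 (.pred () (.var 1)) (.pred () (.var 0))))))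
      fun E' _ _ _ _ P' hP' hA _ => (eval_sup_univ_le_iff hP' _).2 fun x =>
        (eval_sup_univ_le_iff hP' _).2 fun y => by
          show 0 + 1 * P' (BLat.mid x y) + -1 * (0 + 1 * P' x + 1 * P' y) ≤ 0
          linarith [hA.mid x y]
    intro x y
    have h2 : 0 + 1 * P (BLat.mid x y) + -1 * (0 + 1 * P x + 1 * P y) ≤ 0 :=
      (eval_sup_univ_le_iff h.1 _).1 (h1 x) y
    linarith
  abs := by
    have h1 := (eval_sup_univ_le_iff h.1 _).1 <| h.eval_le_zero hp
      (.sup (.affine 0 1 (-1) (.pred () (.abs (.var 0))) (.pred () (.var 0))))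
      fun E' _ _ _ _ P' hP' hA _ => (eval_sup_univ_le_iff hP' _).2 fun x => by
        show 0 + 1 * P' (BLat.abs x) + -1 * P' x ≤ 0
        linarith [hA.abs x]
    intro x
    have h2 : 0 + 1 * P (BLat.abs x) + -1 * P x ≤ 0 := h1 x
    linarith
  double := by
    have h1 := (eval_sup_univ_le_iff h.1 _).1 <| h.eval_le_zero hp
      (.sup (.affine 0 1 (-4) (.pred () (.var 0)) (.pred () (.mid (.var 0) .zero))))
      fun E' _ _ _ _ P' hP' hA _ => (eval_sup_univ_le_iff hP' _).2 fun x => by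
        show 0 + 1 * P' x + -4 * P' (BLat.mid x BLat.zero) ≤ 0
        linarith [hA.double x]
    intro x
    have h2 : 0 + 1 * P x + -4 * P (BLat.mid x BLat.zero) ≤ 0 := h1 x
    linarith
  dist := by
    have h1 := (eval_sup_univ_le_iff h.1 _).1 <| h.eval_le_zero hp
      (.sup (.inf (.maxOf (.pred () (.var 0))
        (.affine 0 1 (-1) (.dist (.var 1) (.var 0)) (.pred () (.var 1))))))
      fun E' _ _ _ _ P' hP' hA _ => (eval_sup_univ_le_iff hP' _).2 fun x =>
        (eval_inf_univ_le_iff hP' _).2 fun ε hε => by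
          obtain ⟨y, hy1, hy2⟩ := hA.dist x ε hε
          refine ⟨y, ?_⟩
          show max (P' y) (0 + 1 * Dist.dist x y + -1 * P' x) ≤ 0 + ε
          exact max_le (by linarith) (by linarith)
    intro x ε hε
    obtain ⟨y, hy⟩ := (eval_inf_univ_le_iff h.1 _).1 (h1 x) ε hε
    have h2 : max (P y) (0 + 1 * Dist.dist x y + -1 * P x) ≤ 0 + ε := hy
    obtain ⟨h3, h4⟩ := max_le_iff.1 h2
    exact ⟨y, by linarith, by linarith⟩
  nontrivial := by
    have h1 := (eval_inf_univ_le_iff h.1 _).1 <| h.eval_le_zero hp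
      (.inf (.maxOf (.pred () (.var 0)) (.affine 1 (-1) 0 (.norm (.var 0)) (.norm (.var 0)))))
      fun E' _ _ _ _ P' hP' hA _ => (eval_inf_univ_le_iff hP' _).2 fun ε hε => by
        obtain ⟨x, hx1, hx2⟩ := hA.nontrivial ε hε
        refine ⟨x, ?_⟩
        show max (P' x) (1 + -1 * ‖x.1‖ + 0 * ‖x.1‖) ≤ 0 + ε
        exact max_le (by linarith) (by linarith)
    intro ε hε
    obtain ⟨x, hx⟩ := h1 ε hε
    have h2 : max (P x) (1 + -1 * ‖x.1‖ + 0 * ‖x.1‖) ≤ 0 + ε := hx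
    obtain ⟨h3, h4⟩ := max_le_iff.1 h2
    exact ⟨x, by linarith, by linarith⟩
  halves := by
    have h1 := (eval_sup_univ_le_iff h.1 _).1 <| h.eval_le_zero hp
      (.sup (.inf (.maxOf (.pred () (.var 0))
        (.affine 0 1 (-10) (.halving (.var 1) (.var 0)) (.pred () (.var 1))))))
      fun E' _ _ _ _ P' hP' hA _ => (eval_sup_univ_le_iff hP' _).2 fun x =>
        (eval_inf_univ_le_iff hP' _).2 fun ε hε => by
          obtain ⟨y, hy1, hy2⟩ := hA.halves x ε hε
          refine ⟨y, ?_⟩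
          rw [Formula.eval_maxOf, Formula.eval_affine, Formula.eval_halving]
          show max (P' y) (0 + 1 * halvingDefect x.1 y.1 + -10 * P' x) ≤ 0 + ε
          exact max_le (by linarith) (by linarith)
    intro x ε hε
    obtain ⟨y, hy⟩ := (eval_inf_univ_le_iff h.1 _).1 (h1 x) ε hε
    rw [Formula.eval_maxOf, Formula.eval_affine, Formula.eval_halving] at hy
    have h2 : max (P y) (0 + 1 * halvingDefect x.1 y.1 + -10 * P x) ≤ 0 + ε := hy
    obtain ⟨h3, h4⟩ := max_le_iff.1 h2
    exact ⟨y, by linarith, by linarith⟩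
  halvesOver := by
    have h1 := (eval_sup_univ_le_iff h.1 _).1 <| h.eval_le_zero hp
      (.sup (.inf (.sup (.maxOf (.halving (.var 2) (.var 1))
        (.affine 0 1 (-10) (.truncated (.var 2) (.var 1) (.var 0)) (.pred () (.var 0)))))))
      fun E' _ _ _ _ P' hP' hA _ => (eval_sup_univ_le_iff hP' _).2 fun x =>
        (eval_inf_univ_le_iff hP' _).2 fun ε hε => by
          obtain ⟨y, hy⟩ := hA.halvesOver x ε hε
          refine ⟨y, (eval_sup_univ_le_iff hP' _).2 fun g => ?_⟩
          obtain ⟨hy1, hy2⟩ := hy g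
          rw [Formula.eval_maxOf, Formula.eval_affine, Formula.eval_halving, Formula.eval_truncated]
          show max (halvingDefect x.1 y.1)
            (0 + 1 * truncatedDefect x.1 y.1 g.1 + -10 * P' g) ≤ 0 + ε
          exact max_le (by linarith) (by linarith)
    intro x ε hε
    obtain ⟨y, hy⟩ := (eval_inf_univ_le_iff h.1 _).1 (h1 x) ε hε
    refine ⟨y, fun g => ?_⟩
    have h2 := (eval_sup_univ_le_iff h.1 _).1 hy g
    rw [Formula.eval_maxOf, Formula.eval_affine, Formula.eval_halving,
      Formula.eval_truncated] at h2
    have h3 : max (halvingDefect x.1 y.1)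
      (0 + 1 * truncatedDefect x.1 y.1 g.1 + -10 * P g) ≤ 0 + ε := h2
    obtain ⟨h4, h5⟩ := max_le_iff.1 h3
    exact ⟨by linarith, by linarith⟩

theorem continuous_rpow_coord {q : ℝ} (hq : 0 ≤ q) {m : ℕ} (i : Fin m) :
    Continuous fun v : Fin m → ℝ => v i ^ q :=
  (continuous_apply i).rpow_const fun _ => Or.inr hq

/-- Two sentences express `p`-additivity: superadditivity for the elements `|x| / 2` and `|y| / 2`,
and `‖x⁺‖ ^ p + ‖x⁻‖ ^ p = ‖x‖ ^ p`. Disjoint positive elements `x` and `y` are the positive and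
negative part of `x - y`. -/
theorem IsModelALpLP.isPAdditive (hp : p ≠ ∞) (h : IsModelALpLP p P) :
    IsPAdditive p.toReal E := by
  have hq := toReal_pos_of_fact hp
  have h1 : ∀ x y : UnitBall E, ‖(1 / 2 : ℝ) • (|x.1| + 0)‖ ^ p.toReal +
      ‖(1 / 2 : ℝ) • (|y.1| + 0)‖ ^ p.toReal - ‖(1 / 2 : ℝ) • (|x.1| + |y.1|)‖ ^ p.toReal ≤ 0 := by
    have h1 := (eval_sup_univ_le_iff h.1 _).1 <| h.eval_le_zero hp
      (.sup (.sup (.conn ⟨fun v => v 0 ^ p.toReal + v 1 ^ p.toReal - v 2 ^ p.toReal,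
        ((continuous_rpow_coord hq.le 0).add (continuous_rpow_coord hq.le 1)).sub
          (continuous_rpow_coord hq.le 2)⟩
        ![.norm (.mid (.abs (.var 1)) .zero), .norm (.mid (.abs (.var 0)) .zero),
          .norm (.mid (.abs (.var 1)) (.abs (.var 0)))])))
      fun E' _ _ _ _ P' hP' _ hA => (eval_sup_univ_le_iff hP' _).2 fun x =>
        (eval_sup_univ_le_iff hP' _).2 fun y => by
          show ‖(1 / 2 : ℝ) • (|x.1| + 0)‖ ^ p.toReal + ‖(1 / 2 : ℝ) • (|y.1| + 0)‖ ^ p.toReal -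
            ‖(1 / 2 : ℝ) • (|x.1| + |y.1|)‖ ^ p.toReal ≤ 0
          have h2 := hA.superadd ((1 / 2 : ℝ) • |x.1|) ((1 / 2 : ℝ) • |y.1|)
            (smul_nonneg (by norm_num) (abs_nonneg _)) (smul_nonneg (by norm_num) (abs_nonneg _))
          rw [add_zero, add_zero, smul_add]
          linarith
    exact fun x y => (eval_sup_univ_le_iff h.1 _).1 (h1 x) y
  have h2 : ∀ x : UnitBall E, |‖(1 / 2 : ℝ) • (x.1 + |x.1|)‖ ^ p.toReal +
      ‖(1 / 2 : ℝ) • (-x.1 + |x.1|)‖ ^ p.toReal - ‖x.1‖ ^ p.toReal| ≤ 0 := by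
    refine (eval_sup_univ_le_iff h.1 _).1 <| h.eval_le_zero hp
      (.sup (.conn ⟨fun v => |v 0 ^ p.toReal + v 1 ^ p.toReal - v 2 ^ p.toReal|,
        (((continuous_rpow_coord hq.le 0).add (continuous_rpow_coord hq.le 1)).sub
          (continuous_rpow_coord hq.le 2)).abs⟩
        ![.norm (.mid (.var 0) (.abs (.var 0))), .norm (.mid (.neg (.var 0)) (.abs (.var 0))),
          .norm (.var 0)]))
      fun E' _ _ _ _ P' hP' _ hA => (eval_sup_univ_le_iff hP' _).2 fun x => ?_
    show |‖(1 / 2 : ℝ) • (x.1 + |x.1|)‖ ^ p.toReal +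
      ‖(1 / 2 : ℝ) • (-x.1 + |x.1|)‖ ^ p.toReal - ‖x.1‖ ^ p.toReal| ≤ 0
    have e1 : (1 / 2 : ℝ) • (x.1 + |x.1|) = x.1⁺ := by
      rw [posPart_def, sup_eq_half_smul, add_zero, sub_zero]
    have e2 : (1 / 2 : ℝ) • (-x.1 + |x.1|) = x.1⁻ := by
      rw [negPart_def, sup_eq_half_smul, add_zero, sub_zero, abs_neg]
    rw [e1, e2, ← hA.add_of_disjoint _ _ (posPart_nonneg _) (negPart_nonneg _)
      (posPart_inf_negPart_eq_zero _), posPart_add_negPart, norm_abs_eq_norm, sub_self, abs_zero]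
  -- both laws are homogeneous
  refine ⟨(isPAdditive_Lp (μ := (volume : Measure ℝ)) hp).one_le, fun x y hx hy => ?_,
    fun x y hx hy hxy => ?_⟩
  · obtain ⟨t, ht, hxt, hyt⟩ : ∃ t : ℝ, 0 < t ∧ ‖x‖ ≤ t ∧ ‖y‖ ≤ t :=
      ⟨‖x‖ + ‖y‖ + 1, by positivity, by linarith [norm_nonneg y], by linarith [norm_nonneg x]⟩
    obtain ⟨x', rfl⟩ := PairAxioms.exists_smul_mem_unitBall x ht hxt
    obtain ⟨y', rfl⟩ := PairAxioms.exists_smul_mem_unitBall y ht hyt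
    have hx' : 0 ≤ x'.1 := by
      have := smul_nonneg (inv_pos.2 ht).le hx
      rwa [inv_smul_smul₀ ht.ne'] at this
    have hy' : 0 ≤ y'.1 := by
      have := smul_nonneg (inv_pos.2 ht).le hy
      rwa [inv_smul_smul₀ ht.ne'] at this
    have h3 := h1 x' y'
    rw [abs_of_nonneg hx', abs_of_nonneg hy', add_zero, add_zero, norm_smul, norm_smul, norm_smul,
      Real.mul_rpow (norm_nonneg _) (norm_nonneg _), Real.mul_rpow (norm_nonneg _) (norm_nonneg _),
      Real.mul_rpow (norm_nonneg _) (norm_nonneg _), ← mul_add, ← mul_sub] at h3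
    have h4 : 0 < ‖(1 / 2 : ℝ)‖ ^ p.toReal := Real.rpow_pos_of_pos (by norm_num) _
    have h5 : ‖x'.1‖ ^ p.toReal + ‖y'.1‖ ^ p.toReal ≤ ‖x'.1 + y'.1‖ ^ p.toReal := by
      nlinarith
    rw [← smul_add, norm_smul, norm_smul, norm_smul, Real.mul_rpow (norm_nonneg _) (norm_nonneg _),
      Real.mul_rpow (norm_nonneg _) (norm_nonneg _), Real.mul_rpow (norm_nonneg _) (norm_nonneg _),
      ← mul_add]
    exact mul_le_mul_of_nonneg_left h5 (Real.rpow_nonneg (norm_nonneg _) _)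
  · obtain ⟨t, ht, hxt⟩ : ∃ t : ℝ, 0 < t ∧ ‖x - y‖ ≤ t :=
      ⟨‖x - y‖ + 1, by positivity, by linarith⟩
    obtain ⟨z, hz⟩ := PairAxioms.exists_smul_mem_unitBall (x - y) ht hxt
    have habs : |x - y| = x + y := by
      have h3 := inf_eq_half_smul x y
      rw [hxy, eq_comm, smul_eq_zero_iff_right (by norm_num), sub_eq_zero] at h3
      exact h3.symm
    have e0 : z.1 = t⁻¹ • (x - y) := by rw [hz, inv_smul_smul₀ ht.ne']
    have e1 : (1 / 2 : ℝ) • (z.1 + |z.1|) = t⁻¹ • x := by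
      rw [e0, abs_smul_eq, abs_of_pos (inv_pos.2 ht), habs, ← smul_add, sub_add_add_cancel,
        ← two_smul ℝ x, smul_smul, smul_smul]
      congr 1; ring
    have e2 : (1 / 2 : ℝ) • (-z.1 + |z.1|) = t⁻¹ • y := by
      rw [e0, abs_smul_eq, abs_of_pos (inv_pos.2 ht), habs, ← smul_neg, ← smul_add, neg_sub,
        add_comm x y, sub_add_add_cancel, ← two_smul ℝ y, smul_smul, smul_smul]
      congr 1; ring
    have h3 := abs_nonpos_iff.1 (h2 z)
    have e3 : ‖z.1‖ = ‖t⁻¹ • (x + y)‖ := by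
      rw [e0, ← habs, norm_smul, norm_smul, norm_abs_eq_norm]
    rw [e1, e2, e3, norm_smul, norm_smul, norm_smul,
      Real.mul_rpow (norm_nonneg _) (norm_nonneg _), Real.mul_rpow (norm_nonneg _) (norm_nonneg _),
      Real.mul_rpow (norm_nonneg _) (norm_nonneg _), ← mul_add, ← mul_sub, mul_eq_zero] at h3
    have h4 : 0 < ‖t⁻¹‖ ^ p.toReal := Real.rpow_pos_of_pos (norm_pos_iff.2 (inv_pos.2 ht).ne') _
    linarith [h3.resolve_left h4.ne']

/-- Separable models are the two standard pairs. -/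
theorem IsModelALpLP.exists_iso_rectMeasure [TopologicalSpace.SeparableSpace E] (hp : p ≠ ∞)
    (h : IsModelALpLP p P) : ∃ a : ℝ, (a = 1 ∨ a = 2) ∧
      ∃ L : BanachLatticeIso E (Lp ℝ p (rectMeasure a)),
        ∀ x, P x = Metric.infDist (L.ballMap x) (baseBall p a) := by
  have hA := h.pairAxioms hp
  obtain ⟨F, hFc, hF⟩ := hA.exists_isClosedSublattice h.1.continuous
  obtain ⟨a, ha, L, hL⟩ := (h.isPAdditive hp).exists_iso_rectMeasure hp hFc (hA.ne_bot h.1 hF)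
    (hA.halves_sublattice h.1 hFc hF) (hA.halvesOver_sublattice hF)
  refine ⟨a, ha, L, fun x => ?_⟩
  have himage : L.ballMap '' zeroSet P = baseBall p a := by
    ext y
    constructor
    · rintro ⟨x, hx, rfl⟩
      exact (hL x.1).1 ((hF x).1 hx)
    · intro hy
      refine ⟨L.symm.ballMap y, (hF _).2 ((hL _).2 ?_), Subtype.ext (L.apply_symm_apply y.1)⟩
      have := L.apply_symm_apply y.1
      show IsBaseFunction (L.toLinearIsometryEquiv (L.symm.toLinearIsometryEquiv y.1))
      rw [this]
      exact hy
  rw [hA.eq_infDist h.1, ← himage, Metric.infDist_image L.isometry_ballMap]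

end Axiomatization

/-! ### The rescaling isomorphism -/

section Rescaling

/-- The affine map from `[d, d + c]` onto the unit interval. -/
theorem isMeasureIso_affine {c : ℝ} (hc : 0 < c) (d : ℝ) :
    IsMeasureIso (ENNReal.ofReal c⁻¹ • (volume : Measure ℝ).restrict (Icc d (d + c))) unitLeb
      (fun y => (y - d) / c) (fun u => c * u + d) := by
  have hm : Measurable fun y : ℝ => (y - d) / c := (measurable_id.sub_const d).div_const c
  refine ⟨hm, (measurable_id.const_mul c).add_const d, ?_, Eventually.of_forall fun y => ?_⟩
  · have hpre : (fun y : ℝ => (y - d) / c) ⁻¹' Icc 0 1 = Icc d (d + c) := by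
      ext y
      simp only [mem_preimage, mem_Icc, le_div_iff₀ hc, div_le_iff₀ hc]
      constructor <;> rintro ⟨h1, h2⟩ <;> constructor <;> linarith
    have hvol : ENNReal.ofReal c⁻¹ • (volume : Measure ℝ).map (fun y : ℝ => (y - d) / c) =
        volume := by
      have e1 : (fun y : ℝ => (y - d) / c) = (fun y => c⁻¹ * y) ∘ (fun y => y + -d) := by
        funext y; simp only [Function.comp_apply]; rw [div_eq_inv_mul, sub_eq_add_neg]
      have e2 := Real.smul_map_volume_mul_left (a := c⁻¹) (inv_pos.2 hc).ne'
      rw [abs_of_pos (inv_pos.2 hc)] at e2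
      rw [e1, ← Measure.map_map (measurable_const_mul _) (measurable_add_const _),
        map_add_right_eq_self, e2]
    rw [Measure.map_smul, ← hpre, ← Measure.restrict_map hm measurableSet_Icc,
      ← Measure.restrict_smul, hvol]
  · show c * ((y - d) / c) + d = y
    field_simp; ring

theorem isMeasureIso_shift :
    IsMeasureIso unitLeb ((volume : Measure ℝ).restrict (Ioc 1 2)) (fun x => x + 1)
      (fun x => x - 1) := by
  refine ⟨measurable_add_const _, measurable_sub_const _, ?_, Eventually.of_forall fun y => ?_⟩
  · have hpre : (fun x : ℝ => x + 1) ⁻¹' Ioc 1 2 = Ioc 0 1 := by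
      ext y
      simp only [mem_preimage, mem_Ioc]
      constructor <;> rintro ⟨h1, h2⟩ <;> constructor <;> linarith
    rw [unitLeb, ← Measure.restrict_congr_set (Ioc_ae_eq_Icc (μ := volume)), ← hpre,
      ← Measure.restrict_map (measurable_add_const _) measurableSet_Ioc, map_add_right_eq_self]
  · show y + 1 - 1 = y
    ring

theorem IsMeasureIso.prod {Ω Ω' X X' : Type*} [MeasurableSpace Ω] [MeasurableSpace Ω']
    [MeasurableSpace X] [MeasurableSpace X'] {μ : Measure Ω} {ν : Measure Ω'} {μ' : Measure X}
    {ν' : Measure X'} [SFinite μ] [SFinite μ'] {τ : Ω → Ω'} {σ : Ω' → Ω} {τ' : X → X'}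
    {σ' : X' → X} (h : IsMeasureIso μ ν τ σ) (h' : IsMeasureIso μ' ν' τ' σ') :
    IsMeasureIso (μ.prod μ') (ν.prod ν') (Prod.map τ τ') (Prod.map σ σ') := by
  refine ⟨h.measurable_map.prodMap h'.measurable_map, h.measurable_inv.prodMap h'.measurable_inv,
    ?_, ?_⟩
  · rw [← Measure.map_prod_map _ _ h.measurable_map h'.measurable_map, h.map_eq, h'.map_eq]
  · filter_upwards [Measure.quasiMeasurePreserving_fst.ae h.left_inv,
      Measure.quasiMeasurePreserving_snd.ae h'.left_inv] with z h1 h2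
    exact Prod.ext h1 h2

variable {p : ℝ≥0∞} [Fact (1 ≤ p)]

/-- The map underlying the rescaling isomorphism. -/
def rescaleMap (r : ℝ) (z : ℝ × ℝ) : ℝ × ℝ :=
  if r ≤ z.2 then (z.1, (z.2 - r) / (1 - r)) else (z.1 + 1, z.2 / r)

/-- The weight of the rescaling isomorphism. -/
def rescaleWeight (p : ℝ≥0∞) (r : ℝ) (z : ℝ × ℝ) : ℝ :=
  if r ≤ z.2 then (1 - r) ^ (-(1 / p.toReal)) else r ^ (-(1 / p.toReal))

theorem ofReal_rpow_neg_rpow {q : ℝ} (hq : 0 < q) {c : ℝ} (hc : 0 < c) :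
    ENNReal.ofReal ((c ^ (-(1 / q))) ^ q) = ENNReal.ofReal c⁻¹ := by
  rw [← Real.rpow_mul hc.le, neg_mul, one_div_mul_cancel hq.ne', Real.rpow_neg_one]

theorem unitLeb_eq_add {r : ℝ} (h0 : 0 < r) (h1 : r < 1) :
    unitLeb = (volume : Measure ℝ).restrict (Icc r 1) + volume.restrict (Ico 0 r) := by
  have h : (Icc 0 1 : Set ℝ) = Icc r 1 ∪ Ico 0 r := by
    rw [union_comm, Ico_union_Icc_eq_Icc h0.le h1.le]
  have hd : Disjoint (Icc r 1 : Set ℝ) (Ico 0 r) :=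
    disjoint_left.2 fun x h1 h2 => (h2.2.trans_le h1.1).false
  rw [unitLeb, h, Measure.restrict_union hd measurableSet_Ico]

/-- The parts `y ≥ r` and `y < r` of the unit square are stretched onto the two squares of the
rectangle; the `p`-th powers of the weights are the factors by which the measure is multiplied. -/
theorem exists_isWeightedIso_rescale (hp : p ≠ ∞) {r : ℝ} (h0 : 0 < r) (h1 : r < 1) :
    ∃ σ, IsWeightedIso p (rectMeasure 1) (rectMeasure 2) (rescaleMap r) (rescaleWeight p r) σ := by
  classical
  have hq := toReal_pos_of_fact hp
  have hr : 0 < 1 - r := sub_pos.2 h1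
  have hid : IsMeasureIso unitLeb unitLeb (fun x => x) (fun x => x) :=
    ⟨measurable_id, measurable_id, Measure.map_id, Eventually.of_forall fun _ => rfl⟩
  have k₁ := hid.prod (isMeasureIso_affine hr r)
  have k₂ := isMeasureIso_shift.prod (isMeasureIso_affine h0 0)
  rw [add_sub_cancel, Measure.prod_smul_right, ← rectMeasure_eq_prod 1] at k₁
  rw [zero_add, ← Measure.restrict_congr_set (Ico_ae_eq_Icc (μ := volume)),
    Measure.prod_smul_right] at k₂
  have hS : MeasurableSet {z : ℝ × ℝ | r ≤ z.2} := measurableSet_le measurable_const measurable_snd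
  have hT : MeasurableSet {z : ℝ × ℝ | z.1 ≤ 1} := measurableSet_le measurable_fst measurable_const
  have hS₁ : ∀ᵐ z ∂(unitLeb.prod ((volume : Measure ℝ).restrict (Icc r 1))), r ≤ z.2 := by
    refine Measure.quasiMeasurePreserving_snd.ae (p := fun y => r ≤ y) ?_
    filter_upwards [ae_restrict_mem measurableSet_Icc] with y hy using hy.1
  have hS₂ : ∀ᵐ z ∂(unitLeb.prod ((volume : Measure ℝ).restrict (Ico 0 r))), ¬ r ≤ z.2 := by
    refine Measure.quasiMeasurePreserving_snd.ae (p := fun y => ¬ r ≤ y) ?_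
    filter_upwards [ae_restrict_mem measurableSet_Ico] with y hy using not_le.2 hy.2
  have hglue := k₁.glue k₂ (S := {z | r ≤ z.2}) (T := {z | z.1 ≤ 1}) hS hT
    (Measure.ae_smul_measure hS₁ _) (Measure.ae_smul_measure hS₂ _) ae_rectMeasure_one_le
    ae_rightMeasure_not_le
  rw [← rightMeasure, ← rectMeasure_two] at hglue
  have hwm : Measurable (rescaleWeight p r) := Measurable.ite hS measurable_const measurable_const
  have hw0 : ∀ z, 0 < rescaleWeight p r z := fun z => by
    rw [rescaleWeight]
    split_ifs
    exacts [Real.rpow_pos_of_pos hr _, Real.rpow_pos_of_pos h0 _]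
  have hdens : ((rectMeasure 1).withDensity fun z =>
      ENNReal.ofReal (rescaleWeight p r z ^ p.toReal)) =
      ENNReal.ofReal (1 - r)⁻¹ • unitLeb.prod ((volume : Measure ℝ).restrict (Icc r 1)) +
        ENNReal.ofReal r⁻¹ • unitLeb.prod ((volume : Measure ℝ).restrict (Ico 0 r)) := by
    have hsum : rectMeasure 1 = unitLeb.prod ((volume : Measure ℝ).restrict (Icc r 1)) +
        unitLeb.prod ((volume : Measure ℝ).restrict (Ico 0 r)) := by
      rw [← Measure.prod_add, ← unitLeb_eq_add h0 h1]
      exact rectMeasure_eq_prod 1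
    rw [hsum, withDensity_add_measure]
    congr 1
    · rw [← withDensity_const]
      refine withDensity_congr_ae ?_
      filter_upwards [hS₁] with z hz
      rw [rescaleWeight, if_pos hz, ofReal_rpow_neg_rpow hq hr]
    · rw [← withDensity_const]
      refine withDensity_congr_ae ?_
      filter_upwards [hS₂] with z hz
      rw [rescaleWeight, if_neg hz, ofReal_rpow_neg_rpow hq h0]
  rw [← hdens] at hglue
  have hτ : rescaleMap r = piecewise {z : ℝ × ℝ | r ≤ z.2}
      (Prod.map (fun x => x) fun y => (y - r) / (1 - r))
      (Prod.map (fun x => x + 1) fun y => (y - 0) / r) := by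
    funext z
    by_cases hz : r ≤ z.2
    · rw [piecewise_eq_of_mem _ _ _ (show z ∈ {z : ℝ × ℝ | r ≤ z.2} from hz), rescaleMap,
        if_pos hz]
      rfl
    · rw [piecewise_eq_of_notMem _ _ _ (show z ∉ {z : ℝ × ℝ | r ≤ z.2} from hz), rescaleMap,
        if_neg hz]
      simp [Prod.map]
  rw [← hτ] at hglue
  exact ⟨_, hglue.toWeighted hwm hw0⟩

/-- The rescaling isomorphism from `L_p([0, 2] × [0, 1])` onto `L_p([0, 1] × [0, 1])`. -/
def rescaleIso (hp : p ≠ ∞) {r : ℝ} (h0 : 0 < r) (h1 : r < 1) :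
    BanachLatticeIso (Lp ℝ p (rectMeasure 2)) (Lp ℝ p (rectMeasure 1)) :=
  (exists_isWeightedIso_rescale hp h0 h1).choose_spec.toIso hp

theorem rescaleIso_coeFn (hp : p ≠ ∞) {r : ℝ} (h0 : 0 < r) (h1 : r < 1)
    (f : Lp ℝ p (rectMeasure 2)) : ∀ᵐ z ∂(rectMeasure 1),
      (rescaleIso hp h0 h1).toLinearIsometryEquiv f z =
        if r ≤ z.2 then (1 - r) ^ (-(1 / p.toReal)) * f (z.1, (z.2 - r) / (1 - r))
        else r ^ (-(1 / p.toReal)) * f (z.1 + 1, z.2 / r) := by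
  filter_upwards [(exists_isWeightedIso_rescale hp h0 h1).choose_spec.toIso_coeFn hp f] with z hz
  rw [rescaleIso, hz, rescaleWeight, rescaleMap]
  split_ifs <;> rfl

/-- By Fubini, restriction of a function of the first coordinate to a strip multiplies the norm by
the `p`-th root of the width. -/
theorem norm_indicatorL_snd (hp : p ≠ ∞) {f : Lp ℝ p (rectMeasure 1)} {g : ℝ → ℝ}
    (hg : Measurable g) (hf : ∀ᵐ z ∂(rectMeasure 1), f z = g z.1) {S : Set ℝ}
    (hS : MeasurableSet S) :
    ‖indicatorL p (rectMeasure 1) (measurable_snd hS) f‖ =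
      (unitLeb.real S) ^ (1 / p.toReal) * ‖f‖ := by
  have hq := toReal_pos_of_fact hp
  have key : ∀ T, MeasurableSet T → ∫⁻ z in Prod.snd ⁻¹' T, ‖f z‖ₑ ^ p.toReal ∂(rectMeasure 1) =
      unitLeb T * ∫⁻ x, ‖g x‖ₑ ^ p.toReal ∂unitLeb := fun T hT => by
    have hm : (rectMeasure 1).restrict (Prod.snd ⁻¹' T) = unitLeb.prod (unitLeb.restrict T) := by
      rw [rectMeasure_eq_prod, ← univ_prod, ← Measure.prod_restrict, Measure.restrict_univ]
    have hgm : Measurable fun x => ‖g x‖ₑ ^ p.toReal := hg.enorm.pow_const _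
    rw [lintegral_congr_ae (g := fun z => ‖g z.1‖ₑ ^ p.toReal) (ae_restrict_of_ae (by
        filter_upwards [hf] with z hz
        rw [hz])), hm, ← lintegral_map (f := fun x => ‖g x‖ₑ ^ p.toReal) hgm measurable_fst,
      Measure.map_fst_prod, lintegral_smul_measure, Measure.restrict_apply_univ, smul_eq_mul]
  have h1 := ofReal_norm_indicatorL_rpow hp (measurable_snd hS) f
  have h2 := ofReal_norm_rpow_eq_lintegral hp f
  have h3 : ∫⁻ z, ‖f z‖ₑ ^ p.toReal ∂(rectMeasure 1) = ∫⁻ x, ‖g x‖ₑ ^ p.toReal ∂unitLeb := by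
    have := key univ MeasurableSet.univ
    rwa [preimage_univ, Measure.restrict_univ, show unitLeb univ = 1 by simp [unitLeb],
      one_mul] at this
  rw [key S hS, ← h3, ← h2, ← ENNReal.ofReal_toReal (measure_ne_top unitLeb S),
    ← ENNReal.ofReal_mul ENNReal.toReal_nonneg,
    ENNReal.ofReal_eq_ofReal_iff (Real.rpow_nonneg (norm_nonneg _) _)
      (mul_nonneg ENNReal.toReal_nonneg (Real.rpow_nonneg (norm_nonneg _) _))] at h1
  refine (Real.rpow_left_inj (norm_nonneg _)
    (mul_nonneg (Real.rpow_nonneg measureReal_nonneg _) (norm_nonneg _)) hq.ne').1 ?_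
  rw [Real.mul_rpow (Real.rpow_nonneg measureReal_nonneg _) (norm_nonneg _),
    ← Real.rpow_mul measureReal_nonneg, one_div_mul_cancel hq.ne', Real.rpow_one]
  exact h1

theorem unitLeb_real_Ici {r : ℝ} (h0 : 0 < r) (h1 : r < 1) : unitLeb.real (Ici r) = 1 - r := by
  have : Ici r ∩ Icc 0 1 = Icc r 1 := by
    ext x; simp only [mem_inter_iff, mem_Ici, mem_Icc]
    constructor
    · rintro ⟨h, -, h'⟩; exact ⟨h, h'⟩
    · rintro ⟨h, h'⟩; exact ⟨h, h0.le.trans h, h'⟩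
  rw [measureReal_restrict_apply measurableSet_Ici, this, Real.volume_real_Icc_of_le h1.le]

theorem unitLeb_real_Iio {r : ℝ} (h0 : 0 < r) (h1 : r < 1) : unitLeb.real (Iio r) = r := by
  have : Iio r ∩ Icc 0 1 = Ico 0 r := by
    ext x; simp only [mem_inter_iff, mem_Iio, mem_Icc, mem_Ico]
    constructor
    · rintro ⟨h, h', -⟩; exact ⟨h', h⟩
    · rintro ⟨h', h⟩; exact ⟨h, h', (h.trans h1).le⟩
  rw [measureReal_restrict_apply measurableSet_Iio, this, Real.volume_real_Ico_of_le h0.le,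
    sub_zero]

/-- The rescaling isomorphism moves base functions by at most `ζ(r)`: it multiplies by
`(1 - r) ^ (-1 / p)` on a part of relative measure `1 - r` and is zero on the rest. -/
theorem norm_rescaleIso_sub_le (hp : p ≠ ∞) {r : ℝ} (h0 : 0 < r) (h1 : r < 1)
    {f : Lp ℝ p (rectMeasure 2)} {f' : Lp ℝ p (rectMeasure 1)} {g : ℝ → ℝ} (hg : Measurable g)
    (hf : ∀ᵐ z ∂(rectMeasure 2), f z = if z.1 ≤ 1 then g z.1 else 0)
    (hf' : ∀ᵐ z ∂(rectMeasure 1), f' z = if z.1 ≤ 1 then g z.1 else 0) :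
    ‖(rescaleIso hp h0 h1).toLinearIsometryEquiv f - f'‖ ≤ zetaBound p r * ‖f'‖ := by
  have hq := toReal_pos_of_fact hp
  have hr : 0 < 1 - r := sub_pos.2 h1
  have hf'' : ∀ᵐ z ∂(rectMeasure 1), f' z = g z.1 := by
    filter_upwards [hf', ae_rectMeasure_one_le] with z e1 e2
    rw [e1, if_pos e2]
  obtain ⟨σ, hσ⟩ := exists_isWeightedIso_rescale (p := p) hp h0 h1
  have hpos : ∀ᵐ z ∂(rectMeasure 1), 0 < z.1 := by
    rw [rectMeasure_eq_prod]
    refine Measure.quasiMeasurePreserving_fst.ae (p := fun x => 0 < x) ?_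
    filter_upwards [ae_unitLeb_mem_Ioo] with x hx using hx.1
  -- the difference of the image and `f'` is `c f'` for `y ≥ r` and `-f'` for `y < r`
  set c : ℝ := (1 - r) ^ (-(1 / p.toReal)) - 1 with hc
  have hc0 : 0 ≤ c := by
    rw [hc, sub_nonneg]
    exact Real.one_le_rpow_of_pos_of_le_one_of_nonpos hr (by linarith)
      (by rw [neg_nonpos]; positivity)
  have heq : (rescaleIso hp h0 h1).toLinearIsometryEquiv f - f' =
      c • indicatorL p (rectMeasure 1) (measurable_snd (measurableSet_Ici (a := r))) f' -
        indicatorL p (rectMeasure 1) (measurable_snd (measurableSet_Iio (a := r))) f' := by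
    apply Lp.ext
    filter_upwards [rescaleIso_coeFn hp h0 h1 f, hσ.quasiMeasurePreserving.ae hf, hf'',
      ae_rectMeasure_one_le, hpos,
      Lp.coeFn_sub ((rescaleIso hp h0 h1).toLinearIsometryEquiv f) f',
      Lp.coeFn_sub
        (c • indicatorL p (rectMeasure 1) (measurable_snd (measurableSet_Ici (a := r))) f')
        (indicatorL p (rectMeasure 1) (measurable_snd (measurableSet_Iio (a := r))) f'),
      Lp.coeFn_smul c
        (indicatorL p (rectMeasure 1) (measurable_snd (measurableSet_Ici (a := r))) f'),
      indicatorL_coeFn (measurable_snd (measurableSet_Ici (a := r))) f',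
      indicatorL_coeFn (measurable_snd (measurableSet_Iio (a := r))) f']
      with z e1 e2 e3 e4 e5 e6 e7 e8 e9 e10
    rw [e6, e7, Pi.sub_apply, Pi.sub_apply, e8, Pi.smul_apply, e9, e10, e1, smul_eq_mul]
    rw [rescaleMap] at e2
    by_cases hz : r ≤ z.2
    · rw [if_pos hz] at e2 ⊢
      rw [if_pos e4] at e2
      rw [e2, indicator_of_mem (show z ∈ Prod.snd ⁻¹' Ici r from hz),
        indicator_of_notMem (show z ∉ Prod.snd ⁻¹' Iio r from fun h => (not_lt.2 hz) h), e3, hc]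
      ring
    · rw [if_neg hz] at e2 ⊢
      rw [if_neg (by simp only; linarith)] at e2
      rw [e2, indicator_of_notMem (show z ∉ Prod.snd ⁻¹' Ici r from hz),
        indicator_of_mem (show z ∈ Prod.snd ⁻¹' Iio r from not_le.1 hz)]
      ring
  rw [heq]
  refine (norm_sub_le _ _).trans (le_of_eq ?_)
  rw [norm_smul, Real.norm_of_nonneg hc0, norm_indicatorL_snd hp hg hf'' measurableSet_Ici,
    norm_indicatorL_snd hp hg hf'' measurableSet_Iio, unitLeb_real_Ici h0 h1,
    unitLeb_real_Iio h0 h1, zetaBound]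
  have h2 : (1 - r) ^ (-(1 / p.toReal)) * (1 - r) ^ (1 / p.toReal) = 1 := by
    rw [← Real.rpow_add hr, neg_add_cancel, Real.rpow_zero]
  rw [hc]
  linear_combination ‖f'‖ * h2

theorem rectMeasure_two_restrict : (rectMeasure 2).restrict {z | z.1 ≤ 1} = rectMeasure 1 := by
  have h1 : (rectMeasure 1).restrict {z | z.1 ≤ 1} = rectMeasure 1 :=
    Measure.restrict_eq_self_of_ae_mem ae_rectMeasure_one_le
  have : rightMeasure.restrict {z | z.1 ≤ 1} = 0 :=
    Measure.restrict_eq_zero.2 (measure_eq_zero_iff_ae_notMem.2 ae_rightMeasure_not_le)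
  rw [rectMeasure_two, Measure.restrict_add, h1, this, add_zero]

/-- Base functions of the wide rectangle restrict to base functions of the square. -/
theorem exists_base_of_two (b : UnitBall (Lp ℝ p (rectMeasure 2))) (hb : b ∈ baseBall p 2) :
    ∃ g : ℝ → ℝ, Measurable g ∧ (∀ᵐ z ∂(rectMeasure 2), b.1 z = if z.1 ≤ 1 then g z.1 else 0) ∧
      ∃ b' : UnitBall (Lp ℝ p (rectMeasure 1)),
        ∀ᵐ z ∂(rectMeasure 1), b'.1 z = if z.1 ≤ 1 then g z.1 else 0 := by
  obtain ⟨g, hg, hbg⟩ := hb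
  have hle : rectMeasure 1 ≤ rectMeasure 2 := by
    rw [← rectMeasure_two_restrict]; exact Measure.restrict_le_self
  have hm : MemLp b.1 p (rectMeasure 1) := (Lp.memLp b.1).mono_measure hle
  refine ⟨g, hg, hbg, ⟨hm.toLp _, ?_⟩, ?_⟩
  · rw [mem_closedBall_zero_iff, Lp.norm_toLp]
    refine le_trans ?_ (mem_closedBall_zero_iff.1 b.2)
    rw [Lp.norm_def]
    exact ENNReal.toReal_mono (Lp.memLp b.1).2.ne (eLpNorm_mono_measure _ hle)
  · filter_upwards [hm.coeFn_toLp, Measure.absolutelyContinuous_of_le hle hbg] with z e1 e2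
    rw [e1, e2]

/-- Base functions of the square extend by zero to base functions of the wide rectangle. -/
theorem exists_base_of_one (b : UnitBall (Lp ℝ p (rectMeasure 1))) (hb : b ∈ baseBall p 1) :
    ∃ g : ℝ → ℝ, Measurable g ∧ (∀ᵐ z ∂(rectMeasure 1), b.1 z = if z.1 ≤ 1 then g z.1 else 0) ∧
      ∃ b' : UnitBall (Lp ℝ p (rectMeasure 2)),
        ∀ᵐ z ∂(rectMeasure 2), b'.1 z = if z.1 ≤ 1 then g z.1 else 0 := by
  obtain ⟨g, hg, hbg⟩ := hb
  have hS : MeasurableSet {z : ℝ × ℝ | z.1 ≤ 1} := measurableSet_le measurable_fst measurable_const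
  have hm : MemLp ({z : ℝ × ℝ | z.1 ≤ 1}.indicator b.1) p (rectMeasure 2) := by
    rw [memLp_indicator_iff_restrict hS, rectMeasure_two_restrict]
    exact Lp.memLp b.1
  refine ⟨g, hg, hbg, ⟨hm.toLp _, ?_⟩, ?_⟩
  · rw [mem_closedBall_zero_iff, Lp.norm_toLp, eLpNorm_indicator_eq_eLpNorm_restrict hS,
      rectMeasure_two_restrict, ← Lp.norm_def]
    exact mem_closedBall_zero_iff.1 b.2
  · have hbg' : ∀ᵐ z ∂((rectMeasure 2).restrict {z | z.1 ≤ 1}),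
        b.1 z = if z.1 ≤ 1 then g z.1 else 0 := by rw [rectMeasure_two_restrict]; exact hbg
    filter_upwards [hm.coeFn_toLp, (ae_restrict_iff' hS).1 hbg'] with z e1 e2
    rw [e1]
    by_cases hz : z.1 ≤ 1
    · rw [indicator_of_mem (show z ∈ {z : ℝ × ℝ | z.1 ≤ 1} from hz), e2 hz]
    · rw [indicator_of_notMem (show z ∉ {z : ℝ × ℝ | z.1 ≤ 1} from hz), if_neg hz]

theorem zero_mem_baseBall (a : ℝ) : BLat.zero ∈ baseBall p a := by
  refine ⟨0, measurable_zero, ?_⟩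
  filter_upwards [Lp.coeFn_zero ℝ p (rectMeasure a)] with z hz
  rw [show (BLat.zero : UnitBall (Lp ℝ p (rectMeasure a))).1 z = 0 from hz]
  split_ifs <;> rfl

/-- Distances to `A` and to `B` are compared by the one-sided Hausdorff distance. -/
theorem infDist_le_infDist_add {X : Type*} [PseudoMetricSpace X] {A B : Set X} {ζ : ℝ}
    (hA : A.Nonempty) (h : ∀ a ∈ A, ∃ b ∈ B, dist a b ≤ ζ) (x : X) :
    Metric.infDist x B ≤ Metric.infDist x A + ζ := by
  rw [← sub_le_iff_le_add]
  refine (Metric.le_infDist hA).2 fun a ha => ?_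
  obtain ⟨b, hb, hab⟩ := h a ha
  have h1 := Metric.infDist_le_dist_of_mem hb (x := x)
  have h2 := dist_triangle x a b
  linarith

theorem zetaBound_nonneg (hp : p ≠ ∞) {r : ℝ} (h0 : 0 < r) (h1 : r < 1) : 0 ≤ zetaBound p r := by
  have h2 : (1 - r) ^ (1 / p.toReal) ≤ 1 :=
    Real.rpow_le_one (by linarith) (by linarith) (one_div_pos.2 (toReal_pos_of_fact hp)).le
  have h3 : 0 ≤ r ^ (1 / p.toReal) := Real.rpow_nonneg h0.le _
  rw [zetaBound]; linarith

/-- The rescaling isomorphism carries one base ball to within Hausdorff distance `ζ(r)` of the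
other. -/
theorem abs_infDist_sub_infDist_rescaleIso_le (hp : p ≠ ∞) {r : ℝ} (h0 : 0 < r) (h1 : r < 1)
    (f : UnitBall (Lp ℝ p (rectMeasure 2))) :
    |Metric.infDist f (baseBall p 2) -
      Metric.infDist ((rescaleIso hp h0 h1).ballMap f) (baseBall p 1)| ≤ zetaBound p r := by
  have hbound : ∀ (b : UnitBall (Lp ℝ p (rectMeasure 2))) (b' : UnitBall (Lp ℝ p (rectMeasure 1)))
      (g : ℝ → ℝ), Measurable g →
      (∀ᵐ z ∂(rectMeasure 2), b.1 z = if z.1 ≤ 1 then g z.1 else 0) →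
      (∀ᵐ z ∂(rectMeasure 1), b'.1 z = if z.1 ≤ 1 then g z.1 else 0) →
      dist ((rescaleIso hp h0 h1).ballMap b) b' ≤ zetaBound p r := fun b b' g hg hb hb' => by
    rw [Subtype.dist_eq, dist_eq_norm]
    refine (norm_rescaleIso_sub_le hp h0 h1 hg hb hb').trans ?_
    exact mul_le_of_le_one_right (zetaBound_nonneg hp h0 h1) (mem_closedBall_zero_iff.1 b'.2)
  rw [← Metric.infDist_image (rescaleIso hp h0 h1).isometry_ballMap (t := baseBall p 2)]
  have k1 := infDist_le_infDist_add (A := (rescaleIso hp h0 h1).ballMap '' baseBall p 2)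
    (B := baseBall p 1) (ζ := zetaBound p r) ⟨_, mem_image_of_mem _ (zero_mem_baseBall 2)⟩ (by
      rintro _ ⟨b, hb, rfl⟩
      obtain ⟨g, hg, hbg, b', hb'⟩ := exists_base_of_two b hb
      exact ⟨b', ⟨g, hg, hb'⟩, hbound b b' g hg hbg hb'⟩) ((rescaleIso hp h0 h1).ballMap f)
  have k2 := infDist_le_infDist_add (B := (rescaleIso hp h0 h1).ballMap '' baseBall p 2)
    (A := baseBall p 1) (ζ := zetaBound p r) ⟨_, zero_mem_baseBall 1⟩ (by
      intro b' hb'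
      obtain ⟨g, hg, hbg', b, hb⟩ := exists_base_of_one b' hb'
      refine ⟨_, mem_image_of_mem _ ⟨g, hg, hb⟩, ?_⟩
      rw [dist_comm]
      exact hbound b b' g hg hb hbg') ((rescaleIso hp h0 h1).ballMap f)
  rw [abs_le]
  constructor <;> linarith

end Rescaling

/-! ### Categoricity -/

section Categoricity

variable {p : ℝ≥0∞} [Fact (1 ≤ p)]

theorem BanachLatticeIso.ballMap_symm_ballMap {E F : Type*} [NormedAddCommGroup E]
    [NormedSpace ℝ E] [Lattice E] [IsBanachLattice E] [NormedAddCommGroup F] [NormedSpace ℝ F]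
    [Lattice F] [IsBanachLattice F] (L : BanachLatticeIso E F) (y : UnitBall F) :
    L.ballMap (L.symm.ballMap y) = y := Subtype.ext (L.apply_symm_apply y.1)

/-- Any two of the standard pairs are isomorphic up to `ζ(r)`, by the identity, the rescaling
isomorphism or its inverse. -/
theorem exists_iso_standard_pairs (hp : p ≠ ∞) {a b : ℝ} (ha : a = 1 ∨ a = 2) (hb : b = 1 ∨ b = 2)
    {r : ℝ} (h0 : 0 < r) (h1 : r < 1) :
    ∃ R : BanachLatticeIso (Lp ℝ p (rectMeasure a)) (Lp ℝ p (rectMeasure b)),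
      ∀ f, |Metric.infDist f (baseBall p a) - Metric.infDist (R.ballMap f) (baseBall p b)| ≤
        zetaBound p r := by
  have hrefl : ∀ c : ℝ, ∃ R : BanachLatticeIso (Lp ℝ p (rectMeasure c)) (Lp ℝ p (rectMeasure c)),
      ∀ f, |Metric.infDist f (baseBall p c) - Metric.infDist (R.ballMap f) (baseBall p c)| ≤
        zetaBound p r := fun c =>
    ⟨{ LinearIsometryEquiv.refl ℝ _ with map_sup' := fun _ _ => rfl, map_inf' := fun _ _ => rfl },
      fun f => by
        refine le_trans (le_of_eq ?_) (zetaBound_nonneg hp h0 h1)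
        exact abs_eq_zero.2 (sub_self _)⟩
  rcases ha with rfl | rfl <;> rcases hb with rfl | rfl
  · exact hrefl 1
  · refine ⟨(rescaleIso hp h0 h1).symm, fun f => ?_⟩
    have := abs_infDist_sub_infDist_rescaleIso_le hp h0 h1 ((rescaleIso hp h0 h1).symm.ballMap f)
    rwa [BanachLatticeIso.ballMap_symm_ballMap, abs_sub_comm] at this
  · exact ⟨rescaleIso hp h0 h1, abs_infDist_sub_infDist_rescaleIso_le hp h0 h1⟩
  · exact hrefl 2

/-- Both models are isomorphic to standard pairs, and these to each other up to `ζ(r)`. -/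
theorem IsModelALpLP.exists_iso {E : Type*} [NormedAddCommGroup E] [NormedSpace ℝ E] [Lattice E]
    [IsBanachLattice E] [TopologicalSpace.SeparableSpace E] {P : UnitBall E → ℝ} {F : Type*}
    [NormedAddCommGroup F] [NormedSpace ℝ F] [Lattice F] [IsBanachLattice F]
    [TopologicalSpace.SeparableSpace F] {Q : UnitBall F → ℝ} (hp : p ≠ ∞) (hP : IsModelALpLP p P)
    (hQ : IsModelALpLP p Q) {r : ℝ} (h0 : 0 < r) (h1 : r < 1) :
    ∃ ρ : BanachLatticeIso E F, ∀ f : UnitBall E, |P f - Q (ρ.ballMap f)| ≤ zetaBound p r := by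
  obtain ⟨a, ha, L, hL⟩ := hP.exists_iso_rectMeasure hp
  obtain ⟨b, hb, L', hL'⟩ := hQ.exists_iso_rectMeasure hp
  obtain ⟨R, hR⟩ := exists_iso_standard_pairs hp ha hb h0 h1
  refine ⟨L.trans (R.trans L'.symm), fun f => ?_⟩
  rw [hL, hL']
  have : L'.ballMap ((L.trans (R.trans L'.symm)).ballMap f) = R.ballMap (L.ballMap f) :=
    L'.ballMap_symm_ballMap (R.ballMap (L.ballMap f))
  rw [this]
  exact hR _

theorem exists_zetaBound_lt (hp : p ≠ ∞) {ε : ℝ} (hε : 0 < ε) :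
    ∃ r : ℝ, 0 < r ∧ r < 1 ∧ zetaBound p r < ε := by
  have hq : 0 < 1 / p.toReal := one_div_pos.2 (toReal_pos_of_fact hp)
  have hcont : ContinuousAt (zetaBound p) 0 := by
    have h1 : ContinuousAt (fun r : ℝ => (1 - r) ^ (1 / p.toReal)) 0 :=
      (continuousAt_const.sub continuousAt_id).rpow_const (Or.inr hq.le)
    have h2 : ContinuousAt (fun r : ℝ => r ^ (1 / p.toReal)) 0 :=
      continuousAt_id.rpow_const (Or.inr hq.le)
    exact (continuousAt_const.sub h1).add h2
  have h0 : zetaBound p 0 = 0 := by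
    rw [zetaBound, sub_zero, Real.one_rpow, Real.zero_rpow hq.ne']; ring
  have h1 : ∀ᶠ r in 𝓝[>] (0 : ℝ), zetaBound p r < ε :=
    (hcont.eventually (gt_mem_nhds (by rw [h0]; exact hε))).filter_mono nhdsWithin_le_nhds
  obtain ⟨r, hr, hr1⟩ := (h1.and (Ioo_mem_nhdsGT zero_lt_one)).exists
  exact ⟨r, hr1.1, hr1.2, hr⟩

end Categoricity

end

theorem mainTheorem10 (p : ℝ≥0∞) [Fact (1 ≤ p)] (hp : p ≠ ∞) :
    -- any two separable models are isomorphic up to an arbitrarily small perturbation of `P`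
    (∀ (E : Type*) [NormedAddCommGroup E] [NormedSpace ℝ E] [Lattice E] [IsBanachLattice E]
      [TopologicalSpace.SeparableSpace E] (P : UnitBall E → ℝ)
      (F : Type*) [NormedAddCommGroup F] [NormedSpace ℝ F] [Lattice F] [IsBanachLattice F]
      [TopologicalSpace.SeparableSpace F] (Q : UnitBall F → ℝ),
      IsModelALpLP p P → IsModelALpLP p Q →
      (∀ ε : ℝ, 0 < ε → ∃ ρ : BanachLatticeIso E F,
        ∀ f : UnitBall E, |P f - Q (ρ.ballMap f)| < ε) ∧
      (∀ r : ℝ, 0 < r → r < 1 → ∃ ρ : BanachLatticeIso E F,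
        ∀ f : UnitBall E, |P f - Q (ρ.ballMap f)| ≤ zetaBound p r)) ∧
    -- explicit rescaled isomorphism between the two standard pairs, with the same bound
    (∀ r : ℝ, 0 < r → r < 1 →
      ∃ ρ : BanachLatticeIso (Lp ℝ p (rectMeasure 2)) (Lp ℝ p (rectMeasure 1)),
        (∀ f : Lp ℝ p (rectMeasure 2), ∀ᵐ z ∂(rectMeasure 1),
          ρ.toLinearIsometryEquiv f z =
            if r ≤ z.2 then (1 - r) ^ (-(1 / p.toReal)) * f (z.1, (z.2 - r) / (1 - r))
            else r ^ (-(1 / p.toReal)) * f (z.1 + 1, z.2 / r)) ∧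
        ∀ f : UnitBall (Lp ℝ p (rectMeasure 2)),
          |Metric.infDist f (baseBall p 2) - Metric.infDist (ρ.ballMap f) (baseBall p 1)|
            ≤ zetaBound p r) := by
  refine ⟨?_, fun r h0 h1 => ⟨rescaleIso hp h0 h1, rescaleIso_coeFn hp h0 h1,
    abs_infDist_sub_infDist_rescaleIso_le hp h0 h1⟩⟩
  intro E _ _ _ _ _ P F _ _ _ _ _ Q hP hQ
  refine ⟨fun ε hε => ?_, fun r h0 h1 => hP.exists_iso hp hQ h0 h1⟩
  obtain ⟨r, h0, h1, hr⟩ := exists_zetaBound_lt hp hε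
  obtain ⟨ρ, hρ⟩ := hP.exists_iso hp hQ h0 h1
  exact ⟨ρ, fun f => (hρ f).trans_lt hr⟩
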